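/- Let $k$ be a field and $B$ a unital $k$-algebra. A left $B$-bialgebroid is a $k$-algebra $L$ with an algebra map $s:B\to L$, $b\mapsto b$, and an antialgebra map $t:B\to L$, $b\mapsto\bar b$, with commuting images, and a $B$-coring structure $\Delta X=X_1\diamond X_2$, $\varepsilon:L\to B$, where $L\diamond_B M=L\otimes M/\langle \bar bX\otimes m-X\otimes bm\rangle$, such that $\Delta$ is an algebra map into the Takeuchi product ($X_1\bar b\diamond X_2=X_1\diamond X_2b$) and $\varepsilon(1)=1$, $\varepsilon(XY)=\varepsilon(X\varepsilon(Y))=\varepsilon(X\overline{\varepsilon(Y)})$. It is a left Hopf algebroid if $\lambda:L\otimes_{\bar B}L\to L\diamond_BL$, $X\otimes Y\mapsto X_1\diamond X_2Y$ is bijective, where $L\otimes_{\bar B}L=L\otimes L/\langle X\bar b\otimes Y-X\otimes\bar bY\rangle$; write $X_+\otimes X_-=\lambda^{-1}(X\diamond 1)$. A left $L$-comodule is a $B$-bimodule $M$ with a coassociative, counital $B$-bimodule map $\delta:M\to L\diamond_BM$, $m\mapsto m_{-1}\diamond m_0$ (so $\delta(amb)=am_{-1}b\diamond m_0$) with $m_{-1}\bar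 b\diamond m_0=m_{-1}\diamond m_0b$. A left 2-cocycle is a $k$-linear map $\Gamma:L\otimes_{\bar B}L\to B$ with $\Gamma(\bar bX,Y)=\Gamma(X,Y)b$, $\Gamma(X,\Gamma(Y_1,Z_1)Y_2Z_2)=\Gamma(\Gamma(X_1,Y_1)X_2Y_2,Z)$ and $\Gamma(1,X)=\varepsilon(X)=\Gamma(X,1)$. Put $a\cdot_\Gamma b=\Gamma(a,b)$ on $B$ (the algebra $B^\Gamma$) and $a\cdot_\Gamma m=\Gamma(a,m_{-1})m_0$, $m\cdot_\Gamma a=\Gamma(m_{-1},a)m_0$ on a comodule $M$. Then $\Gamma^\#_{M,N}:M\otimes_{B^\Gamma}N\to M\otimes_BN$, $m\otimes n\mapsto\Gamma(m_{-1},n_{-1})m_0\otimes n_0$, is well defined; $\Gamma$ is called invertible if $\Gamma^\#_{M,N}$ is bijective for all left $L$-comodules $M,N$. The cotwist $L^\Gamma$ is the vector space $L$ with base $B^\Gamma$, the same $s,t$ and units, and $$X\cdot_\Gamma Y=\Gamma(X_1,Y_1)\,X_{2+}Y_{2+}\,\overline{\Gamma(Y_{2-},X_{2-})},\quad \varepsilon^\Gamma(X)=\Gamma(X_+,X_-),\quad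 \Delta^\Gamma=(\Gamma^\#)^{-1}\circ\Delta,$$ where here $\Gamma^\#:L\diamond_{B^\Gamma}M\to L\diamond_BM$, $X\diamond m\mapsto X_+\overline{\Gamma(X_-,m_{-1})}\diamond m_0$ (with $M=L$ and $\delta=\Delta$). A left $L$-comodule $M$ gives the left $L^\Gamma$-comodule $M^\Gamma$: the same space with the actions $\cdot_\Gamma$ and the coaction $(\Gamma^\#)^{-1}\circ\delta$. **Theorem.** Let $L$ be a left Hopf algebroid over $B$ such that all four $B$- and $\bar B$-module structures $bX$, $Xb$, $\bar bX$, $X\bar b$ on $L$ are faithfully flat, and let $\Gamma$ be an invertible left 2-cocycle on $L$. Then $L^\Gamma$ is a left Hopf algebroid over $B^\Gamma$, and $$\Sigma(X,Y)=\Gamma\big(X_+Y_+,\ \Gamma(Y_{-1},X_{-1})\,Y_{-2}\,X_{-2}\big),\qquad X_{-1}\diamond X_{-2}:=\Delta(X_-),$$ is a well-defined invertible left 2-cocycle on $L^\Gamma$. Every left $L$-comodule $M$ has a cotwist $M^\Gamma$, every left $L^\Gamma$-comodule is of this form, and $\Sigma^\#_{M^\Gamma,N^\Gamma}:M\otimes_BN\to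 M\otimes_{B^\Gamma}N$ is the two-sided inverse of $\Gamma^\#_{M,N}$ for all left $L$-comodules $M,N$. Moreover $(L^\Gamma)^\Sigma=L$ as left Hopf algebroids. (One writes $\Sigma=:\Gamma^{-1}$.) -/

import Mathlib

open scoped TensorProduct

universe v u

namespace HopfCotwist

/-! ### Algebras on a fixed vector space, balanced tensor products -/

/-- An associative unital `k`-algebra structure on a given `k`-vector space `V`.
(The cotwist changes the products of `B` and of `L` but not the underlying vector spaces, so the
products have to be data.) -/
structure AlgebraOn (k : Type v) [Field k] (V : Type u) [AddCommGroup V] [Module k V] where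
  mul : V →ₗ[k] V →ₗ[k] V
  one : V
  mul_assoc : ∀ x y z : V, mul (mul x y) z = mul x (mul y z)
  one_mul : ∀ x : V, mul one x = x
  mul_one : ∀ x : V, mul x one = x

section Balanced

variable {k : Type v} [Field k] {B M P N : Type u}
  [AddCommGroup B] [Module k B] [AddCommGroup M] [Module k M]
  [AddCommGroup P] [Module k P] [AddCommGroup N] [Module k N]

/-- The relations `m·b ⊗ n - m ⊗ b·n`. -/
def balRel (r : M →ₗ[k] B →ₗ[k] M) (l : B →ₗ[k] N →ₗ[k] N) : Submodule k (M ⊗[k] N) :=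
  Submodule.span k {z | ∃ (m : M) (b : B) (n : N), z = r m b ⊗ₜ[k] n - m ⊗ₜ[k] l b n}

/-- The balanced tensor product: `M ⊗ N` modulo `m·b ⊗ n = m ⊗ b·n`. -/
abbrev Bal (r : M →ₗ[k] B →ₗ[k] M) (l : B →ₗ[k] N →ₗ[k] N) : Type u :=
  (M ⊗[k] N) ⧸ balRel r l

/-- The projection of `M ⊗ N` onto the balanced tensor product. -/
abbrev toBal (r : M →ₗ[k] B →ₗ[k] M) (l : B →ₗ[k] N →ₗ[k] N) : M ⊗[k] N →ₗ[k] Bal r l :=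
  (balRel r l).mkQ

theorem toBal_rel (r : M →ₗ[k] B →ₗ[k] M) (l : B →ₗ[k] N →ₗ[k] N) (m : M) (b : B) (n : N) :
    toBal r l (r m b ⊗ₜ[k] n) = toBal r l (m ⊗ₜ[k] l b n) := by
  rw [← sub_eq_zero, ← map_sub]
  exact (Submodule.Quotient.mk_eq_zero _).2 (Submodule.subset_span ⟨m, b, n, rfl⟩)

theorem balRel_le_ker {Q : Type*} [AddCommGroup Q] [Module k Q]
    (r : M →ₗ[k] B →ₗ[k] M) (l : B →ₗ[k] N →ₗ[k] N) (f : M ⊗[k] N →ₗ[k] Q)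
    (h : ∀ m b n, f (r m b ⊗ₜ[k] n) = f (m ⊗ₜ[k] l b n)) : balRel r l ≤ LinearMap.ker f := by
  refine Submodule.span_le.2 ?_
  rintro z ⟨m, b, n, rfl⟩
  simp [h]

/-- A linear map on `M ⊗ N` that respects the relations descends to the balanced tensor product. -/
def balLift {Q : Type*} [AddCommGroup Q] [Module k Q]
    (r : M →ₗ[k] B →ₗ[k] M) (l : B →ₗ[k] N →ₗ[k] N) (f : M ⊗[k] N →ₗ[k] Q)
    (h : ∀ m b n, f (r m b ⊗ₜ[k] n) = f (m ⊗ₜ[k] l b n)) : Bal r l →ₗ[k] Q :=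
  (balRel r l).liftQ f (balRel_le_ker r l f h)

@[simp] theorem balLift_toBal {Q : Type*} [AddCommGroup Q] [Module k Q]
    (r : M →ₗ[k] B →ₗ[k] M) (l : B →ₗ[k] N →ₗ[k] N) (f : M ⊗[k] N →ₗ[k] Q)
    (h : ∀ m b n, f (r m b ⊗ₜ[k] n) = f (m ⊗ₜ[k] l b n)) (z : M ⊗[k] N) :
    balLift r l f h (toBal r l z) = f z := rfl

/-- The relations of a threefold balanced tensor product. -/
def tripleRel (r₁ : M →ₗ[k] B →ₗ[k] M) (l₁ : B →ₗ[k] P →ₗ[k] P)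
    (r₂ : P →ₗ[k] B →ₗ[k] P) (l₂ : B →ₗ[k] N →ₗ[k] N) : Submodule k (M ⊗[k] (P ⊗[k] N)) :=
  Submodule.span k
    ({z | ∃ (m : M) (b : B) (p : P) (n : N),
        z = r₁ m b ⊗ₜ[k] (p ⊗ₜ[k] n) - m ⊗ₜ[k] (l₁ b p ⊗ₜ[k] n)} ∪
     {z | ∃ (m : M) (b : B) (p : P) (n : N),
        z = m ⊗ₜ[k] (r₂ p b ⊗ₜ[k] n) - m ⊗ₜ[k] (p ⊗ₜ[k] l₂ b n)})

/-- The threefold balanced tensor product. -/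
abbrev Triple (r₁ : M →ₗ[k] B →ₗ[k] M) (l₁ : B →ₗ[k] P →ₗ[k] P)
    (r₂ : P →ₗ[k] B →ₗ[k] P) (l₂ : B →ₗ[k] N →ₗ[k] N) : Type u :=
  (M ⊗[k] (P ⊗[k] N)) ⧸ tripleRel r₁ l₁ r₂ l₂

/-- The canonical map from `M ⊗ (P ⊗_B N)` to the threefold balanced tensor product. -/
def tripleR (r₁ : M →ₗ[k] B →ₗ[k] M) (l₁ : B →ₗ[k] P →ₗ[k] P)
    (r₂ : P →ₗ[k] B →ₗ[k] P) (l₂ : B →ₗ[k] N →ₗ[k] N) :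
    M ⊗[k] Bal r₂ l₂ →ₗ[k] Triple r₁ l₁ r₂ l₂ :=
  TensorProduct.lift (LinearMap.flip (balLift r₂ l₂
    (LinearMap.flip ((TensorProduct.mk k M (P ⊗[k] N)).compr₂ (tripleRel r₁ l₁ r₂ l₂).mkQ))
    (by
      intro p b n
      ext m
      exact (Submodule.Quotient.eq _).2 (Submodule.subset_span (Or.inr ⟨m, b, p, n, rfl⟩)))))

/-- The canonical map from `(M ⊗_B P) ⊗ N` to the threefold balanced tensor product. -/
def tripleL (r₁ : M →ₗ[k] B →ₗ[k] M) (l₁ : B →ₗ[k] P →ₗ[k] P)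
    (r₂ : P →ₗ[k] B →ₗ[k] P) (l₂ : B →ₗ[k] N →ₗ[k] N) :
    Bal r₁ l₁ ⊗[k] N →ₗ[k] Triple r₁ l₁ r₂ l₂ :=
  TensorProduct.lift (balLift r₁ l₁
    (TensorProduct.curry ((tripleRel r₁ l₁ r₂ l₂).mkQ ∘ₗ
      (TensorProduct.assoc k M P N).toLinearMap))
    (by
      intro m b p
      ext n
      exact (Submodule.Quotient.eq _).2 (Submodule.subset_span (Or.inl ⟨m, b, p, n, rfl⟩))))

@[simp] theorem tripleR_tmul (r₁ : M →ₗ[k] B →ₗ[k] M) (l₁ : B →ₗ[k] P →ₗ[k] P)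
    (r₂ : P →ₗ[k] B →ₗ[k] P) (l₂ : B →ₗ[k] N →ₗ[k] N) (m : M) (z : P ⊗[k] N) :
    tripleR r₁ l₁ r₂ l₂ (m ⊗ₜ[k] toBal r₂ l₂ z) = (tripleRel r₁ l₁ r₂ l₂).mkQ (m ⊗ₜ[k] z) := rfl

@[simp] theorem tripleL_tmul (r₁ : M →ₗ[k] B →ₗ[k] M) (l₁ : B →ₗ[k] P →ₗ[k] P)
    (r₂ : P →ₗ[k] B →ₗ[k] P) (l₂ : B →ₗ[k] N →ₗ[k] N) (z : M ⊗[k] P) (n : N) :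
    tripleL r₁ l₁ r₂ l₂ (toBal r₁ l₁ z ⊗ₜ[k] n) =
      (tripleRel r₁ l₁ r₂ l₂).mkQ (TensorProduct.assoc k M P N (z ⊗ₜ[k] n)) := rfl

end Balanced

/-! ### Modules over `B` and faithful flatness (`B` need not be commutative) -/

section Flat

variable {k : Type v} [Field k] {B : Type u} [AddCommGroup B] [Module k B]

/-- `act` is a left module structure over the algebra `A`. -/
structure IsLeftModule (A : AlgebraOn k B) {V : Type u} [AddCommGroup V] [Module k V]
    (act : B →ₗ[k] V →ₗ[k] V) : Prop where
  one_act : ∀ x : V, act A.one x = x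
  mul_act : ∀ (a b : B) (x : V), act (A.mul a b) x = act a (act b x)

/-- `act` is a right module structure over the algebra `A`. -/
structure IsRightModule (A : AlgebraOn k B) {V : Type u} [AddCommGroup V] [Module k V]
    (act : V →ₗ[k] B →ₗ[k] V) : Prop where
  act_one : ∀ x : V, act x A.one = x
  act_mul : ∀ (a b : B) (x : V), act x (A.mul a b) = act (act x a) b

/-- The map `f ⊗_B g` for `f` right linear and `g` left linear. -/
def balMap {V V' N N' : Type u} [AddCommGroup V] [Module k V] [AddCommGroup V'] [Module k V']
    [AddCommGroup N] [Module k N] [AddCommGroup N'] [Module k N']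
    (r : V →ₗ[k] B →ₗ[k] V) (r' : V' →ₗ[k] B →ₗ[k] V')
    (l : B →ₗ[k] N →ₗ[k] N) (l' : B →ₗ[k] N' →ₗ[k] N')
    (f : V →ₗ[k] V') (hf : ∀ x b, f (r x b) = r' (f x) b)
    (g : N →ₗ[k] N') (hg : ∀ b x, g (l b x) = l' b (g x)) : Bal r l →ₗ[k] Bal r' l' :=
  balLift r l (toBal r' l' ∘ₗ TensorProduct.map f g) (by
    intro m b n
    simpa [hf, hg] using toBal_rel r' l' (f m) b (g n))

/-- The left `A`-module `(N, l)` is faithfully flat: `- ⊗_A N` preserves injective maps of right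
modules and kills no nonzero right module. -/
def IsFaithfullyFlatLeft (A : AlgebraOn k B) {N : Type u} [AddCommGroup N] [Module k N]
    (l : B →ₗ[k] N →ₗ[k] N) : Prop :=
  (∀ (V V' : Type u) [AddCommGroup V] [Module k V] [AddCommGroup V'] [Module k V']
      (r : V →ₗ[k] B →ₗ[k] V) (r' : V' →ₗ[k] B →ₗ[k] V'),
      IsRightModule A r → IsRightModule A r' →
      ∀ (f : V →ₗ[k] V') (hf : ∀ x b, f (r x b) = r' (f x) b), Function.Injective f →
        Function.Injective (balMap r r' l l f hf LinearMap.id (fun _ _ => rfl))) ∧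
  (∀ (V : Type u) [AddCommGroup V] [Module k V] (r : V →ₗ[k] B →ₗ[k] V),
      IsRightModule A r → Subsingleton (Bal r l) → Subsingleton V)

/-- The right `A`-module `(N, r)` is faithfully flat. -/
def IsFaithfullyFlatRight (A : AlgebraOn k B) {N : Type u} [AddCommGroup N] [Module k N]
    (r : N →ₗ[k] B →ₗ[k] N) : Prop :=
  (∀ (V V' : Type u) [AddCommGroup V] [Module k V] [AddCommGroup V'] [Module k V']
      (l : B →ₗ[k] V →ₗ[k] V) (l' : B →ₗ[k] V' →ₗ[k] V'),
      IsLeftModule A l → IsLeftModule A l' →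
      ∀ (f : V →ₗ[k] V') (hf : ∀ b x, f (l b x) = l' b (f x)), Function.Injective f →
        Function.Injective (balMap r r l l' LinearMap.id (fun _ _ => rfl) f hf)) ∧
  (∀ (V : Type u) [AddCommGroup V] [Module k V] (l : B →ₗ[k] V →ₗ[k] V),
      IsLeftModule A l → Subsingleton (Bal r l) → Subsingleton V)

end Flat

/-! ### Left bialgebroids and left Hopf algebroids -/

/-- A `B^e`-ring: an algebra `L` with an algebra map `s` and an antialgebra map `t` from `B`
whose images commute. One writes `b` for `s b` and `b̄` for `t b`. -/
structure EnvRing (k : Type v) [Field k] (B L : Type u) [AddCommGroup B] [Module k B]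
    [AddCommGroup L] [Module k L] where
  algB : AlgebraOn k B
  algL : AlgebraOn k L
  s : B →ₗ[k] L
  t : B →ₗ[k] L
  s_one : s algB.one = algL.one
  s_mul : ∀ a b, s (algB.mul a b) = algL.mul (s a) (s b)
  t_one : t algB.one = algL.one
  t_mul : ∀ a b, t (algB.mul a b) = algL.mul (t b) (t a)
  s_t_comm : ∀ a b, algL.mul (s a) (t b) = algL.mul (t b) (s a)

section Main

variable {k : Type v} [Field k] {B L : Type u} [AddCommGroup B] [Module k B]
  [AddCommGroup L] [Module k L]

namespace EnvRing

/-- `b, X ↦ b X`. -/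
def sL (R : EnvRing k B L) : B →ₗ[k] L →ₗ[k] L := R.algL.mul ∘ₗ R.s
/-- `b, X ↦ b̄ X`. -/
def tL (R : EnvRing k B L) : B →ₗ[k] L →ₗ[k] L := R.algL.mul ∘ₗ R.t
/-- `X, b ↦ X b`. -/
def sR (R : EnvRing k B L) : L →ₗ[k] B →ₗ[k] L := R.algL.mul.compl₂ R.s
/-- `X, b ↦ X b̄`. -/
def tR (R : EnvRing k B L) : L →ₗ[k] B →ₗ[k] L := R.algL.mul.compl₂ R.t

@[simp] theorem sL_apply (R : EnvRing k B L) (b : B) (X : L) :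
    R.sL b X = R.algL.mul (R.s b) X := rfl
@[simp] theorem tL_apply (R : EnvRing k B L) (b : B) (X : L) :
    R.tL b X = R.algL.mul (R.t b) X := rfl
@[simp] theorem sR_apply (R : EnvRing k B L) (X : L) (b : B) :
    R.sR X b = R.algL.mul X (R.s b) := rfl
@[simp] theorem tR_apply (R : EnvRing k B L) (X : L) (b : B) :
    R.tR X b = R.algL.mul X (R.t b) := rfl

/-- `L ⋄_B M`, that is, `L ⊗ M` modulo `b̄ X ⊗ m = X ⊗ b m`, for a left `B`-action `l` on `M`. -/
abbrev Dia (R : EnvRing k B L) {M : Type u} [AddCommGroup M] [Module k M]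
    (l : B →ₗ[k] M →ₗ[k] M) : Type u := Bal R.tL.flip l

/-- The projection `L ⊗ M → L ⋄_B M`. -/
abbrev toDia (R : EnvRing k B L) {M : Type u} [AddCommGroup M] [Module k M]
    (l : B →ₗ[k] M →ₗ[k] M) : L ⊗[k] M →ₗ[k] R.Dia l := toBal R.tL.flip l

/-- `L ⊗_{B̄} L`, that is, `L ⊗ L` modulo `X b̄ ⊗ Y = X ⊗ b̄ Y`. -/
abbrev OpTensor (R : EnvRing k B L) : Type u := Bal R.tR R.tL

/-- The projection `L ⊗ L → L ⊗_{B̄} L`. -/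
abbrev toOp (R : EnvRing k B L) : L ⊗[k] L →ₗ[k] R.OpTensor := toBal R.tR R.tL

end EnvRing

end Main

/-- A left `B`-bialgebroid. Sweedler formulas are stated for every element `u` of `L ⊗ L` that
represents `Δ X = X₁ ⋄ X₂`. -/
structure LeftBialgebroid (k : Type v) [Field k] (B L : Type u) [AddCommGroup B] [Module k B]
    [AddCommGroup L] [Module k L] extends EnvRing k B L where
  Δ : L →ₗ[k] toEnvRing.Dia toEnvRing.sL
  ε : L →ₗ[k] B
  /-- `Δ (a b̄ X) = a X₁ ⋄ b̄ X₂`. -/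
  Δ_bilin : ∀ (a b : B) (X : L) (u : L ⊗[k] L), toEnvRing.toDia toEnvRing.sL u = Δ X →
    Δ (algL.mul (s a) (algL.mul (t b) X)) =
      toEnvRing.toDia toEnvRing.sL (TensorProduct.map (toEnvRing.sL a) (toEnvRing.tL b) u)
  /-- The image of `Δ` lies in the Takeuchi product: `X₁ ā ⋄ X₂ = X₁ ⋄ X₂ a`. -/
  Δ_takeuchi : ∀ (a : B) (X : L) (u : L ⊗[k] L), toEnvRing.toDia toEnvRing.sL u = Δ X →
    toEnvRing.toDia toEnvRing.sL (TensorProduct.map (toEnvRing.tR.flip a) LinearMap.id u) =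
      toEnvRing.toDia toEnvRing.sL (TensorProduct.map LinearMap.id (toEnvRing.sR.flip a) u)
  /-- Coassociativity in `L ⋄ L ⋄ L`. -/
  coassoc : ∀ (X : L) (u : L ⊗[k] L), toEnvRing.toDia toEnvRing.sL u = Δ X →
    tripleR toEnvRing.tL.flip toEnvRing.sL toEnvRing.tL.flip toEnvRing.sL
        (TensorProduct.map LinearMap.id Δ u) =
      tripleL toEnvRing.tL.flip toEnvRing.sL toEnvRing.tL.flip toEnvRing.sL
        (TensorProduct.map Δ LinearMap.id u)
  /-- `Δ` is unital and multiplicative. -/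
  Δ_one : Δ algL.one = toEnvRing.toDia toEnvRing.sL (algL.one ⊗ₜ[k] algL.one)
  Δ_mul : ∀ (X Y : L) (u w : L ⊗[k] L), toEnvRing.toDia toEnvRing.sL u = Δ X →
    toEnvRing.toDia toEnvRing.sL w = Δ Y →
    Δ (algL.mul X Y) = toEnvRing.toDia toEnvRing.sL (TensorProduct.map₂ algL.mul algL.mul u w)
  /-- `ε (a b̄ X) = a ε(X) b`. -/
  ε_bilin : ∀ (a b : B) (X : L),
    ε (algL.mul (s a) (algL.mul (t b) X)) = algB.mul a (algB.mul (ε X) b)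
  /-- `ε(X₁) X₂ = X`. -/
  counit_left : ∀ (X : L) (u : L ⊗[k] L), toEnvRing.toDia toEnvRing.sL u = Δ X →
    TensorProduct.lift (toEnvRing.sL ∘ₗ ε) u = X
  /-- `\overline{ε(X₂)} X₁ = X`. -/
  counit_right : ∀ (X : L) (u : L ⊗[k] L), toEnvRing.toDia toEnvRing.sL u = Δ X →
    TensorProduct.lift (toEnvRing.tL ∘ₗ ε).flip u = X
  ε_one : ε algL.one = algB.one
  ε_mul_s : ∀ X Y : L, ε (algL.mul X Y) = ε (algL.mul X (s (ε Y)))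
  ε_mul_t : ∀ X Y : L, ε (algL.mul X Y) = ε (algL.mul X (t (ε Y)))

section Main

variable {k : Type v} [Field k] {B L : Type u} [AddCommGroup B] [Module k B]
  [AddCommGroup L] [Module k L]

namespace LeftBialgebroid

/-- `L ⋄_B L`. -/
abbrev DiaL (H : LeftBialgebroid k B L) : Type u := H.toEnvRing.Dia H.toEnvRing.sL

/-- The projection `L ⊗ L → L ⋄_B L`. -/
abbrev toDiaL (H : LeftBialgebroid k B L) : L ⊗[k] L →ₗ[k] H.DiaL :=
  H.toEnvRing.toDia H.toEnvRing.sL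

theorem Δ_mul_t (H : LeftBialgebroid k B L) (X : L) (b : B) (u : L ⊗[k] L)
    (hu : H.toDiaL u = H.Δ X) :
    H.Δ (H.algL.mul X (H.t b)) =
      H.toDiaL (TensorProduct.map LinearMap.id (H.algL.mul.flip (H.t b)) u) := by
  have h1 : H.Δ (H.t b) = H.toDiaL (H.algL.one ⊗ₜ[k] H.t b) := by
    have h := H.Δ_bilin H.algB.one b H.algL.one (H.algL.one ⊗ₜ[k] H.algL.one) H.Δ_one.symm
    simpa [H.s_one, H.algL.one_mul, H.algL.mul_one] using h
  rw [H.Δ_mul X (H.t b) u _ hu h1.symm]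
  congr 1
  clear hu
  induction u using TensorProduct.induction_on with
  | zero => simp
  | tmul x y => simp [H.algL.mul_one]
  | add x y hx hy => simp only [map_add, LinearMap.add_apply, hx, hy]

theorem Δ_s (H : LeftBialgebroid k B L) (b : B) :
    H.Δ (H.s b) = H.toDiaL (H.s b ⊗ₜ[k] H.algL.one) := by
  have h := H.Δ_bilin b H.algB.one H.algL.one (H.algL.one ⊗ₜ[k] H.algL.one) H.Δ_one.symm
  simpa [H.t_one, H.algL.one_mul, H.algL.mul_one] using h

/-- `(X ⋄ Z), Y ↦ X ⋄ Z Y`. -/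
def diaMulRight (H : LeftBialgebroid k B L) : H.DiaL →ₗ[k] L →ₗ[k] H.DiaL :=
  balLift H.tL.flip H.sL
    (TensorProduct.lift (LinearMap.mk₂ k
      (fun X Z => H.toDiaL ∘ₗ (TensorProduct.mk k L L X) ∘ₗ H.algL.mul Z)
      (by intros; ext; simp)
      (by
        intro c X Z
        ext Y
        change H.toDiaL ((c • X) ⊗ₜ[k] _) = c • H.toDiaL (X ⊗ₜ[k] _)
        rw [← map_smul, TensorProduct.smul_tmul'])
      (by intros; ext; simp [TensorProduct.tmul_add])
      (by intros; ext; simp)))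
    (by
      intro X b Z
      ext Y
      simpa [H.algL.mul_assoc] using toBal_rel H.tL.flip H.sL X b (H.algL.mul Z Y))

@[simp] theorem diaMulRight_tmul (H : LeftBialgebroid k B L) (X Z Y : L) :
    H.diaMulRight (H.toDiaL (X ⊗ₜ[k] Z)) Y = H.toDiaL (X ⊗ₜ[k] H.algL.mul Z Y) := rfl

/-- The Hopf-Galois map `λ : L ⊗_{B̄} L → L ⋄_B L`, `X ⊗ Y ↦ X₁ ⋄ X₂ Y`. -/
def hopfMap (H : LeftBialgebroid k B L) : H.OpTensor →ₗ[k] H.DiaL :=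
  balLift H.tR H.tL (TensorProduct.lift (H.diaMulRight ∘ₗ H.Δ)) (by
    intro X b Y
    obtain ⟨u, hu⟩ := Submodule.mkQ_surjective _ (H.Δ X)
    simp only [TensorProduct.lift.tmul, LinearMap.comp_apply, EnvRing.tR_apply,
      EnvRing.tL_apply]
    rw [H.Δ_mul_t X b u hu, ← hu]
    clear hu
    change H.diaMulRight _ Y = H.diaMulRight (H.toDiaL u) _
    induction u using TensorProduct.induction_on with
    | zero => simp
    | tmul x y =>
      rw [TensorProduct.map_tmul, diaMulRight_tmul, diaMulRight_tmul]
      simp [H.algL.mul_assoc]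
    | add x y hx hy => simp only [map_add, LinearMap.add_apply] at hx hy ⊢; rw [hx, hy])

/-- A left comodule over a left bialgebroid: a `B`-bimodule `M` with a `B`-bimodule map
`M → L ×_B M ⊆ L ⋄_B M`, `m ↦ m₋₁ ⋄ m₀`, that is coassociative and counital. -/
structure Comodule (H : LeftBialgebroid k B L) (M : Type u) [AddCommGroup M] [Module k M] where
  lact : B →ₗ[k] M →ₗ[k] M
  ract : M →ₗ[k] B →ₗ[k] M
  lact_module : IsLeftModule H.algB lact
  ract_module : IsRightModule H.algB ract
  lact_ract : ∀ (a b : B) (m : M), ract (lact a m) b = lact a (ract m b)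
  δ : M →ₗ[k] H.Dia lact
  /-- `δ (a m b) = a m₋₁ b ⋄ m₀`. -/
  δ_bilin : ∀ (a b : B) (m : M) (u : L ⊗[k] M), H.toDia lact u = δ m →
    δ (lact a (ract m b)) =
      H.toDia lact (TensorProduct.map (H.sL a ∘ₗ H.sR.flip b) LinearMap.id u)
  /-- `m₋₁ ā ⋄ m₀ = m₋₁ ⋄ m₀ a`. -/
  δ_takeuchi : ∀ (a : B) (m : M) (u : L ⊗[k] M), H.toDia lact u = δ m →
    H.toDia lact (TensorProduct.map (H.tR.flip a) LinearMap.id u) =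
      H.toDia lact (TensorProduct.map LinearMap.id (ract.flip a) u)
  /-- Coassociativity in `L ⋄ L ⋄ M`. -/
  coassoc : ∀ (m : M) (u : L ⊗[k] M), H.toDia lact u = δ m →
    tripleR H.tL.flip H.sL H.tL.flip lact (TensorProduct.map LinearMap.id δ u) =
      tripleL H.tL.flip H.sL H.tL.flip lact (TensorProduct.map H.Δ LinearMap.id u)
  /-- `ε(m₋₁) m₀ = m`. -/
  counit : ∀ (m : M) (u : L ⊗[k] M), H.toDia lact u = δ m →
    TensorProduct.lift (lact ∘ₗ H.ε) u = m

/-- `(X₁ ⊗ X₂), (Y₁ ⊗ Y₂) ↦ Γ(X₁, Y₁) X₂ Y₂`. -/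
def twMul (H : LeftBialgebroid k B L) (Γ : L →ₗ[k] L →ₗ[k] B) :
    L ⊗[k] L →ₗ[k] L ⊗[k] L →ₗ[k] L :=
  (TensorProduct.map₂ Γ H.algL.mul).compr₂ (TensorProduct.lift H.sL)

@[simp] theorem twMul_tmul (H : LeftBialgebroid k B L) (Γ : L →ₗ[k] L →ₗ[k] B)
    (X₁ X₂ Y₁ Y₂ : L) :
    H.twMul Γ (X₁ ⊗ₜ[k] X₂) (Y₁ ⊗ₜ[k] Y₂) =
      H.algL.mul (H.s (Γ X₁ Y₁)) (H.algL.mul X₂ Y₂) := by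
  simp [twMul]

/-- A left 2-cocycle on a left bialgebroid. -/
structure TwoCocycle (H : LeftBialgebroid k B L) where
  Γ : L →ₗ[k] L →ₗ[k] B
  /-- `Γ` is defined on `L ⊗_{B̄} L`. -/
  balanced : ∀ (X Y : L) (b : B), Γ (H.algL.mul X (H.t b)) Y = Γ X (H.algL.mul (H.t b) Y)
  /-- `Γ` is left `B̄`-linear, where `b̄` acts on `B` by right multiplication by `b`. -/
  linear : ∀ (X Y : L) (b : B), Γ (H.algL.mul (H.t b) X) Y = H.algB.mul (Γ X Y) b
  /-- `Γ(X, Γ(Y₁, Z₁) Y₂ Z₂) = Γ(Γ(X₁, Y₁) X₂ Y₂, Z)`. -/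
  cocycle : ∀ (X Y Z : L) (u w z : L ⊗[k] L),
    H.toDiaL u = H.Δ X → H.toDiaL w = H.Δ Y → H.toDiaL z = H.Δ Z →
      Γ X (H.twMul Γ w z) = Γ (H.twMul Γ u w) Z
  one_left : ∀ X : L, Γ H.algL.one X = H.ε X
  one_right : ∀ X : L, Γ X H.algL.one = H.ε X

end LeftBialgebroid

namespace LeftBialgebroid.TwoCocycle

variable {H : LeftBialgebroid k B L} {M N : Type u} [AddCommGroup M] [Module k M]
  [AddCommGroup N] [Module k N]

/-- `(X ⋄ m), Y ↦ Γ(X, Y) m`. -/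
def evalR (G : H.TwoCocycle) (cM : H.Comodule M) : H.Dia cM.lact →ₗ[k] L →ₗ[k] M :=
  balLift H.tL.flip cM.lact
    (TensorProduct.lift (LinearMap.mk₂ k (fun X m => cM.lact.flip m ∘ₗ G.Γ X)
      (by intros; ext; simp) (by intros; ext; simp)
      (by intros; ext; simp) (by intros; ext; simp)))
    (by
      intro X b m
      ext Y
      simp [G.linear, cM.lact_module.mul_act])

/-- `(X ⋄ m), a ↦ Γ(a, X) m`. -/
def evalL (G : H.TwoCocycle) (cM : H.Comodule M) : H.Dia cM.lact →ₗ[k] B →ₗ[k] M :=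
  balLift H.tL.flip cM.lact
    (TensorProduct.lift (LinearMap.mk₂ k (fun X m => cM.lact.flip m ∘ₗ G.Γ.flip X ∘ₗ H.s)
      (by intros; ext; simp) (by intros; ext; simp)
      (by intros; ext; simp) (by intros; ext; simp)))
    (by
      intro X b m
      ext a
      simp [← G.balanced, H.s_t_comm, G.linear, cM.lact_module.mul_act])

@[simp] theorem evalR_tmul (G : H.TwoCocycle) (cM : H.Comodule M) (X Y : L) (m : M) :
    G.evalR cM (H.toDia cM.lact (X ⊗ₜ[k] m)) Y = cM.lact (G.Γ X Y) m := rfl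

@[simp] theorem evalL_tmul (G : H.TwoCocycle) (cM : H.Comodule M) (X : L) (a : B) (m : M) :
    G.evalL cM (H.toDia cM.lact (X ⊗ₜ[k] m)) a = cM.lact (G.Γ (H.s a) X) m := rfl

/-- The twisted left action `a ·_Γ m = Γ(a, m₋₁) m₀`. -/
def twL (G : H.TwoCocycle) (cM : H.Comodule M) : B →ₗ[k] M →ₗ[k] M :=
  (G.evalL cM ∘ₗ cM.δ).flip

/-- The twisted right action `m ·_Γ a = Γ(m₋₁, a) m₀`. -/
def twR (G : H.TwoCocycle) (cM : H.Comodule M) : M →ₗ[k] B →ₗ[k] M :=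
  (G.evalR cM ∘ₗ cM.δ).compl₂ H.s

theorem evalR_takeuchi (G : H.TwoCocycle) (cM : H.Comodule M) (m : M) (b : B) (Y : L) :
    G.evalR cM (cM.δ m) (H.algL.mul (H.t b) Y) = cM.ract (G.evalR cM (cM.δ m) Y) b := by
  obtain ⟨u, hu⟩ := Submodule.mkQ_surjective _ (cM.δ m)
  have h := congrArg (fun z => G.evalR cM z Y) (cM.δ_takeuchi b m u hu)
  rw [← hu]
  have h1 : ∀ u : L ⊗[k] M, G.evalR cM (H.toDia cM.lact
      (TensorProduct.map (H.tR.flip b) LinearMap.id u)) Y =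
      G.evalR cM (H.toDia cM.lact u) (H.algL.mul (H.t b) Y) := by
    intro u
    induction u using TensorProduct.induction_on with
    | zero => simp
    | tmul x y => rw [TensorProduct.map_tmul, evalR_tmul, evalR_tmul]; simp [G.balanced]
    | add x y hx hy => simp only [map_add, LinearMap.add_apply, hx, hy]
  have h2 : ∀ u : L ⊗[k] M, G.evalR cM (H.toDia cM.lact
      (TensorProduct.map LinearMap.id (cM.ract.flip b) u)) Y =
      cM.ract (G.evalR cM (H.toDia cM.lact u) Y) b := by
    intro u
    induction u using TensorProduct.induction_on with
    | zero => simp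
    | tmul x y => rw [TensorProduct.map_tmul, evalR_tmul, evalR_tmul]; simp [cM.lact_ract]
    | add x y hx hy => simp only [map_add, LinearMap.add_apply, hx, hy]
  exact (h1 u).symm.trans (h.trans (h2 u))

/-- For fixed `m`, the map `Y ⋄ n ↦ Γ(m₋₁, Y) m₀ ⊗_B n`. -/
def sharpFst (G : H.TwoCocycle) (cM : H.Comodule M) (cN : H.Comodule N) (m : M) :
    H.Dia cN.lact →ₗ[k] Bal cM.ract cN.lact :=
  balLift H.tL.flip cN.lact
    (toBal cM.ract cN.lact ∘ₗ TensorProduct.map (G.evalR cM (cM.δ m)) LinearMap.id)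
    (by
      intro Y b n
      simp only [LinearMap.comp_apply, TensorProduct.map_tmul, LinearMap.flip_apply,
        EnvRing.tL_apply, LinearMap.id_apply]
      rw [evalR_takeuchi]
      exact toBal_rel _ _ _ _ _)

@[simp] theorem sharpFst_tmul (G : H.TwoCocycle) (cM : H.Comodule M) (cN : H.Comodule N) (m : M)
    (Y : L) (n : N) : G.sharpFst cM cN m (H.toDia cN.lact (Y ⊗ₜ[k] n)) =
      toBal cM.ract cN.lact (G.evalR cM (cM.δ m) Y ⊗ₜ[k] n) := rfl

/-- `m, n ↦ Γ(m₋₁, n₋₁) m₀ ⊗_B n₀`. -/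
def sharpAux (G : H.TwoCocycle) (cM : H.Comodule M) (cN : H.Comodule N) :
    M →ₗ[k] N →ₗ[k] Bal cM.ract cN.lact :=
  LinearMap.mk₂ k (fun m n => G.sharpFst cM cN m (cN.δ n))
    (by
      intro m m' n
      have h : G.sharpFst cM cN (m + m') = G.sharpFst cM cN m + G.sharpFst cM cN m' := by
        refine Submodule.linearMap_qext _ (TensorProduct.ext' fun Y n => ?_)
        change toBal cM.ract cN.lact (G.evalR cM (cM.δ (m + m')) Y ⊗ₜ[k] n) =
          toBal cM.ract cN.lact (G.evalR cM (cM.δ m) Y ⊗ₜ[k] n) +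
          toBal cM.ract cN.lact (G.evalR cM (cM.δ m') Y ⊗ₜ[k] n)
        rw [← map_add, ← TensorProduct.add_tmul, map_add, map_add, LinearMap.add_apply]
      rw [h, LinearMap.add_apply])
    (by
      intro c m n
      have h : G.sharpFst cM cN (c • m) = c • G.sharpFst cM cN m := by
        refine Submodule.linearMap_qext _ (TensorProduct.ext' fun Y n => ?_)
        change toBal cM.ract cN.lact (G.evalR cM (cM.δ (c • m)) Y ⊗ₜ[k] n) =
          c • toBal cM.ract cN.lact (G.evalR cM (cM.δ m) Y ⊗ₜ[k] n)
        rw [← map_smul, TensorProduct.smul_tmul', map_smul, map_smul, LinearMap.smul_apply]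
      rw [h, LinearMap.smul_apply])
    (by intros; simp)
    (by intros; simp)

theorem sharpAux_apply (G : H.TwoCocycle) (cM : H.Comodule M) (cN : H.Comodule N) (m : M) (n : N)
    (w : L ⊗[k] N) (hw : H.toDia cN.lact w = cN.δ n) :
    G.sharpAux cM cN m n =
      toBal cM.ract cN.lact (TensorProduct.map (G.evalR cM (cM.δ m)) LinearMap.id w) := by
  change G.sharpFst cM cN m (cN.δ n) = _
  rw [← hw]
  rfl

theorem δ_left (cM : H.Comodule M) (a : B) (m : M) (u : L ⊗[k] M)
    (hu : H.toDia cM.lact u = cM.δ m) :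
    cM.δ (cM.lact a m) = H.toDia cM.lact (TensorProduct.map (H.sL a) LinearMap.id u) := by
  have h := cM.δ_bilin a H.algB.one m u hu
  rw [cM.ract_module.act_one] at h
  rw [h]
  congr 3
  ext X
  simp [H.s_one, H.algL.mul_one]

/-- `(X ⋄ Z ⋄ m) ↦ Φ(X) Z ⋄ m`. -/
def slide (cM : H.Comodule M) (Φ : L →ₗ[k] B)
    (hΦ : ∀ X b, Φ (H.algL.mul (H.t b) X) = H.algB.mul (Φ X) b) :
    Triple H.tL.flip H.sL H.tL.flip cM.lact →ₗ[k] H.Dia cM.lact :=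
  Submodule.liftQ _
    (H.toDia cM.lact ∘ₗ TensorProduct.map (TensorProduct.lift (H.sL ∘ₗ Φ)) LinearMap.id ∘ₗ
      (TensorProduct.assoc k L L M).symm.toLinearMap)
    (by
      refine Submodule.span_le.2 ?_
      rintro z (⟨X, b, Z, m, rfl⟩ | ⟨X, b, Z, m, rfl⟩)
      · simp [hΦ, H.s_mul, H.algL.mul_assoc]
      · simp only [SetLike.mem_coe, LinearMap.mem_ker, map_sub, sub_eq_zero]
        have h := toBal_rel H.tL.flip cM.lact (H.algL.mul (H.s (Φ X)) Z) b m
        simpa [← H.algL.mul_assoc, H.s_t_comm] using h)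

theorem δ_apply (cM : H.Comodule M) (Φ : L →ₗ[k] B)
    (hΦ : ∀ X b, Φ (H.algL.mul (H.t b) X) = H.algB.mul (Φ X) b) (m : M) (u : L ⊗[k] M)
    (hu : H.toDia cM.lact u = cM.δ m) :
    cM.δ (TensorProduct.lift (cM.lact ∘ₗ Φ) u) =
      slide cM Φ hΦ (tripleL H.tL.flip H.sL H.tL.flip cM.lact
        (TensorProduct.map H.Δ LinearMap.id u)) := by
  rw [← cM.coassoc m u hu]
  clear hu
  induction u using TensorProduct.induction_on with
  | zero => simp
  | tmul X m =>
    obtain ⟨w, hw⟩ := Submodule.mkQ_surjective _ (cM.δ m)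
    rw [TensorProduct.map_tmul, ← hw, TensorProduct.lift.tmul, LinearMap.comp_apply,
      δ_left cM _ m w hw]
    clear hw
    change _ = slide cM Φ hΦ (tripleR H.tL.flip H.sL H.tL.flip cM.lact
      (X ⊗ₜ[k] toBal H.tL.flip cM.lact w))
    rw [tripleR_tmul]
    change H.toDia cM.lact _ = H.toDia cM.lact _
    congr 1
    induction w using TensorProduct.induction_on with
    | zero => simp
    | tmul x y => simp
    | add x y hx hy => simp only [map_add, TensorProduct.tmul_add, hx, hy]
  | add x y hx hy => simp only [map_add, hx, hy]

theorem evalR_apply (G : H.TwoCocycle) (cM : H.Comodule M) (u : L ⊗[k] M) (Y : L) :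
    G.evalR cM (H.toDia cM.lact u) Y = TensorProduct.lift (cM.lact ∘ₗ G.Γ.flip Y) u := by
  induction u using TensorProduct.induction_on with
  | zero => simp
  | tmul x y => rw [evalR_tmul]; simp
  | add x y hx hy => simp only [map_add, LinearMap.add_apply, hx, hy]

theorem evalL_apply (G : H.TwoCocycle) (cM : H.Comodule M) (u : L ⊗[k] M) (a : B) :
    G.evalL cM (H.toDia cM.lact u) a = TensorProduct.lift (cM.lact ∘ₗ G.Γ (H.s a)) u := by
  induction u using TensorProduct.induction_on with
  | zero => simp
  | tmul x y => rw [evalL_tmul]; simp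
  | add x y hx hy => simp only [map_add, LinearMap.add_apply, hx, hy]

theorem slide_tripleL (cM : H.Comodule M) (Φ : L →ₗ[k] B)
    (hΦ : ∀ X b, Φ (H.algL.mul (H.t b) X) = H.algB.mul (Φ X) b) (x : L ⊗[k] L) (m : M) :
    slide cM Φ hΦ (tripleL H.tL.flip H.sL H.tL.flip cM.lact (H.toDiaL x ⊗ₜ[k] m)) =
      H.toDia cM.lact (TensorProduct.lift (H.sL ∘ₗ Φ) x ⊗ₜ[k] m) := by
  rw [tripleL_tmul]
  change H.toDia cM.lact _ = _
  simp

theorem lin_left (G : H.TwoCocycle) (b : B) (X : L) (c : B) :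
    G.Γ (H.s b) (H.algL.mul (H.t c) X) = H.algB.mul (G.Γ (H.s b) X) c := by
  rw [← G.balanced, H.s_t_comm, G.linear]

theorem evalR_twR (G : H.TwoCocycle) (cM : H.Comodule M) (m : M) (b : B) (Y : L) (y : L ⊗[k] L)
    (hy : H.toDiaL y = H.Δ Y) :
    G.evalR cM (cM.δ (G.twR cM m b)) Y =
      G.evalR cM (cM.δ m) (TensorProduct.lift (H.sL ∘ₗ G.Γ (H.s b)) y) := by
  obtain ⟨u, hu⟩ := Submodule.mkQ_surjective _ (cM.δ m)
  have h1 : G.twR cM m b = TensorProduct.lift (cM.lact ∘ₗ G.Γ.flip (H.s b)) u := by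
    rw [← evalR_apply]
    change G.evalR cM (cM.δ m) (H.s b) = _
    rw [← hu]
  rw [h1, δ_apply cM (G.Γ.flip (H.s b)) (fun X c => G.linear X (H.s b) c) m u hu, ← hu]
  change _ = G.evalR cM (H.toDia cM.lact u) _
  clear hu h1
  have e1 : ∀ x : L ⊗[k] L, H.twMul G.Γ x (H.s b ⊗ₜ[k] H.algL.one) =
      TensorProduct.lift (H.sL ∘ₗ G.Γ.flip (H.s b)) x := by
    intro x
    induction x using TensorProduct.induction_on with
    | zero => simp
    | tmul x y => simp [H.algL.mul_one]
    | add x y hx hy => simp only [map_add, LinearMap.add_apply, hx, hy]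
  have e2 : H.twMul G.Γ (H.s b ⊗ₜ[k] H.algL.one) y =
      TensorProduct.lift (H.sL ∘ₗ G.Γ (H.s b)) y := by
    clear hy
    induction y using TensorProduct.induction_on with
    | zero => simp
    | tmul x y => simp [H.algL.one_mul]
    | add x y hx hy => simp only [map_add, hx, hy]
  induction u using TensorProduct.induction_on with
  | zero => simp
  | tmul X m =>
    obtain ⟨x, hx⟩ := Submodule.mkQ_surjective _ (H.Δ X)
    have hc := G.cocycle X (H.s b) Y x (H.s b ⊗ₜ[k] H.algL.one) y hx (H.Δ_s b).symm hy
    rw [TensorProduct.map_tmul, ← hx, LinearMap.id_apply]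
    change G.evalR cM (slide cM _ _ (tripleL H.tL.flip H.sL H.tL.flip cM.lact
      (H.toDiaL x ⊗ₜ[k] m))) Y = _
    have hs := slide_tripleL cM (G.Γ.flip (H.s b)) (fun X c => G.linear X (H.s b) c) x m
    refine (congrArg (fun z => G.evalR cM z Y) hs).trans ?_
    rw [evalR_tmul, evalR_tmul, ← e1, ← e2, hc]
  | add x y hx hy => simp only [map_add, LinearMap.add_apply, hx, hy]

/-- The map `Γ^# : M ⊗_{B^Γ} N → M ⊗_B N`, `m ⊗ n ↦ Γ(m₋₁, n₋₁) m₀ ⊗ n₀`. -/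
def sharp (G : H.TwoCocycle) (cM : H.Comodule M) (cN : H.Comodule N) :
    Bal (G.twR cM) (G.twL cN) →ₗ[k] Bal cM.ract cN.lact :=
  balLift (G.twR cM) (G.twL cN) (TensorProduct.lift (G.sharpAux cM cN)) (by
    intro m b n
    obtain ⟨w, hw⟩ := Submodule.mkQ_surjective _ (cN.δ n)
    have h1 : G.twL cN b n = TensorProduct.lift (cN.lact ∘ₗ G.Γ (H.s b)) w := by
      rw [← evalL_apply]
      change G.evalL cN (cN.δ n) b = _
      rw [← hw]
    rw [TensorProduct.lift.tmul, TensorProduct.lift.tmul, sharpAux_apply G cM cN _ n w hw]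
    change _ = G.sharpFst cM cN m (cN.δ _)
    rw [h1, δ_apply cN (G.Γ (H.s b)) (G.lin_left b) n w hw]
    clear hw h1
    induction w using TensorProduct.induction_on with
    | zero => simp
    | tmul Y n =>
      obtain ⟨y, hy⟩ := Submodule.mkQ_surjective _ (H.Δ Y)
      rw [TensorProduct.map_tmul, TensorProduct.map_tmul, evalR_twR G cM m b Y y hy, ← hy,
        LinearMap.id_apply]
      change _ = G.sharpFst cM cN m (slide cN _ _ (tripleL H.tL.flip H.sL H.tL.flip cN.lact
        (H.toDiaL y ⊗ₜ[k] n)))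
      rw [slide_tripleL, sharpFst_tmul]
    | add x y hx hy => simp only [map_add, hx, hy])

/-- `Γ` is invertible: `Γ^#` is invertible for all left comodules `M`, `N`. -/
def Invertible (G : H.TwoCocycle) : Prop :=
  ∀ (M N : Type u) [AddCommGroup M] [Module k M] [AddCommGroup N] [Module k N]
    (cM : H.Comodule M) (cN : H.Comodule N), Function.Bijective (G.sharp cM cN)

end LeftBialgebroid.TwoCocycle

end Main

/-- A left Hopf algebroid: a left bialgebroid whose Hopf-Galois map is invertible. -/
structure LeftHopfAlgebroid (k : Type v) [Field k] (B L : Type u) [AddCommGroup B] [Module k B]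
    [AddCommGroup L] [Module k L] extends LeftBialgebroid k B L where
  hopf_bijective : Function.Bijective toLeftBialgebroid.hopfMap

section Main

variable {k : Type v} [Field k] {B L : Type u} [AddCommGroup B] [Module k B]
  [AddCommGroup L] [Module k L]

namespace LeftHopfAlgebroid

/-- `L` is faithfully flat for each of its four `B`- and `B̄`-module structures
`b X`, `X b`, `b̄ X`, `X b̄`. -/
def IsFaithfullyFlat (H : LeftHopfAlgebroid k B L) : Prop :=
  IsFaithfullyFlatLeft H.algB H.sL ∧ IsFaithfullyFlatRight H.algB H.sR ∧
    IsFaithfullyFlatRight H.algB H.tL.flip ∧ IsFaithfullyFlatLeft H.algB H.tR.flip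

/-- `X ↦ X₊ ⊗_{B̄} X₋ = λ⁻¹(X ⋄ 1)`. -/
noncomputable def plusMinus (H : LeftHopfAlgebroid k B L) : L →ₗ[k] H.OpTensor :=
  (LinearEquiv.ofBijective H.hopfMap H.hopf_bijective).symm.toLinearMap ∘ₗ H.toDiaL ∘ₗ
    (TensorProduct.mk k L L).flip H.algL.one

/-- `x ∈ L ⊗ (L ⊗ L)` represents `X₁ ⊗ (X₂₊ ⊗ X₂₋)`. -/
def RepOnePlusMinus (H : LeftHopfAlgebroid k B L) (X : L) (x : L ⊗[k] (L ⊗[k] L)) : Prop :=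
  ∃ u : L ⊗[k] L, H.toDiaL u = H.Δ X ∧
    TensorProduct.map LinearMap.id H.toOp x = TensorProduct.map LinearMap.id H.plusMinus u

/-- `x ∈ L ⊗ (L ⊗ L)` represents `X₊ ⊗ (X₋₁ ⊗ X₋₂)`. -/
def RepPlusMinusDelta (H : LeftHopfAlgebroid k B L) (X : L) (x : L ⊗[k] (L ⊗[k] L)) : Prop :=
  ∃ p : L ⊗[k] L, H.toOp p = H.plusMinus X ∧
    TensorProduct.map LinearMap.id H.toDiaL x = TensorProduct.map LinearMap.id H.Δ p

/-- `(X₁ ⊗ (X₊ ⊗ X₋)), (Y₁ ⊗ (Y₊ ⊗ Y₋)) ↦ Γ(X₁, Y₁) X₊ Y₊ \overline{Γ(Y₋, X₋)}`. -/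
def twProd (H : LeftHopfAlgebroid k B L) (Γ : L →ₗ[k] L →ₗ[k] B) :
    L ⊗[k] (L ⊗[k] L) →ₗ[k] L ⊗[k] (L ⊗[k] L) →ₗ[k] L :=
  (TensorProduct.map₂ Γ (TensorProduct.map₂ H.algL.mul Γ.flip)).compr₂
    (TensorProduct.lift (H.sL.compl₂ (TensorProduct.lift H.tR)))

@[simp] theorem twProd_tmul (H : LeftHopfAlgebroid k B L) (Γ : L →ₗ[k] L →ₗ[k] B)
    (X₁ Xp Xm Y₁ Yp Ym : L) :
    H.twProd Γ (X₁ ⊗ₜ[k] (Xp ⊗ₜ[k] Xm)) (Y₁ ⊗ₜ[k] (Yp ⊗ₜ[k] Ym)) =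
      H.algL.mul (H.s (Γ X₁ Y₁)) (H.algL.mul (H.algL.mul Xp Yp) (H.t (Γ Ym Xm))) := by
  simp [twProd]

/-- `(X₊ ⊗ (X₁ ⊗ X₂)), (Y₊ ⊗ (Y₁ ⊗ Y₂)) ↦ Γ(X₊ Y₊, Γ(Y₁, X₁) Y₂ X₂)`. -/
def inverseForm (H : LeftHopfAlgebroid k B L) (Γ : L →ₗ[k] L →ₗ[k] B) :
    L ⊗[k] (L ⊗[k] L) →ₗ[k] L ⊗[k] (L ⊗[k] L) →ₗ[k] B :=
  (TensorProduct.map₂ H.algL.mul (H.twMul Γ).flip).compr₂ (TensorProduct.lift Γ)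

@[simp] theorem inverseForm_tmul (H : LeftHopfAlgebroid k B L) (Γ : L →ₗ[k] L →ₗ[k] B)
    (Xp X₁ X₂ Yp Y₁ Y₂ : L) :
    H.inverseForm Γ (Xp ⊗ₜ[k] (X₁ ⊗ₜ[k] X₂)) (Yp ⊗ₜ[k] (Y₁ ⊗ₜ[k] Y₂)) =
      Γ (H.algL.mul Xp Yp) (H.algL.mul (H.s (Γ Y₁ X₁)) (H.algL.mul Y₂ X₂)) := by
  simp [inverseForm]

/-- `((X₊ ⊗ X₋) ⊗ (Y ⊗ m)) ↦ X₊ \overline{Γ(X₋, Y)} ⊗ m`. -/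
noncomputable def sharpDia (H : LeftHopfAlgebroid k B L) (Γ : L →ₗ[k] L →ₗ[k] B)
    (M : Type u) [AddCommGroup M] [Module k M] :
    (L ⊗[k] L) ⊗[k] (L ⊗[k] M) →ₗ[k] L ⊗[k] M :=
  TensorProduct.lift ((LinearMap.rTensorHom M) ∘ₗ
    (TensorProduct.lift (((LinearMap.llcomp k L B L) ∘ₗ H.tR).compl₂ Γ)))

@[simp] theorem sharpDia_tmul (H : LeftHopfAlgebroid k B L) (Γ : L →ₗ[k] L →ₗ[k] B)
    (M : Type u) [AddCommGroup M] [Module k M] (Xp Xm Y : L) (m : M) :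
    H.sharpDia Γ M ((Xp ⊗ₜ[k] Xm) ⊗ₜ[k] (Y ⊗ₜ[k] m)) =
      H.algL.mul Xp (H.t (Γ Xm Y)) ⊗ₜ[k] m := by
  simp [sharpDia]

/-- The coaction `δ' : M → L ⋄_{B^Γ} M` is `(Γ^#)⁻¹ ∘ δ`, where
`Γ^# : L ⋄_{B^Γ} M → L ⋄_B M`, `X ⋄ m ↦ X₊ \overline{Γ(X₋, m₋₁)} ⋄ m₀`.
Here `u` represents `δ' m = Σ X ⋄ n`, `q` represents `Σ X ⊗ δ n = Σ X ⊗ (n₋₁ ⊗ n₀)`,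
`p` represents `Σ (X₊ ⊗ X₋) ⊗ (n₋₁ ⊗ n₀)`, and the equation says `Γ^#(δ' m) = δ m`. -/
def IsTwistedCoaction (H : LeftHopfAlgebroid k B L) (Γ : L →ₗ[k] L →ₗ[k] B)
    (R' : EnvRing k B L) {M : Type u} [AddCommGroup M] [Module k M]
    (l : B →ₗ[k] M →ₗ[k] M) (δ : M →ₗ[k] H.Dia l)
    (l' : B →ₗ[k] M →ₗ[k] M) (δ' : M →ₗ[k] R'.Dia l') : Prop :=
  ∀ (m : M) (u : L ⊗[k] M) (q : L ⊗[k] (L ⊗[k] M)) (p : (L ⊗[k] L) ⊗[k] (L ⊗[k] M)),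
    R'.toDia l' u = δ' m →
    TensorProduct.map LinearMap.id (H.toDia l) q = TensorProduct.map LinearMap.id δ u →
    TensorProduct.map H.toOp LinearMap.id p = TensorProduct.map H.plusMinus LinearMap.id q →
      H.toDia l (H.sharpDia Γ M p) = δ m

/-- `H' = L^Γ`: the left Hopf algebroid `H'` on the same vector spaces is the cotwist of `H` by
`Γ`. Every operation of `H'` is prescribed; the coproduct is determined by
`Γ^#(Δ^Γ X) = Δ X` since `Γ^#` is injective for an invertible `Γ`. -/
structure IsCotwist (H : LeftHopfAlgebroid k B L) (G : H.TwoCocycle)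
    (H' : LeftHopfAlgebroid k B L) : Prop where
  /-- `a ·_Γ b = Γ(a, b)`. -/
  mul_B : ∀ a b : B, H'.algB.mul a b = G.Γ (H.s a) (H.s b)
  one_B : H'.algB.one = H.algB.one
  /-- `X ·_Γ Y = Γ(X₁, Y₁) X₂₊ Y₂₊ \overline{Γ(Y₂₋, X₂₋)}`. -/
  mul_L : ∀ (X Y : L) (x y : L ⊗[k] (L ⊗[k] L)), H.RepOnePlusMinus X x → H.RepOnePlusMinus Y y →
    H'.algL.mul X Y = H.twProd G.Γ x y
  one_L : H'.algL.one = H.algL.one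
  s_eq : H'.s = H.s
  t_eq : H'.t = H.t
  /-- `Δ^Γ = (Γ^#)⁻¹ ∘ Δ`. -/
  comul : H.IsTwistedCoaction G.Γ H'.toEnvRing H.sL H.Δ H'.sL H'.Δ
  /-- `ε^Γ(X) = Γ(X₊, X₋)`. -/
  counit : ∀ (X : L) (p : L ⊗[k] L), H.toOp p = H.plusMinus X →
    H'.ε X = TensorProduct.lift G.Γ p

/-- `cM' = Γ(M)`: the comodule `cM'` over the cotwist is the one obtained from the `H`-comodule
`cM` on the same vector space, with the twisted actions and the coaction `(Γ^#)⁻¹ ∘ δ`. -/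
structure IsCotwistComodule (H : LeftHopfAlgebroid k B L) (G : H.TwoCocycle)
    (H' : LeftHopfAlgebroid k B L) {M : Type u} [AddCommGroup M] [Module k M]
    (cM : H.Comodule M) (cM' : H'.Comodule M) : Prop where
  lact_eq : cM'.lact = G.twL cM
  ract_eq : cM'.ract = G.twR cM
  coact : H.IsTwistedCoaction G.Γ H'.toEnvRing cM.lact cM.δ cM'.lact cM'.δ

end LeftHopfAlgebroid

end Main

end HopfCotwist

/-!
The cotwist of a left Hopf algebroid `L` by a left 2-cocycle `Γ`, and its inverse.

Everything rests on one operation, the twist `f^Γ(m, n) = Γ(m₋₁, n₋₁) f(m₀, n₀)` of a balanced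
bilinear map `f` on a pair of comodules (`tw`). By the cocycle condition, twisting preserves
associativity (`tw_assoc`); it is natural in morphisms of comodules (`tw_nat`), and it does nothing
on coinvariant arguments (`tw_coinv_left`, `tw_coinv_right`). The map `Γ^#` is the twist of the
universal balanced map, the actions `·_Γ` are the twists of the actions (`tw_lact`, `tw_ract`), and
`f^Γ` is the composite of `f` with `Γ^#` (`ev_tw`).

The space `L` carries two commuting left comodule structures (`commutes_reg_cT`): the coproduct,
with the actions `b X` and `X b` (`reg`), and `X ↦ X₋ ⋄ X₊`, with the actions `X b̄` and `b̄ X`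
(`cT`). The product of `L` is a morphism for the first, and the opposite product is one for the
second. Twisting the product along the first structure gives `X • Y = Γ(X₁, Y₁) X₂ Y₂` (`bul`),
twisting it along the second gives `X ∘ Y = X₊ Y₊ \overline{Γ(Y₋, X₋)}` (`circ`), and twisting it
along both, in either order, gives the product `X ·_Γ Y` of the cotwist (`mulΓ_eq`). Associativity,
and the fact that `s` and `t` are an algebra and an antialgebra map, follow from the general
properties of the twist.

The map `Γ^# : L ⋄_{B^Γ} M → L ⋄_B M` is the twist for the comodules `cT` and `M`, so the coaction
`(Γ^#)⁻¹ ∘ δ` of the cotwist (`coact`) is characterized by the rule that summing `f^Γ` over it is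
summing `f` over `δ` (`ev_coact_tw`). The element `m₋₁ ⊗ m₀` of `L ⊗_B M` is coinvariant when `L`
has the structure `cT` (`coinv_δ`). Together with `tw_assoc` this gives the identity
`ev_coact_coact`, which for suitable morphisms says that `Δ^Γ` is multiplicative (`comulΓ_mul`)
and, by a similar argument (`twist_galois`), that the Hopf-Galois map of the cotwist is the one of
`L` up to composition with the bijections `Γ^#`. The right counit axiom then follows from the left
one and the surjectivity of that map (`comulΓ_counit_right`).

The inverse cocycle is `Σ(X, Y) = ε^Γ(X ∘ Y)`. Applying `X ⊗ m ↦ Γ(X₊, X₋ m₋₁) m₀`, a retraction of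
the coaction, to `ev_coact_coact` shows that twisting by `Σ` undoes twisting by `Γ`
(`ev_coact_inverse`, `sigma_tw`). The cocycle condition for `Σ` is thereby the associativity of
`∘`, and `Σ^#` is inverse to `Γ^#`. As the two comodule structures of the cotwist are the cotwists
of those of `L`, twisting its product and its coproduct by `Σ` gives back those of `L`
(`isCotwist_sigma`).

Let finally `δ'` be the coaction of a comodule `M` over the cotwist. It identifies `M` with the
kernel of the difference of `Δ^Γ ⋄ id` and `id ⋄ δ'` on `L ⋄_{B^Γ} M`. Both are morphisms of
`L`-comodules for the coaction of the first factor, and a kernel of a morphism of `L`-comodules is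
an `L`-comodule since `L` is flat for the action `b̄ X` (`exists_comodule_of_kernel`). The cotwist
of the comodule so obtained is the given one (`exists_isCotwistComodule`).

Sweedler sums are written with `ev z f`, the sum of `f` over a representation of `z` by elementary
tensors, which does not depend on the representation if `f` is balanced.
-/

namespace HopfCotwist

set_option linter.unusedSectionVars false

/-! ### Sums over representatives in balanced tensor products -/

section Eval

variable {k : Type v} [Field k] {B M P N : Type u}
  [AddCommGroup B] [Module k B] [AddCommGroup M] [Module k M]
  [AddCommGroup P] [Module k P] [AddCommGroup N] [Module k N]
  {Q Q' : Type*} [AddCommGroup Q] [Module k Q] [AddCommGroup Q'] [Module k Q']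

/-- The class of `m ⊗ n` in the balanced tensor product, as a bilinear map. -/
def tm (r : M →ₗ[k] B →ₗ[k] M) (l : B →ₗ[k] N →ₗ[k] N) : M →ₗ[k] N →ₗ[k] Bal r l :=
  (TensorProduct.mk k M N).compr₂ (toBal r l)

variable (r : M →ₗ[k] B →ₗ[k] M) (l : B →ₗ[k] N →ₗ[k] N)

theorem tm_bal (m : M) (b : B) (n : N) : tm r l (r m b) n = tm r l m (l b n) :=
  toBal_rel r l m b n

variable {r l}

theorem Bal.induction {p : Bal r l → Prop} (z : Bal r l) (h0 : p 0)
    (ht : ∀ m n, p (tm r l m n)) (ha : ∀ x y, p x → p y → p (x + y)) : p z := by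
  obtain ⟨u, rfl⟩ := Submodule.mkQ_surjective _ z
  induction u using TensorProduct.induction_on with
  | zero => simpa using h0
  | tmul x y => exact ht x y
  | add x y hx hy => rw [map_add]; exact ha _ _ hx hy

theorem Bal.hom_ext {f g : Bal r l →ₗ[k] Q} (h : ∀ m n, f (tm r l m n) = g (tm r l m n)) :
    f = g :=
  Submodule.linearMap_qext _ (TensorProduct.ext' h)

theorem Bal.exists_list (z : Bal r l) :
    ∃ S : List (M × N), z = (S.map fun p => tm r l p.1 p.2).sum := by
  induction z using Bal.induction with
  | h0 => exact ⟨[], by simp⟩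
  | ht m n => exact ⟨[(m, n)], by simp⟩
  | ha x y hx hy =>
    obtain ⟨S, rfl⟩ := hx
    obtain ⟨T, rfl⟩ := hy
    exact ⟨S ++ T, by simp⟩

/-- The sum `Σ f(mᵢ, nᵢ)` over a chosen representation `z = Σ mᵢ ⊗ nᵢ`. It is independent of the
choice when `f` is bilinear and balanced, but it makes sense for every function `f`; thus
iterated Sweedler sums can be written down, and linear maps moved into them, before anything is
checked about balancedness. -/
noncomputable def ev {A : Type*} [AddCommMonoid A] (z : Bal r l) (f : M → N → A) : A :=
  ((Bal.exists_list z).choose.map fun p => f p.1 p.2).sum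

@[simp] theorem ev_tm_self (z : Bal r l) : ev z (fun m n => tm r l m n) = z :=
  (Bal.exists_list z).choose_spec.symm

theorem ev_map (z : Bal r l) (f : M → N → Q) (g : Q →ₗ[k] Q') :
    g (ev z f) = ev z fun m n => g (f m n) := by
  simp [ev, map_list_sum, Function.comp_def]

theorem ev_map₂ (z : Bal r l) {Q'' : Type*} [AddCommGroup Q''] [Module k Q'']
    (f : M → N → Q) (g : Q →ₗ[k] Q' →ₗ[k] Q'') (q : Q') :
    g (ev z f) q = ev z fun m n => g (f m n) q :=
  ev_map z f (g.flip q)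

theorem ev_add_fun (z : Bal r l) (f g : M → N → Q) :
    ev z (fun m n => f m n + g m n) = ev z f + ev z g := by
  simp [ev, List.sum_map_add]

theorem ev_smul_fun (z : Bal r l) (c : k) (f : M → N → Q) :
    ev z (fun m n => c • f m n) = c • ev z f := by
  simp [ev, List.smul_sum, Function.comp_def]

theorem ev_sub_fun (z : Bal r l) (f g : M → N → Q) :
    ev z (fun m n => f m n - g m n) = ev z f - ev z g := by
  have := ev_add_fun (Q := Q) z (fun m n => f m n - g m n) g
  rw [eq_sub_iff_add_eq, ← this]
  simp

theorem ev_hom (z : Bal r l) (F : Bal r l →ₗ[k] Q) : ev z (fun m n => F (tm r l m n)) = F z := by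
  rw [← ev_map, ev_tm_self]

theorem ev_comm {M' N' B' : Type u} [AddCommGroup M'] [Module k M'] [AddCommGroup N'] [Module k N']
    [AddCommGroup B'] [Module k B'] {r' : M' →ₗ[k] B' →ₗ[k] M'} {l' : B' →ₗ[k] N' →ₗ[k] N'}
    (z : Bal r l) (w : Bal r' l') (f : M → N → M' → N' → Q) :
    ev z (fun m n => ev w fun p q => f m n p q) = ev w fun p q => ev z fun m n => f m n p q := by
  unfold ev
  generalize (Bal.exists_list z).choose = S
  generalize (Bal.exists_list w).choose = T
  induction S with
  | nil => simp
  | cons a S ih => simp [ih, List.sum_map_add]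

/-- `f` is bilinear and balanced. -/
structure IsBal (r : M →ₗ[k] B →ₗ[k] M) (l : B →ₗ[k] N →ₗ[k] N) (f : M → N → Q) : Prop where
  add_left : ∀ m m' n, f (m + m') n = f m n + f m' n
  smul_left : ∀ (c : k) m n, f (c • m) n = c • f m n
  add_right : ∀ m n n', f m (n + n') = f m n + f m n'
  smul_right : ∀ (c : k) m n, f m (c • n) = c • f m n
  bal : ∀ m b n, f (r m b) n = f m (l b n)

theorem IsBal.mk_linear (F : M →ₗ[k] N →ₗ[k] Q) (h : ∀ m b n, F (r m b) n = F m (l b n)) :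
    IsBal r l fun m n => F m n where
  add_left := by simp
  smul_left := by simp
  add_right := by simp
  smul_right := by simp
  bal := h

/-- The linear map on the balanced tensor product induced by a balanced function. -/
def blift (f : M → N → Q) (hf : IsBal r l f) : Bal r l →ₗ[k] Q :=
  balLift r l (TensorProduct.lift (LinearMap.mk₂ k f hf.add_left hf.smul_left hf.add_right
    hf.smul_right)) hf.bal

@[simp] theorem blift_tm (f : M → N → Q) (hf : IsBal r l f) (m : M) (n : N) :
    blift f hf (tm r l m n) = f m n := rfl

theorem ev_eq_blift (z : Bal r l) (f : M → N → Q) (hf : IsBal r l f) : ev z f = blift f hf z := by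
  rw [← ev_hom z (blift f hf)]; rfl

theorem ev_tm {f : M → N → Q} (hf : IsBal r l f) (m : M) (n : N) : ev (tm r l m n) f = f m n := by
  rw [ev_eq_blift _ _ hf]; rfl

theorem ev_add {f : M → N → Q} (hf : IsBal r l f) (z w : Bal r l) :
    ev (z + w) f = ev z f + ev w f := by
  simp only [ev_eq_blift _ _ hf, map_add]

theorem ev_smul {f : M → N → Q} (hf : IsBal r l f) (c : k) (z : Bal r l) :
    ev (c • z) f = c • ev z f := by
  simp only [ev_eq_blift _ _ hf, map_smul]

theorem ev_zero {f : M → N → Q} (hf : IsBal r l f) : ev (0 : Bal r l) f = 0 := by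
  simp only [ev_eq_blift _ _ hf, map_zero]

/-- Substitution: a balanced sum over an iterated sum. -/
theorem ev_ev {M' N' B' : Type u} [AddCommGroup M'] [Module k M'] [AddCommGroup N'] [Module k N']
    [AddCommGroup B'] [Module k B'] {r' : M' →ₗ[k] B' →ₗ[k] M'} {l' : B' →ₗ[k] N' →ₗ[k] N'}
    {f : M → N → Q} (hf : IsBal r l f) (w : Bal r' l') (g : M' → N' → Bal r l) :
    ev (ev w g) f = ev w fun p q => ev (g p q) f := by
  simp only [ev_eq_blift _ _ hf, ev_map]

theorem ev_toBal {f : M → N → Q} (hf : IsBal r l f) (u : M ⊗[k] N) :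
    ev (toBal r l u) f = TensorProduct.lift (LinearMap.mk₂ k f hf.add_left hf.smul_left
      hf.add_right hf.smul_right) u := by
  rw [ev_eq_blift _ _ hf]; rfl

theorem ev_toBal_eq {f : M → N → Q} (hf : IsBal r l f) (u : M ⊗[k] N) (F : M ⊗[k] N →ₗ[k] Q)
    (hF : ∀ m n, F (m ⊗ₜ[k] n) = f m n) : ev (toBal r l u) f = F u := by
  rw [ev_toBal hf]
  congr 1
  exact TensorProduct.ext' fun m n => (hF m n).symm

end Eval

/-! ### Threefold balanced tensor products -/

section Triple

variable {k : Type v} [Field k] {B M P N : Type u}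
  [AddCommGroup B] [Module k B] [AddCommGroup M] [Module k M]
  [AddCommGroup P] [Module k P] [AddCommGroup N] [Module k N]
  {Q Q' : Type*} [AddCommGroup Q] [Module k Q] [AddCommGroup Q'] [Module k Q']

/-- A trilinear function that respects the relations of the threefold balanced tensor product. -/
structure IsBal₃ (r₁ : M →ₗ[k] B →ₗ[k] M) (l₁ : B →ₗ[k] P →ₗ[k] P)
    (r₂ : P →ₗ[k] B →ₗ[k] P) (l₂ : B →ₗ[k] N →ₗ[k] N) (T : M → P → N → Q) : Prop where
  left : ∀ n, IsBal r₁ l₁ fun m p => T m p n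
  right : ∀ m, IsBal r₂ l₂ (T m)

/-- The class of `m ⊗ p ⊗ n` in the threefold balanced tensor product. -/
def trip (r₁ : M →ₗ[k] B →ₗ[k] M) (l₁ : B →ₗ[k] P →ₗ[k] P)
    (r₂ : P →ₗ[k] B →ₗ[k] P) (l₂ : B →ₗ[k] N →ₗ[k] N) (m : M) (p : P) (n : N) :
    Triple r₁ l₁ r₂ l₂ :=
  (tripleRel r₁ l₁ r₂ l₂).mkQ (m ⊗ₜ[k] (p ⊗ₜ[k] n))

variable {r₁ : M →ₗ[k] B →ₗ[k] M} {l₁ : B →ₗ[k] P →ₗ[k] P}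
    {r₂ : P →ₗ[k] B →ₗ[k] P} {l₂ : B →ₗ[k] N →ₗ[k] N}

theorem trip_isBal₃ : IsBal₃ r₁ l₁ r₂ l₂ (trip r₁ l₁ r₂ l₂) where
  left n :=
    { add_left := fun _ _ _ => by simp only [trip, TensorProduct.add_tmul, map_add]
      smul_left := fun _ _ _ => by simp only [trip, ← TensorProduct.smul_tmul', map_smul]
      add_right := fun _ _ _ => by
        simp only [trip, TensorProduct.add_tmul, TensorProduct.tmul_add, map_add]
      smul_right := fun _ _ _ => by
        simp only [trip, ← TensorProduct.smul_tmul', TensorProduct.tmul_smul, map_smul]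
      bal := fun m b p =>
        (Submodule.Quotient.eq _).2 (Submodule.subset_span (Or.inl ⟨m, b, p, n, rfl⟩)) }
  right m :=
    { add_left := fun _ _ _ => by
        simp only [trip, TensorProduct.add_tmul, TensorProduct.tmul_add, map_add]
      smul_left := fun _ _ _ => by
        simp only [trip, ← TensorProduct.smul_tmul', TensorProduct.tmul_smul, map_smul]
      add_right := fun _ _ _ => by simp only [trip, TensorProduct.tmul_add, map_add]
      smul_right := fun _ _ _ => by simp only [trip, TensorProduct.tmul_smul, map_smul]
      bal := fun p b n =>
        (Submodule.Quotient.eq _).2 (Submodule.subset_span (Or.inr ⟨m, b, p, n, rfl⟩)) }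

/-- The linear map on the threefold balanced tensor product induced by a balanced function. -/
def tlift (T : M → P → N → Q) (hT : IsBal₃ r₁ l₁ r₂ l₂ T) : Triple r₁ l₁ r₂ l₂ →ₗ[k] Q :=
  Submodule.liftQ _
    (TensorProduct.lift
      { toFun := fun m => TensorProduct.lift (LinearMap.mk₂ k (T m) (hT.right m).add_left
          (hT.right m).smul_left (hT.right m).add_right (hT.right m).smul_right)
        map_add' := fun m m' => TensorProduct.ext' fun p n => (hT.left n).add_left m m' p
        map_smul' := fun c m => TensorProduct.ext' fun p n => (hT.left n).smul_left c m p })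
    (by
      refine Submodule.span_le.2 ?_
      rintro z (⟨m, b, p, n, rfl⟩ | ⟨m, b, p, n, rfl⟩)
      · simpa [sub_eq_zero] using (hT.left n).bal m b p
      · simpa [sub_eq_zero] using (hT.right m).bal p b n)

@[simp] theorem tlift_trip (T : M → P → N → Q) (hT : IsBal₃ r₁ l₁ r₂ l₂ T) (m : M) (p : P)
    (n : N) : tlift T hT (trip r₁ l₁ r₂ l₂ m p n) = T m p n := rfl

theorem tripleR_eq_ev (m : M) (z : Bal r₂ l₂) :
    tripleR r₁ l₁ r₂ l₂ (m ⊗ₜ[k] z) = ev z fun p n => trip r₁ l₁ r₂ l₂ m p n := by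
  conv_lhs => rw [← ev_tm_self z]
  exact ev_map z _ (tripleR r₁ l₁ r₂ l₂ ∘ₗ TensorProduct.mk k M (Bal r₂ l₂) m)

theorem tripleL_eq_ev (z : Bal r₁ l₁) (n : N) :
    tripleL r₁ l₁ r₂ l₂ (z ⊗ₜ[k] n) = ev z fun m p => trip r₁ l₁ r₂ l₂ m p n := by
  conv_lhs => rw [← ev_tm_self z]
  exact ev_map z _ (tripleL r₁ l₁ r₂ l₂ ∘ₗ (TensorProduct.mk k (Bal r₁ l₁) N).flip n)

end Triple

attribute [simp] AlgebraOn.mul_assoc AlgebraOn.one_mul AlgebraOn.mul_one EnvRing.s_one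
  EnvRing.t_one EnvRing.s_mul EnvRing.t_mul

/-! ### Sweedler calculus for bialgebroids and comodules -/

section Bialgebroid

variable {k : Type v} [Field k] {B L : Type u} [AddCommGroup B] [Module k B]
  [AddCommGroup L] [Module k L] {M N P V : Type u} [AddCommGroup M] [Module k M]
  [AddCommGroup N] [Module k N] [AddCommGroup P] [Module k P] [AddCommGroup V] [Module k V]
  {Q : Type*} [AddCommGroup Q] [Module k Q]

@[simp] theorem EnvRing.t_s (R : EnvRing k B L) (a b : B) :
    R.algL.mul (R.t b) (R.s a) = R.algL.mul (R.s a) (R.t b) := (R.s_t_comm a b).symm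

@[simp] theorem EnvRing.t_s_mul (R : EnvRing k B L) (a b : B) (X : L) :
    R.algL.mul (R.t b) (R.algL.mul (R.s a) X) = R.algL.mul (R.s a) (R.algL.mul (R.t b) X) := by
  rw [← R.algL.mul_assoc, R.t_s, R.algL.mul_assoc]

/-- `X, m ↦ X ⋄ m`. -/
abbrev EnvRing.dia (R : EnvRing k B L) (l : B →ₗ[k] M →ₗ[k] M) : L →ₗ[k] M →ₗ[k] R.Dia l :=
  tm R.tL.flip l

theorem EnvRing.dia_bal (R : EnvRing k B L) (l : B →ₗ[k] M →ₗ[k] M) (b : B) (X : L) (m : M) :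
    R.dia l (R.algL.mul (R.t b) X) m = R.dia l X (l b m) := tm_bal R.tL.flip l X b m

/-- The form in which the axioms of a bialgebroid or a comodule, stated for representatives, are
turned into Sweedler sums. -/
theorem toBal_map {r : M →ₗ[k] B →ₗ[k] M} {l : B →ₗ[k] N →ₗ[k] N}
    {r' : P →ₗ[k] B →ₗ[k] P} {l' : B →ₗ[k] V →ₗ[k] V} (f : M →ₗ[k] P) (g : N →ₗ[k] V)
    {F : M → N → Bal r' l'} (hF : ∀ m n, tm r' l' (f m) (g n) = F m n) (h : IsBal r l F)
    (u : M ⊗[k] N) : toBal r' l' (TensorProduct.map f g u) = ev (toBal r l u) F :=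
  (ev_toBal_eq h u (toBal r' l' ∘ₗ TensorProduct.map f g) hF).symm

namespace LeftBialgebroid

variable (H : LeftBialgebroid k B L)

namespace Comodule

variable {H} (cM : H.Comodule M) (cN : H.Comodule N) (cP : H.Comodule P)

attribute [simp] IsLeftModule.one_act IsLeftModule.mul_act IsRightModule.act_one
  IsRightModule.act_mul

@[simp] theorem lact_one (m : M) : cM.lact H.algB.one m = m := cM.lact_module.one_act m
@[simp] theorem lact_mul (a b : B) (m : M) :
    cM.lact (H.algB.mul a b) m = cM.lact a (cM.lact b m) := cM.lact_module.mul_act a b m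
@[simp] theorem ract_one (m : M) : cM.ract m H.algB.one = m := cM.ract_module.act_one m
@[simp] theorem ract_mul (a b : B) (m : M) :
    cM.ract m (H.algB.mul a b) = cM.ract (cM.ract m a) b := cM.ract_module.act_mul a b m
@[simp] theorem ract_lact (a b : B) (m : M) :
    cM.ract (cM.lact a m) b = cM.lact a (cM.ract m b) := cM.lact_ract a b m

theorem isBal_left (l : B →ₗ[k] M →ₗ[k] M) (φ : L →ₗ[k] L)
    (hφ : ∀ b X, φ (H.algL.mul (H.t b) X) = H.algL.mul (H.t b) (φ X)) :
    IsBal H.tL.flip l fun X n => H.dia l (φ X) n :=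
  IsBal.mk_linear (H.dia l ∘ₗ φ) (by intro X b n; simp [hφ, H.dia_bal])

theorem δ_lact (a : B) (m : M) : cM.δ (cM.lact a m) =
    ev (cM.δ m) fun X n => H.dia cM.lact (H.algL.mul (H.s a) X) n := by
  obtain ⟨u, hu⟩ := Submodule.mkQ_surjective _ (cM.δ m)
  have h := cM.δ_bilin a H.algB.one m u hu
  rw [cM.ract_one] at h
  rw [h, ← hu]
  exact toBal_map _ _ (by simp) (isBal_left cM.lact (H.sL a) (by simp)) u

theorem δ_ract (a : B) (m : M) : cM.δ (cM.ract m a) =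
    ev (cM.δ m) fun X n => H.dia cM.lact (H.algL.mul X (H.s a)) n := by
  obtain ⟨u, hu⟩ := Submodule.mkQ_surjective _ (cM.δ m)
  have h := cM.δ_bilin H.algB.one a m u hu
  rw [cM.lact_one] at h
  rw [h, ← hu]
  exact toBal_map _ _ (by simp) (isBal_left cM.lact (H.sR.flip a) (by simp)) u

theorem δ_tak (a : B) (m : M) :
    (ev (cM.δ m) fun X n => H.dia cM.lact (H.algL.mul X (H.t a)) n) =
      ev (cM.δ m) fun X n => H.dia cM.lact X (cM.ract n a) := by
  obtain ⟨u, hu⟩ := Submodule.mkQ_surjective _ (cM.δ m)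
  have h := cM.δ_takeuchi a m u hu
  rw [← hu]
  refine (toBal_map _ _ (by simp) (isBal_left cM.lact (H.tR.flip a) (by simp)) u).symm.trans
    (h.trans (toBal_map _ _ (by simp) (IsBal.mk_linear ((H.dia cM.lact).compl₂ (cM.ract.flip a))
      ?_) u))
  intro X b n
  simp [H.dia_bal]

theorem δ_tak_ev {f : L → M → Q} (hf : IsBal H.tL.flip cM.lact f) (a : B) (m : M) :
    (ev (cM.δ m) fun X n => f (H.algL.mul X (H.t a)) n) =
      ev (cM.δ m) fun X n => f X (cM.ract n a) := by
  simpa [ev_map] using congrArg (blift f hf) (cM.δ_tak a m)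

theorem ev_δ_lact {f : L → M → Q} (hf : IsBal H.tL.flip cM.lact f) (a : B) (m : M) :
    ev (cM.δ (cM.lact a m)) f = ev (cM.δ m) fun X n => f (H.algL.mul (H.s a) X) n := by
  rw [ev_eq_blift _ _ hf, δ_lact]
  simp [ev_map]

theorem ev_δ_ract {f : L → M → Q} (hf : IsBal H.tL.flip cM.lact f) (a : B) (m : M) :
    ev (cM.δ (cM.ract m a)) f = ev (cM.δ m) fun X n => f (H.algL.mul X (H.s a)) n := by
  rw [ev_eq_blift _ _ hf, δ_ract]
  simp [ev_map]

theorem counit_ev (m : M) : (ev (cM.δ m) fun X n => cM.lact (H.ε X) n) = m := by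
  obtain ⟨u, hu⟩ := Submodule.mkQ_surjective _ (cM.δ m)
  conv_rhs => rw [← cM.counit m u hu]
  rw [← hu, ev_toBal_eq _ u (TensorProduct.lift (cM.lact ∘ₗ H.ε)) (by simp)]
  refine IsBal.mk_linear (cM.lact ∘ₗ H.ε) ?_
  intro X b n
  have h := H.ε_bilin H.algB.one b X
  simp only [EnvRing.s_one, AlgebraOn.one_mul] at h
  simp [h]

end Comodule

/-- `L` as a left comodule over itself, with the `B`-actions `b X` and `X b`. -/
abbrev reg : H.Comodule L where
  lact := H.sL
  ract := H.sR
  lact_module := ⟨by simp, by simp⟩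
  ract_module := ⟨by simp, by simp⟩
  lact_ract := by simp
  δ := H.Δ
  δ_bilin a b X u hu := by
    have h := H.Δ_mul (H.algL.mul (H.s a) X) (H.s b) (TensorProduct.map (H.sL a) LinearMap.id u)
      (H.s b ⊗ₜ[k] H.algL.one) (by
        have := H.Δ_bilin a H.algB.one X u hu
        simp only [EnvRing.t_one, AlgebraOn.one_mul] at this
        rw [this]
        congr 2
        ext X
        simp) (H.Δ_s b).symm
    simp only [EnvRing.sL_apply, EnvRing.sR_apply, ← H.algL.mul_assoc]
    rw [h]
    congr 1
    clear hu h
    induction u using TensorProduct.induction_on with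
    | zero => simp
    | tmul x y => simp
    | add x y hx hy => simp only [map_add, LinearMap.add_apply, hx, hy]
  δ_takeuchi a X u hu := H.Δ_takeuchi a X u hu
  coassoc X u hu := H.coassoc X u hu
  counit X u hu := H.counit_left X u hu

@[simp] theorem reg_lact : H.reg.lact = H.sL := rfl
@[simp] theorem reg_ract : H.reg.ract = H.sR := rfl
@[simp] theorem reg_δ : H.reg.δ = H.Δ := rfl

/-- `L ⋄ M` is balanced for `t(b) X ⊗ m = X ⊗ b m`. -/
abbrev Bl (l : B →ₗ[k] M →ₗ[k] M) (f : L → M → Q) : Prop := IsBal H.tL.flip l f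

theorem Δ_t_mul (a : B) (X : L) : H.Δ (H.algL.mul (H.t a) X) =
    ev (H.Δ X) fun Y Z => H.dia H.sL Y (H.algL.mul (H.t a) Z) := by
  obtain ⟨u, hu⟩ := Submodule.mkQ_surjective _ (H.Δ X)
  have h := H.Δ_bilin H.algB.one a X u hu
  simp only [EnvRing.s_one, AlgebraOn.one_mul] at h
  rw [h, ← hu]
  exact toBal_map _ _ (by simp) (IsBal.mk_linear ((H.dia H.sL).compl₂ (H.tL a)) (by
      intro X b n
      simp [H.dia_bal])) u

theorem Δ_mul_t' (a : B) (X : L) : H.Δ (H.algL.mul X (H.t a)) =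
    ev (H.Δ X) fun Y Z => H.dia H.sL Y (H.algL.mul Z (H.t a)) := by
  obtain ⟨u, hu⟩ := Submodule.mkQ_surjective _ (H.Δ X)
  rw [H.Δ_mul_t X a u hu, ← hu]
  exact toBal_map _ _ (by simp)
    (IsBal.mk_linear ((H.dia H.sL).compl₂ (H.algL.mul.flip (H.t a))) (by
      intro X b n
      simp [H.dia_bal])) u

theorem ev_Δ_t_mul {f : L → L → Q} (hf : IsBal H.tL.flip H.sL f) (a : B) (X : L) :
    ev (H.Δ (H.algL.mul (H.t a) X)) f = ev (H.Δ X) fun Y Z => f Y (H.algL.mul (H.t a) Z) := by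
  rw [ev_eq_blift _ _ hf, Δ_t_mul]
  simp [ev_map]

theorem ev_Δ_s_mul {f : L → L → Q} (hf : IsBal H.tL.flip H.sL f) (a : B) (X : L) :
    ev (H.Δ (H.algL.mul (H.s a) X)) f = ev (H.Δ X) fun Y Z => f (H.algL.mul (H.s a) Y) Z :=
  H.reg.ev_δ_lact hf a X

theorem ev_Δ_mul_s {f : L → L → Q} (hf : IsBal H.tL.flip H.sL f) (a : B) (X : L) :
    ev (H.Δ (H.algL.mul X (H.s a))) f = ev (H.Δ X) fun Y Z => f (H.algL.mul Y (H.s a)) Z :=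
  H.reg.ev_δ_ract hf a X

theorem ev_Δ_mul_t {f : L → L → Q} (hf : IsBal H.tL.flip H.sL f) (a : B) (X : L) :
    ev (H.Δ (H.algL.mul X (H.t a))) f = ev (H.Δ X) fun Y Z => f Y (H.algL.mul Z (H.t a)) := by
  rw [ev_eq_blift _ _ hf, Δ_mul_t']
  simp [ev_map]

theorem ev_Δ_tak {f : L → L → Q} (hf : IsBal H.tL.flip H.sL f) (a : B) (X : L) :
    (ev (H.Δ X) fun Y Z => f (H.algL.mul Y (H.t a)) Z) =
      ev (H.Δ X) fun Y Z => f Y (H.algL.mul Z (H.s a)) :=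
  H.reg.δ_tak_ev hf a X

theorem Δ_one' : H.Δ H.algL.one = H.dia H.sL H.algL.one H.algL.one := H.Δ_one

theorem ev_Δ_one {f : L → L → Q} (hf : IsBal H.tL.flip H.sL f) :
    ev (H.Δ H.algL.one) f = f H.algL.one H.algL.one := by
  rw [H.Δ_one', ev_tm hf]

theorem ε_s_mul (a : B) (X : L) : H.ε (H.algL.mul (H.s a) X) = H.algB.mul a (H.ε X) := by
  simpa using H.ε_bilin a H.algB.one X

theorem ε_t_mul (a : B) (X : L) : H.ε (H.algL.mul (H.t a) X) = H.algB.mul (H.ε X) a := by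
  simpa using H.ε_bilin H.algB.one a X

@[simp] theorem ε_s (a : B) : H.ε (H.s a) = a := by
  simpa [H.ε_one] using H.ε_s_mul a H.algL.one

@[simp] theorem ε_t (a : B) : H.ε (H.t a) = a := by
  simpa [H.ε_one] using H.ε_t_mul a H.algL.one

theorem counit_right_ev (X : L) :
    (ev (H.Δ X) fun Y Z => H.algL.mul (H.t (H.ε Z)) Y) = X := by
  obtain ⟨u, hu⟩ := Submodule.mkQ_surjective _ (H.Δ X)
  conv_rhs => rw [← H.counit_right X u hu]
  rw [← hu, ev_toBal_eq _ u (TensorProduct.lift (H.tL ∘ₗ H.ε).flip) (by simp)]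
  refine IsBal.mk_linear (H.tL ∘ₗ H.ε).flip ?_
  intro X b n
  simp [H.ε_s_mul]

variable {H}

/-- Trilinear functions on `L ⋄ L ⋄ M`. -/
abbrev Bl₃ (H : LeftBialgebroid k B L) (l : B →ₗ[k] M →ₗ[k] M) (T : L → L → M → Q) : Prop :=
  IsBal₃ H.tL.flip H.sL H.tL.flip l T

/-- Applying the coaction to the last factor of a balanced trilinear function leaves a balanced
function. Only the left linearity of the map `δ` enters, so this is available while a comodule is
being constructed. -/
theorem Comodule.isBal_ev_of {l : B →ₗ[k] M →ₗ[k] M} {δ : M →ₗ[k] H.Dia l}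
    (hl : ∀ a m, δ (l a m) = ev (δ m) fun X n => H.dia l (H.algL.mul (H.s a) X) n)
    {T : L → L → M → Q} (hT : H.Bl₃ l T) : H.Bl l fun X n => ev (δ n) (T X) where
  add_left X X' n := by
    rw [← ev_add_fun]; congr 1; ext Y p; exact (hT.left p).add_left _ _ _
  smul_left c X n := by
    rw [← ev_smul_fun]; congr 1; ext Y p; exact (hT.left p).smul_left _ _ _
  add_right X n n' := by rw [map_add, ev_add (hT.right X)]
  smul_right c X n := by rw [map_smul, ev_smul (hT.right X)]
  bal X b n := by
    rw [hl, ev_ev (hT.right X)]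
    congr 1; ext Y p
    rw [ev_tm (hT.right X)]
    exact (hT.left p).bal _ _ _

theorem Comodule.isBal_ev_δ (cM : H.Comodule M) {T : L → L → M → Q} (hT : H.Bl₃ cM.lact T) :
    H.Bl cM.lact fun X n => ev (cM.δ n) (T X) := isBal_ev_of cM.δ_lact hT

theorem isBal_ev_Δ {l : B →ₗ[k] M →ₗ[k] M} {T : L → L → M → Q} (hT : H.Bl₃ l T) :
    H.Bl l fun X n => ev (H.Δ X) fun Y Z => T Y Z n where
  add_left X X' n := by rw [map_add, ev_add (hT.left n)]
  smul_left c X n := by rw [map_smul, ev_smul (hT.left n)]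
  add_right X n n' := by
    rw [← ev_add_fun]; congr 1; ext Y Z; exact (hT.right Y).add_right _ _ _
  smul_right c X n := by
    rw [← ev_smul_fun]; congr 1; ext Y Z; exact (hT.right Y).smul_right _ _ _
  bal X b n := by
    have := H.ev_Δ_t_mul (hT.left n) b X
    refine this.trans ?_
    congr 1; ext Y Z; exact (hT.right Y).bal _ _ _

theorem Comodule.tripleR_ev (l : B →ₗ[k] M →ₗ[k] M) (δ : M →ₗ[k] H.Dia l) (u : L ⊗[k] M)
    (h : H.Bl l fun X n => ev (δ n) fun Y p => trip H.tL.flip H.sL H.tL.flip l X Y p) :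
    tripleR H.tL.flip H.sL H.tL.flip l (TensorProduct.map LinearMap.id δ u) =
      ev (H.toDia l u) fun X n => ev (δ n) fun Y p => trip H.tL.flip H.sL H.tL.flip l X Y p := by
  refine (ev_toBal_eq h u (tripleR H.tL.flip H.sL H.tL.flip l ∘ₗ
    TensorProduct.map LinearMap.id δ) fun X n => ?_).symm
  exact tripleR_eq_ev X (δ n)

theorem Comodule.tripleL_ev (l : B →ₗ[k] M →ₗ[k] M) (u : L ⊗[k] M) :
    tripleL H.tL.flip H.sL H.tL.flip l (TensorProduct.map H.Δ LinearMap.id u) =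
      ev (H.toDia l u) fun X n => ev (H.Δ X) fun Y Z =>
        trip H.tL.flip H.sL H.tL.flip l Y Z n := by
  refine (ev_toBal_eq (isBal_ev_Δ trip_isBal₃) u (tripleL H.tL.flip H.sL H.tL.flip l ∘ₗ
    TensorProduct.map H.Δ LinearMap.id) fun X n => ?_).symm
  exact tripleL_eq_ev (H.Δ X) n

/-- Coassociativity, evaluated on a trilinear function. -/
theorem Comodule.coassoc_ev (cM : H.Comodule M) {T : L → L → M → Q} (hT : H.Bl₃ cM.lact T)
    (m : M) : (ev (cM.δ m) fun X n => ev (cM.δ n) fun Y p => T X Y p) =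
      ev (cM.δ m) fun X n => ev (H.Δ X) fun Y Z => T Y Z n := by
  obtain ⟨u, hu⟩ := Submodule.mkQ_surjective _ (cM.δ m)
  have h := cM.coassoc m u hu
  rw [tripleR_ev _ _ _ (cM.isBal_ev_δ trip_isBal₃), tripleL_ev] at h
  rw [← hu]
  simpa [ev_map] using congrArg (tlift T hT) h

/-- A comodule from Sweedler formulas. -/
abbrev Comodule.ofSweedler (lact : B →ₗ[k] M →ₗ[k] M) (ract : M →ₗ[k] B →ₗ[k] M)
    (lact_module : IsLeftModule H.algB lact) (ract_module : IsRightModule H.algB ract)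
    (lact_ract : ∀ (a b : B) (m : M), ract (lact a m) b = lact a (ract m b))
    (δ : M →ₗ[k] H.Dia lact)
    (hl : ∀ a m, δ (lact a m) = ev (δ m) fun X n => H.dia lact (H.algL.mul (H.s a) X) n)
    (hr : ∀ a m, δ (ract m a) = ev (δ m) fun X n => H.dia lact (H.algL.mul X (H.s a)) n)
    (ht : ∀ a m, (ev (δ m) fun X n => H.dia lact (H.algL.mul X (H.t a)) n) =
      ev (δ m) fun X n => H.dia lact X (ract n a))
    (hc : ∀ m, (ev (δ m) fun X n => ev (δ n) fun Y p =>
        trip H.tL.flip H.sL H.tL.flip lact X Y p) =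
      ev (δ m) fun X n => ev (H.Δ X) fun Y Z => trip H.tL.flip H.sL H.tL.flip lact Y Z n)
    (hε : ∀ m, (ev (δ m) fun X n => lact (H.ε X) n) = m) : H.Comodule M where
  lact := lact
  ract := ract
  lact_module := lact_module
  ract_module := ract_module
  lact_ract := lact_ract
  δ := δ
  δ_bilin a b m u hu := by
    have hb : H.Bl lact fun X n => H.dia lact (H.algL.mul (H.s a) X) n :=
      isBal_left lact (H.sL a) (by simp)
    rw [hl, hr, ev_ev hb, toBal_map _ _ (fun _ _ => rfl)
      (isBal_left lact (H.sL a ∘ₗ H.sR.flip b) (by simp)), hu]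
    congr 1
    ext X n
    rw [ev_tm hb]
    rfl
  δ_takeuchi a m u hu := by
    rw [toBal_map _ _ (fun _ _ => rfl) (isBal_left lact (H.tR.flip a) (by simp)),
      toBal_map _ _ (fun _ _ => rfl) (IsBal.mk_linear (r := H.tL.flip) (l := lact)
        ((H.dia lact).compl₂ (ract.flip a)) (by
          intro X b n
          simp [H.dia_bal, lact_ract])), hu]
    exact ht a m
  coassoc m u hu := by
    rw [Comodule.tripleR_ev _ _ _ (isBal_ev_of hl trip_isBal₃), Comodule.tripleL_ev, hu, hc]
  counit m u hu := by
    conv_rhs => rw [← hε m]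
    rw [← hu, ev_toBal_eq _ u (TensorProduct.lift (lact ∘ₗ H.ε)) (by simp)]
    refine IsBal.mk_linear (lact ∘ₗ H.ε) ?_
    intro X b n
    simp [H.ε_t_mul, lact_module.mul_act]

end LeftBialgebroid
end Bialgebroid

/-! ### Morphisms of comodules -/

section Multi

variable {k : Type v} [Field k] {B M N A : Type u}
  [AddCommGroup B] [Module k B] [AddCommGroup M] [Module k M]
  [AddCommGroup N] [Module k N] [AddCommGroup A] [Module k A]
  {Q : Type*} [AddCommGroup Q] [Module k Q]
  {r : M →ₗ[k] B →ₗ[k] M} {l : B →ₗ[k] N →ₗ[k] N}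

/-- A family of balanced functions depending linearly on a parameter. -/
def bliftL (F : A →ₗ[k] M →ₗ[k] N →ₗ[k] Q) (h : ∀ a m b n, F a (r m b) n = F a m (l b n)) :
    A →ₗ[k] Bal r l →ₗ[k] Q where
  toFun a := blift (fun m n => F a m n) (IsBal.mk_linear (F a) (h a))
  map_add' a a' := Bal.hom_ext (by simp)
  map_smul' c a := Bal.hom_ext (by simp)

end Multi

section Bialgebroid

variable {k : Type v} [Field k] {B L : Type u} [AddCommGroup B] [Module k B]
  [AddCommGroup L] [Module k L] {M N P V : Type u} [AddCommGroup M] [Module k M]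
  [AddCommGroup N] [Module k N] [AddCommGroup P] [Module k P] [AddCommGroup V] [Module k V]
  {Q : Type*} [AddCommGroup Q] [Module k Q]

namespace LeftBialgebroid

variable {H : LeftBialgebroid k B L}

/-- A left `B`-linear and `L`-colinear map. -/
structure CoHom (cM : H.Comodule M) (cN : H.Comodule N) (φ : M →ₗ[k] N) : Prop where
  left : ∀ b m, φ (cM.lact b m) = cN.lact b (φ m)
  colin : ∀ m, cN.δ (φ m) = ev (cM.δ m) fun X n => H.dia cN.lact X (φ n)

/-- A `B`-balanced, `B`-bilinear and `L`-colinear map `M × N → P`, that is, a morphism of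
comodules on `M ⊗_B N`. -/
structure CoBilin (cM : H.Comodule M) (cN : H.Comodule N) (cP : H.Comodule P)
    (f : M →ₗ[k] N →ₗ[k] P) : Prop where
  bal : ∀ m b n, f (cM.ract m b) n = f m (cN.lact b n)
  left : ∀ b m n, f (cM.lact b m) n = cP.lact b (f m n)
  right : ∀ m n b, f m (cN.ract n b) = cP.ract (f m n) b
  colin : ∀ m n, cP.δ (f m n) = ev (cN.δ n) fun Y n' => ev (cM.δ m) fun X m' =>
    H.dia cP.lact (H.algL.mul X Y) (f m' n')

theorem CoHom.isBal {cM : H.Comodule M} {cN : H.Comodule N} {φ : M →ₗ[k] N} (h : CoHom cM cN φ) :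
    H.Bl cM.lact fun X n => H.dia cN.lact X (φ n) :=
  IsBal.mk_linear ((H.dia cN.lact).compl₂ φ) (by intro X b n; simp [h.left, H.dia_bal])

theorem CoHom.ev {cM : H.Comodule M} {cN : H.Comodule N} {φ : M →ₗ[k] N} (h : CoHom cM cN φ)
    {g : L → N → Q} (hg : H.Bl cN.lact g) (m : M) :
    ev (cN.δ (φ m)) g = ev (cM.δ m) fun X n => g X (φ n) := by
  rw [h.colin, ev_ev hg]
  simp only [ev_tm hg]

theorem CoHom.id (cM : H.Comodule M) : CoHom cM cM LinearMap.id := ⟨by simp, by simp⟩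

/-- The inner sum of a double sum over `δ m` and `δ n` is a balanced function of the summands of
`δ n`; this uses the Takeuchi condition of `M`. -/
theorem Comodule.isBal_double (cM : H.Comodule M) {l : B →ₗ[k] N →ₗ[k] N} {T : L → M → L → N → Q}
    (h1 : ∀ Y n, H.Bl cM.lact fun X m => T X m Y n)
    (h2 : ∀ X m, ∃ F : L →ₗ[k] N →ₗ[k] Q, ∀ Y n, T X m Y n = F Y n)
    (h3 : ∀ X m Y n b, T X m (H.algL.mul (H.t b) Y) n = T (H.algL.mul X (H.t b)) m Y n)
    (h4 : ∀ X m Y n b, T X (cM.ract m b) Y n = T X m Y (l b n)) (m : M) :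
    H.Bl l fun Y n => ev (cM.δ m) fun X m' => T X m' Y n where
  add_left Y Y' n := by
    rw [← ev_add_fun]; congr 1; ext X m'; obtain ⟨F, hF⟩ := h2 X m'; simp [hF]
  smul_left c Y n := by
    rw [← ev_smul_fun]; congr 1; ext X m'; obtain ⟨F, hF⟩ := h2 X m'; simp [hF]
  add_right Y n n' := by
    rw [← ev_add_fun]; congr 1; ext X m'; obtain ⟨F, hF⟩ := h2 X m'; simp [hF]
  smul_right c Y n := by
    rw [← ev_smul_fun]; congr 1; ext X m'; obtain ⟨F, hF⟩ := h2 X m'; simp [hF]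
  bal Y b n := by
    refine Eq.trans (congrArg (HopfCotwist.ev (cM.δ m)) ?_)
      ((cM.δ_tak_ev (h1 Y n) b m).trans (congrArg (HopfCotwist.ev (cM.δ m)) ?_))
    · funext X m'
      simp [h3]
    · funext X m'
      simp [h4]

/-- A bilinear operation `φ` on `L` for which `φ(X, Y) ⋄ f(m, n)` may be summed over
`δ m` and `δ n`. -/
structure IsDiagonal (φ : L →ₗ[k] L →ₗ[k] L) : Prop where
  t_left : ∀ b X Y, φ (H.algL.mul (H.t b) X) Y = H.algL.mul (H.t b) (φ X Y)
  t_mid : ∀ b X Y, φ (H.algL.mul X (H.t b)) Y = φ X (H.algL.mul (H.t b) Y)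

theorem isDiagonal_mul : IsDiagonal (H := H) H.algL.mul := ⟨by simp, by simp⟩

theorem IsDiagonal.isBal_inner {φ : L →ₗ[k] L →ₗ[k] L} (hφ : IsDiagonal (H := H) φ)
    {cM : H.Comodule M} {f : M →ₗ[k] N →ₗ[k] P} {l : B →ₗ[k] P →ₗ[k] P}
    (hl : ∀ b m n, f (cM.lact b m) n = l b (f m n)) (Y : L) (n : N) :
    H.Bl cM.lact fun X m => H.dia l (φ X Y) (f m n) :=
  IsBal.mk_linear ((H.dia l).compl₁₂ (φ.flip Y) (f.flip n))
    (by intro X b m; simp [hφ.t_left, hl, H.dia_bal])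

theorem IsDiagonal.isBal_outer {φ : L →ₗ[k] L →ₗ[k] L} (hφ : IsDiagonal (H := H) φ)
    {cM : H.Comodule M} {cN : H.Comodule N} {f : M →ₗ[k] N →ₗ[k] P} {l : B →ₗ[k] P →ₗ[k] P}
    (hl : ∀ b m n, f (cM.lact b m) n = l b (f m n))
    (hb : ∀ m b n, f (cM.ract m b) n = f m (cN.lact b n)) (m : M) :
    H.Bl cN.lact fun Y n => ev (cM.δ m) fun X m' => H.dia l (φ X Y) (f m' n) :=
  cM.isBal_double (hφ.isBal_inner hl)
    (fun X m => ⟨(H.dia l).compl₁₂ (φ X) (f m), fun _ _ => rfl⟩)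
    (fun X m Y n b => by simp [hφ.t_mid]) (fun X m Y n b => by simp [hb]) m

/-- The base algebra as a comodule, `δ b = b ⋄ 1`. -/
abbrev base (H : LeftBialgebroid k B L) : H.Comodule B :=
  Comodule.ofSweedler H.algB.mul H.algB.mul ⟨by simp, by simp⟩ ⟨by simp, by simp⟩ (by simp)
    ((H.dia H.algB.mul).flip H.algB.one ∘ₗ H.s)
    (fun a m => by
      have hb := Comodule.isBal_left (H := H) H.algB.mul (H.sL a) (by simp)
      simp only [EnvRing.sL_apply] at hb
      simp [ev_tm hb])
    (fun a m => by
      have hb := Comodule.isBal_left (H := H) H.algB.mul (H.sR.flip a) (by simp)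
      simp only [LinearMap.flip_apply, EnvRing.sR_apply] at hb
      simp [ev_tm hb])
    (fun a m => by
      have hb := Comodule.isBal_left (H := H) H.algB.mul (H.tR.flip a) (by simp)
      simp only [LinearMap.flip_apply, EnvRing.tR_apply] at hb
      have hb' : H.Bl H.algB.mul fun X n => H.dia H.algB.mul X (H.algB.mul n a) :=
        IsBal.mk_linear ((H.dia H.algB.mul).compl₂ (H.algB.mul.flip a)) (by
          intro X b n; simp [H.dia_bal])
      have := H.dia_bal H.algB.mul a (H.s m) H.algB.one
      simpa [ev_tm hb, ev_tm hb'] using this)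
    (fun m => by
      have hl : ∀ (a : B) (m : B), ((H.dia H.algB.mul).flip H.algB.one ∘ₗ H.s) (H.algB.mul a m) =
          ev (((H.dia H.algB.mul).flip H.algB.one ∘ₗ H.s) m) fun X n =>
            H.dia H.algB.mul (H.algL.mul (H.s a) X) n := by
        intro a m
        have hb := Comodule.isBal_left (H := H) H.algB.mul (H.sL a) (by simp)
        simp only [EnvRing.sL_apply] at hb
        simp [ev_tm hb]
      have h1 := Comodule.isBal_ev_of (l := H.algB.mul) hl trip_isBal₃
      have h2 := isBal_ev_Δ (H := H) (l := H.algB.mul) trip_isBal₃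
      refine (ev_tm h1 _ _).trans (Eq.trans ?_ (ev_tm h2 _ _).symm)
      refine (ev_tm (trip_isBal₃.right _) _ _).trans (Eq.trans ?_
        (congrArg (fun z => ev z _) (H.Δ_s m)).symm)
      refine Eq.trans ?_ (ev_tm (trip_isBal₃.left _) _ _).symm
      simp)
    (fun m => by
      have hb : H.Bl H.algB.mul fun X n => H.algB.mul (H.ε X) n :=
        IsBal.mk_linear (H.algB.mul ∘ₗ H.ε) (by intro X b n; simp [H.ε_t_mul])
      simp [ev_tm hb])

@[simp] theorem base_lact : H.base.lact = H.algB.mul := rfl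

theorem ev_base_δ {g : L → B → Q} (hg : H.Bl H.algB.mul g) (b : B) :
    ev (H.base.δ b) g = g (H.s b) H.algB.one := ev_tm hg _ _

/-- The left action is a morphism `B ⊗_B M → M`. -/
theorem Comodule.coBilin_lact (cM : H.Comodule M) : CoBilin H.base cM cM cM.lact where
  bal := by simp
  left := by simp
  right := by simp
  colin b m := by
    rw [cM.δ_lact]
    congr 1; ext Y n
    rw [ev_base_δ (isDiagonal_mul.isBal_inner (cM := H.base) (by simp) Y n)]
    simp

/-- The right action is a morphism `M ⊗_B B → M`. -/
theorem Comodule.coBilin_ract (cM : H.Comodule M) : CoBilin cM H.base cM cM.ract where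
  bal := by simp
  left := by simp
  right := by simp
  colin m b := by
    rw [cM.δ_ract, ev_base_δ (isDiagonal_mul.isBal_outer (cM := cM) (cN := H.base) (f := cM.ract)
      (by simp) (by simp) m)]
    simp

/-- The product of `L` is a morphism `L ⊗_B L → L`. -/
theorem coBilin_mul (H : LeftBialgebroid k B L) : CoBilin H.reg H.reg H.reg H.algL.mul where
  bal := by simp
  left := by simp
  right := by simp
  colin X Y := by
    obtain ⟨u, hu⟩ := Submodule.mkQ_surjective _ (H.Δ X)
    obtain ⟨w, hw⟩ := Submodule.mkQ_surjective _ (H.Δ Y)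
    have h := H.Δ_mul X Y u w hu hw
    have hin := isDiagonal_mul.isBal_inner (cM := H.reg) (f := H.algL.mul) (l := H.sL) (by simp)
    have hout := isDiagonal_mul.isBal_outer (cM := H.reg) (cN := H.reg) (f := H.algL.mul)
      (l := H.sL) (by simp) (by simp) X
    rw [← hu] at hout
    refine h.trans ?_
    change _ = ev (H.Δ Y) fun Y n' => ev (H.Δ X) fun X m' =>
      H.dia H.sL (H.algL.mul X Y) (H.algL.mul m' n')
    rw [← hw, ← hu]
    refine Eq.symm (ev_toBal_eq hout w (H.toDia H.sL ∘ₗ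
      TensorProduct.map₂ H.algL.mul H.algL.mul u) fun Y Z => ?_)
    exact Eq.symm (ev_toBal_eq (hin Y Z) u (H.toDia H.sL ∘ₗ
      (TensorProduct.map₂ H.algL.mul H.algL.mul).flip (Y ⊗ₜ Z)) fun _ _ => rfl)

/-- `f(m, n)₋₁ ⋄ f(m, n)₀ = m₋₁ n₋₁ ⋄ f(m₀, n₀)`, inserted into a balanced function. -/
theorem CoBilin.ev {cM : H.Comodule M} {cN : H.Comodule N} {cP : H.Comodule P}
    {f : M →ₗ[k] N →ₗ[k] P} (hf : CoBilin cM cN cP f) {g : L → P → Q} (hg : H.Bl cP.lact g)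
    (m : M) (n : N) : ev (cP.δ (f m n)) g = ev (cN.δ n) fun Y n' => ev (cM.δ m) fun X m' =>
      g (H.algL.mul X Y) (f m' n') := by
  rw [hf.colin, ev_ev hg]
  congr 1; ext Y n'
  rw [ev_ev hg]
  simp only [ev_tm hg]

theorem ev_Δ_mul {g : L → L → Q} (hg : H.Bl H.sL g) (X Y : L) :
    HopfCotwist.ev (H.Δ (H.algL.mul X Y)) g =
      HopfCotwist.ev (H.Δ Y) fun Y₁ Y₂ => HopfCotwist.ev (H.Δ X) fun X₁ X₂ =>
        g (H.algL.mul X₁ Y₁) (H.algL.mul X₂ Y₂) :=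
  H.coBilin_mul.ev hg X Y

end LeftBialgebroid
end Bialgebroid

/-! ### The tensor product of comodules -/

section Bialgebroid

variable {k : Type v} [Field k] {B L : Type u} [AddCommGroup B] [Module k B]
  [AddCommGroup L] [Module k L] {M N P V : Type u} [AddCommGroup M] [Module k M]
  [AddCommGroup N] [Module k N] [AddCommGroup P] [Module k P] [AddCommGroup V] [Module k V]
  {Q : Type*} [AddCommGroup Q] [Module k Q]

namespace LeftBialgebroid

variable {H : LeftBialgebroid k B L}

namespace Comodule

variable (cM : H.Comodule M) (cN : H.Comodule N)

/-- The left action of `B` on `M ⊗_B N`. -/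
def tensLact : B →ₗ[k] Bal cM.ract cN.lact →ₗ[k] Bal cM.ract cN.lact :=
  bliftL ((LinearMap.llcomp k M M (N →ₗ[k] Bal cM.ract cN.lact) (tm cM.ract cN.lact)) ∘ₗ cM.lact)
    (by intro a m b n; simp [← tm_bal])

@[simp] theorem tensLact_tm (b : B) (m : M) (n : N) :
    tensLact cM cN b (tm cM.ract cN.lact m n) = tm cM.ract cN.lact (cM.lact b m) n := rfl

/-- The right action of `B` on `M ⊗_B N`. -/
def tensRact : Bal cM.ract cN.lact →ₗ[k] B →ₗ[k] Bal cM.ract cN.lact :=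
  (bliftL ((LinearMap.mk₂ k (fun a m => tm cM.ract cN.lact m ∘ₗ cN.ract.flip a)
    (by intros; ext; simp) (by intros; ext; simp) (by intros; ext; simp) (by intros; ext; simp)))
    (by intro a m b n; simp [tm_bal])).flip

@[simp] theorem tensRact_tm (b : B) (m : M) (n : N) :
    tensRact cM cN (tm cM.ract cN.lact m n) b = tm cM.ract cN.lact m (cN.ract n b) := rfl

theorem isBal_tens_inner (Y : L) (n : N) : H.Bl cM.lact fun X m' =>
    H.dia (tensLact cM cN) (H.algL.mul X Y) (tm cM.ract cN.lact m' n) :=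
  isDiagonal_mul.isBal_inner (fun _ _ _ => rfl) Y n

theorem isBal_tens_outer (m : M) : H.Bl cN.lact fun Y n' => ev (cM.δ m) fun X m' =>
    H.dia (tensLact cM cN) (H.algL.mul X Y) (tm cM.ract cN.lact m' n') :=
  isDiagonal_mul.isBal_outer (fun _ _ _ => rfl) (fun m b n => tm_bal _ _ m b n) m

/-- The diagonal coaction on `M ⊗_B N`. -/
noncomputable def tensδ : Bal cM.ract cN.lact →ₗ[k] H.Dia (tensLact cM cN) :=
  blift (fun m n => ev (cN.δ n) fun Y n' => ev (cM.δ m) fun X m' =>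
    H.dia (tensLact cM cN) (H.algL.mul X Y) (tm cM.ract cN.lact m' n'))
  { add_left := fun m m' n => by
      rw [← ev_add_fun]; congr 1; ext Y n'; rw [map_add, ev_add (isBal_tens_inner cM cN Y n')]
    smul_left := fun c m n => by
      rw [← ev_smul_fun]; congr 1; ext Y n'; rw [map_smul, ev_smul (isBal_tens_inner cM cN Y n')]
    add_right := fun m n n' => by rw [map_add, ev_add (isBal_tens_outer cM cN m)]
    smul_right := fun c m n => by rw [map_smul, ev_smul (isBal_tens_outer cM cN m)]
    bal := fun m b n => by
      rw [cN.ev_δ_lact (isBal_tens_outer cM cN m)]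
      congr 1; ext Y n'
      rw [cM.ev_δ_ract (isBal_tens_inner cM cN Y n')]
      simp }

theorem tensδ_tm (m : M) (n : N) : tensδ cM cN (tm cM.ract cN.lact m n) =
    ev (cN.δ n) fun Y n' => ev (cM.δ m) fun X m' =>
      H.dia (tensLact cM cN) (H.algL.mul X Y) (tm cM.ract cN.lact m' n') := rfl

theorem ev_tensδ {g : L → Bal cM.ract cN.lact → Q} (hg : H.Bl (tensLact cM cN) g) (m : M) (n : N) :
    ev (tensδ cM cN (tm cM.ract cN.lact m n)) g = ev (cN.δ n) fun Y n' => ev (cM.δ m) fun X m' =>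
      g (H.algL.mul X Y) (tm cM.ract cN.lact m' n') := by
  rw [tensδ_tm, ev_ev hg]
  congr 1; ext Y n'
  rw [ev_ev hg]
  congr 1; ext X m'
  rw [ev_tm hg]

theorem tensδ_lact (a : B) (z : Bal cM.ract cN.lact) : tensδ cM cN (tensLact cM cN a z) =
    ev (tensδ cM cN z) fun X n => H.dia (tensLact cM cN) (H.algL.mul (H.s a) X) n := by
  have hg : H.Bl (tensLact cM cN) fun X n => H.dia (tensLact cM cN) (H.algL.mul (H.s a) X) n :=
    isBal_left (tensLact cM cN) (H.sL a) (by simp)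
  rw [ev_eq_blift _ _ hg]
  revert z
  refine LinearMap.ext_iff.1 (Bal.hom_ext (f := tensδ cM cN ∘ₗ tensLact cM cN a)
    (g := blift _ hg ∘ₗ tensδ cM cN) fun m n => ?_)
  simp only [LinearMap.comp_apply, tensLact_tm, ← ev_eq_blift _ _ hg]
  rw [ev_tensδ cM cN hg, tensδ_tm]
  congr 1; ext Y n'
  rw [cM.ev_δ_lact (isBal_tens_inner cM cN Y n')]
  simp

theorem tensδ_ract (a : B) (z : Bal cM.ract cN.lact) : tensδ cM cN (tensRact cM cN z a) =
    ev (tensδ cM cN z) fun X n => H.dia (tensLact cM cN) (H.algL.mul X (H.s a)) n := by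
  have hg : H.Bl (tensLact cM cN) fun X n => H.dia (tensLact cM cN) (H.algL.mul X (H.s a)) n :=
    isBal_left (tensLact cM cN) (H.sR.flip a) (by simp)
  rw [ev_eq_blift _ _ hg]
  revert z
  refine LinearMap.ext_iff.1 (Bal.hom_ext (f := tensδ cM cN ∘ₗ (tensRact cM cN).flip a)
    (g := blift _ hg ∘ₗ tensδ cM cN) fun m n => ?_)
  simp only [LinearMap.comp_apply, LinearMap.flip_apply, tensRact_tm, ← ev_eq_blift _ _ hg]
  rw [ev_tensδ cM cN hg, tensδ_tm, cN.ev_δ_ract (isBal_tens_outer cM cN m)]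
  simp

theorem tensRact_lact (a b : B) (z : Bal cM.ract cN.lact) :
    tensRact cM cN (tensLact cM cN a z) b = tensLact cM cN a (tensRact cM cN z b) := by
  revert z
  exact LinearMap.ext_iff.1 (Bal.hom_ext (f := (tensRact cM cN).flip b ∘ₗ tensLact cM cN a)
    (g := tensLact cM cN a ∘ₗ (tensRact cM cN).flip b) fun m n => by simp)

theorem tensδ_tak (a : B) (z : Bal cM.ract cN.lact) :
    (ev (tensδ cM cN z) fun X n => H.dia (tensLact cM cN) (H.algL.mul X (H.t a)) n) =
      ev (tensδ cM cN z) fun X n => H.dia (tensLact cM cN) X (tensRact cM cN n a) := by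
  have hg : H.Bl (tensLact cM cN) fun X n => H.dia (tensLact cM cN) (H.algL.mul X (H.t a)) n :=
    isBal_left (tensLact cM cN) (H.tR.flip a) (by simp)
  have hg' : H.Bl (tensLact cM cN) fun X n => H.dia (tensLact cM cN) X (tensRact cM cN n a) :=
    IsBal.mk_linear ((H.dia (tensLact cM cN)).compl₂ ((tensRact cM cN).flip a))
      (by intro X b n; simp [H.dia_bal, tensRact_lact])
  rw [ev_eq_blift _ _ hg, ev_eq_blift _ _ hg']
  revert z
  refine LinearMap.ext_iff.1 (Bal.hom_ext (f := blift _ hg ∘ₗ tensδ cM cN)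
    (g := blift _ hg' ∘ₗ tensδ cM cN) fun m n => ?_)
  simp only [LinearMap.comp_apply, ← ev_eq_blift _ _ hg, ← ev_eq_blift _ _ hg']
  rw [ev_tensδ cM cN hg, ev_tensδ cM cN hg']
  simpa using cN.δ_tak_ev (isBal_tens_outer cM cN m) a n

theorem tens_coassoc (z : Bal cM.ract cN.lact) :
    (ev (tensδ cM cN z) fun X n => ev (tensδ cM cN n) fun Y p =>
        trip H.tL.flip H.sL H.tL.flip (tensLact cM cN) X Y p) =
      ev (tensδ cM cN z) fun X n => ev (H.Δ X) fun Y Z =>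
        trip H.tL.flip H.sL H.tL.flip (tensLact cM cN) Y Z n := by
  have ht := trip_isBal₃ (r₁ := H.tL.flip) (l₁ := H.sL) (r₂ := H.tL.flip) (l₂ := tensLact cM cN)
  have hg := isBal_ev_of (H := H) (tensδ_lact cM cN) ht
  have hg' := isBal_ev_Δ (H := H) ht
  rw [ev_eq_blift _ _ hg, ev_eq_blift _ _ hg']
  revert z
  refine LinearMap.ext_iff.1 (Bal.hom_ext (f := blift _ hg ∘ₗ tensδ cM cN)
    (g := blift _ hg' ∘ₗ tensδ cM cN) fun m n => ?_)
  simp only [LinearMap.comp_apply, ← ev_eq_blift _ _ hg, ← ev_eq_blift _ _ hg']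
  rw [ev_tensδ cM cN hg, ev_tensδ cM cN hg']
  -- coassociativity of `M` for fixed summands of `δ n`, then coassociativity of `N`
  have h3 : ∀ Y Y' n, H.Bl₃ cM.lact fun X X' m => trip H.tL.flip H.sL H.tL.flip (tensLact cM cN)
      (H.algL.mul X Y) (H.algL.mul X' Y') (tm cM.ract cN.lact m n) := fun Y Y' n =>
    { left := fun m =>
        { add_left := fun _ _ _ => by simp [(ht.left _).add_left]
          smul_left := fun _ _ _ => by simp [(ht.left _).smul_left]
          add_right := fun _ _ _ => by simp [(ht.left _).add_right]
          smul_right := fun _ _ _ => by simp [(ht.left _).smul_right]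
          bal := fun X b X' => by
            simpa using (ht.left (tm cM.ract cN.lact m n)).bal (H.algL.mul X Y) b
              (H.algL.mul X' Y') }
      right := fun X =>
        { add_left := fun _ _ _ => by simp [(ht.right _).add_left]
          smul_left := fun _ _ _ => by simp [(ht.right _).smul_left]
          add_right := fun _ _ _ => by simp [(ht.right _).add_right]
          smul_right := fun _ _ _ => by simp [(ht.right _).smul_right]
          bal := fun X' b m => by
            simpa using (ht.right (H.algL.mul X Y)).bal (H.algL.mul X' Y') b
              (tm cM.ract cN.lact m n) } }
  have e1 : ∀ Y Y' n'', (ev (cM.δ m) fun X m' => ev (cM.δ m') fun X' m'' =>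
      trip H.tL.flip H.sL H.tL.flip (tensLact cM cN) (H.algL.mul X Y) (H.algL.mul X' Y')
        (tm cM.ract cN.lact m'' n'')) = _ := fun Y Y' n'' => cM.coassoc_ev (h3 Y Y' n'') m
  have h4 : H.Bl₃ cN.lact fun Y Y' n'' => ev (cM.δ m) fun X m' => ev (H.Δ X) fun X₁ X₂ =>
      trip H.tL.flip H.sL H.tL.flip (tensLact cM cN) (H.algL.mul X₁ Y) (H.algL.mul X₂ Y')
        (tm cM.ract cN.lact m' n'') :=
    { left := fun n'' =>
        { add_left := fun _ _ _ => by simp [(ht.left _).add_left, ev_add_fun]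
          smul_left := fun _ _ _ => by simp [(ht.left _).smul_left, ev_smul_fun]
          add_right := fun _ _ _ => by simp [(ht.left _).add_right, ev_add_fun]
          smul_right := fun _ _ _ => by simp [(ht.left _).smul_right, ev_smul_fun]
          bal := fun Y b Y' => by
            congr 1; ext X m'
            simpa using H.ev_Δ_tak ((h3 Y Y' n'').left m') b X }
      right := fun Y =>
        { add_left := fun _ _ _ => by simp [(ht.right _).add_left, ev_add_fun]
          smul_left := fun _ _ _ => by simp [(ht.right _).smul_left, ev_smul_fun]
          add_right := fun _ _ _ => by simp [(ht.right _).add_right, ev_add_fun]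
          smul_right := fun _ _ _ => by simp [(ht.right _).smul_right, ev_smul_fun]
          bal := fun Y' b n'' => by
            rw [← e1 Y, ← e1 Y]
            congr 1; ext X m'
            simpa [tm_bal] using cM.δ_tak_ev ((h3 Y Y' n'').right X) b m' } }
  calc _ = ev (cN.δ n) fun Y n' => ev (cN.δ n') fun Y' n'' => ev (cM.δ m) fun X m' =>
        ev (H.Δ X) fun X₁ X₂ => trip H.tL.flip H.sL H.tL.flip (tensLact cM cN)
          (H.algL.mul X₁ Y) (H.algL.mul X₂ Y') (tm cM.ract cN.lact m' n'') := by
        congr 1; ext Y n'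
        simp_rw [ev_tensδ cM cN (ht.right _)]
        rw [ev_comm]
        congr 1; ext Y' n''
        exact e1 Y Y' n''
    _ = _ := by
        rw [cN.coassoc_ev h4]
        congr 1; ext Y n'
        rw [ev_comm]
        congr 1; ext X m'
        rw [ev_Δ_mul (ht.left _)]

theorem tens_counit (z : Bal cM.ract cN.lact) :
    (ev (tensδ cM cN z) fun X n => tensLact cM cN (H.ε X) n) = z := by
  have hg : H.Bl (tensLact cM cN) fun X n => tensLact cM cN (H.ε X) n :=
    IsBal.mk_linear (tensLact cM cN ∘ₗ H.ε) (by
      intro X b n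
      revert n
      refine LinearMap.ext_iff.1 (Bal.hom_ext (f := tensLact cM cN (H.ε (H.algL.mul (H.t b) X)))
        (g := tensLact cM cN (H.ε X) ∘ₗ tensLact cM cN b) fun m n => ?_)
      simp [H.ε_t_mul])
  rw [ev_eq_blift _ _ hg]
  revert z
  refine LinearMap.ext_iff.1 (Bal.hom_ext (f := blift _ hg ∘ₗ tensδ cM cN)
    (g := LinearMap.id) fun m n => ?_)
  simp only [LinearMap.comp_apply, ← ev_eq_blift _ _ hg, LinearMap.id_apply]
  rw [ev_tensδ cM cN hg]
  have hb : H.Bl cM.lact fun X m' => cM.lact (H.ε X) m' :=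
    IsBal.mk_linear (cM.lact ∘ₗ H.ε) (by intro X b n; simp [H.ε_t_mul])
  calc _ = ev (cN.δ n) fun Y n' => tm cM.ract cN.lact
        (ev (cM.δ m) fun X m' => cM.lact (H.ε (H.algL.mul X (H.t (H.ε Y)))) m') n' := by
        congr 1; ext Y n'
        rw [ev_map₂]
        congr 1; ext X m'
        rw [H.ε_mul_t, tensLact_tm]
    _ = ev (cN.δ n) fun Y n' => tm cM.ract cN.lact m (cN.lact (H.ε Y) n') := by
        congr 1; ext Y n'
        rw [cM.δ_tak_ev hb, ← tm_bal]
        congr 2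
        have := congrArg (fun z => cM.ract z (H.ε Y)) (cM.counit_ev m)
        simpa [ev_map₂] using this
    _ = _ := by rw [← ev_map, cN.counit_ev]

/-- The tensor product `M ⊗_B N` of comodules. -/
noncomputable abbrev tens : H.Comodule (Bal cM.ract cN.lact) :=
  Comodule.ofSweedler (tensLact cM cN) (tensRact cM cN)
    ⟨LinearMap.ext_iff.1 (Bal.hom_ext (f := tensLact cM cN H.algB.one) (g := LinearMap.id)
        (by simp)),
      fun a b => LinearMap.ext_iff.1 (Bal.hom_ext (f := tensLact cM cN (H.algB.mul a b))
        (g := tensLact cM cN a ∘ₗ tensLact cM cN b) (by simp))⟩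
    ⟨LinearMap.ext_iff.1 (Bal.hom_ext (f := (tensRact cM cN).flip H.algB.one)
        (g := LinearMap.id) (by simp)),
      fun a b => LinearMap.ext_iff.1 (Bal.hom_ext (f := (tensRact cM cN).flip (H.algB.mul a b))
        (g := (tensRact cM cN).flip b ∘ₗ (tensRact cM cN).flip a) (by simp))⟩
    (tensRact_lact cM cN) (tensδ cM cN) (tensδ_lact cM cN) (tensδ_ract cM cN) (tensδ_tak cM cN)
    (tens_coassoc cM cN) (tens_counit cM cN)

theorem coBilin_tm : CoBilin cM cN (cM.tens cN) (tm cM.ract cN.lact) where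
  bal m b n := tm_bal _ _ m b n
  left _ _ _ := rfl
  right _ _ _ := rfl
  colin _ _ := rfl

end Comodule
end LeftBialgebroid
end Bialgebroid

/-! ### Twisting balanced maps by a cocycle -/

section Cocycle

variable {k : Type v} [Field k] {B L : Type u} [AddCommGroup B] [Module k B]
  [AddCommGroup L] [Module k L] {M N P V S R : Type u} [AddCommGroup M] [Module k M]
  [AddCommGroup N] [Module k N] [AddCommGroup P] [Module k P] [AddCommGroup V] [Module k V]
  [AddCommGroup S] [Module k S] [AddCommGroup R] [Module k R]
  {M' N' P' : Type u} [AddCommGroup M'] [Module k M']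
  [AddCommGroup N'] [Module k N'] [AddCommGroup P'] [Module k P']
  {Q : Type*} [AddCommGroup Q] [Module k Q]

namespace LeftBialgebroid

variable {H : LeftBialgebroid k B L}

/-- `z` is coinvariant: `δ z = 1 ⋄ z`. -/
def Coinv (cP : H.Comodule P) (z : P) : Prop := cP.δ z = H.dia cP.lact H.algL.one z

theorem Coinv.ev {cP : H.Comodule P} {z : P} (hz : Coinv cP z) {g : L → P → Q}
    (hg : H.Bl cP.lact g) : ev (cP.δ z) g = g H.algL.one z := by
  rw [show cP.δ z = _ from hz, ev_tm hg]

theorem Comodule.isBal_counit (cP : H.Comodule P) : H.Bl cP.lact fun X n => cP.lact (H.ε X) n :=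
  IsBal.mk_linear (cP.lact ∘ₗ H.ε) (by intro X b n; simp [H.ε_t_mul])

/-- A coinvariant element is central; this is the Takeuchi condition. -/
theorem Coinv.comm {cP : H.Comodule P} {z : P} (hz : Coinv cP z) (b : B) :
    cP.ract z b = cP.lact b z := by
  have h := cP.δ_tak b z
  have hg : H.Bl cP.lact fun X n => H.dia cP.lact (H.algL.mul X (H.t b)) n :=
    Comodule.isBal_left cP.lact (H.tR.flip b) (by simp)
  have hg' : H.Bl cP.lact fun X n => H.dia cP.lact X (cP.ract n b) :=
    IsBal.mk_linear ((H.dia cP.lact).compl₂ (cP.ract.flip b))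
      (by intro X b n; simp [H.dia_bal])
  rw [hz.ev hg, hz.ev hg'] at h
  have h' := congrArg (blift _ cP.isBal_counit) h
  simpa [H.ε_one] using h'.symm

namespace TwoCocycle

variable (G : H.TwoCocycle)

section Act

variable (cM : H.Comodule M) (cN : H.Comodule N) (cP : H.Comodule P)

/-- `Y, m ↦ Γ(m₋₁, Y) m₀`. -/
def act : L →ₗ[k] M →ₗ[k] M := (G.evalR cM ∘ₗ cM.δ).flip

theorem isBal_act (Y : L) : H.Bl cM.lact fun X n => cM.lact (G.Γ X Y) n :=
  IsBal.mk_linear (cM.lact ∘ₗ G.Γ.flip Y) (by intro X b n; simp [G.linear])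

theorem act_apply (Y : L) (m : M) :
    G.act cM Y m = ev (cM.δ m) fun X n => cM.lact (G.Γ X Y) n :=
  (ev_hom (cM.δ m) ((G.evalR cM).flip Y)).symm

theorem act_t_mul (b : B) (Y : L) (m : M) :
    G.act cM (H.algL.mul (H.t b) Y) m = cM.ract (G.act cM Y m) b :=
  G.evalR_takeuchi cM m b Y

theorem act_s (b : B) (m : M) : G.act cM (H.s b) m = G.twR cM m b := rfl

@[simp] theorem act_one (m : M) : G.act cM H.algL.one m = m := by
  rw [act_apply]
  simp only [G.one_right]
  exact cM.counit_ev m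

theorem isBal_twMul (Y Z : L) : H.Bl H.sL fun X₁ X₂ =>
    H.algL.mul (H.s (G.Γ X₁ Y)) (H.algL.mul X₂ Z) :=
  IsBal.mk_linear (r := H.tL.flip) (l := H.sL)
    ((H.algL.mul ∘ₗ H.s ∘ₗ G.Γ.flip Y).compl₂ (H.algL.mul.flip Z))
    (by intro X b n; simp [G.linear])

theorem twL_apply (b : B) (m : M) :
    G.twL cM b m = ev (cM.δ m) fun X n => cM.lact (G.Γ (H.s b) X) n :=
  (ev_hom (cM.δ m) ((G.evalL cM).flip b)).symm

/-- `δ(Γ(m₋₁, Y) m₀) = Γ(m₋₂, Y) m₋₁ ⋄ m₀`. -/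
theorem δ_act (Y : L) (m : M) : cM.δ (G.act cM Y m) = ev (cM.δ m) fun X n => ev (H.Δ X)
    fun Z W => H.dia cM.lact (H.algL.mul (H.s (G.Γ Z Y)) W) n := by
  have hT : H.Bl₃ cM.lact fun Z W n => H.dia cM.lact (H.algL.mul (H.s (G.Γ Z Y)) W) n :=
    { left := fun n => IsBal.mk_linear
        (((H.algL.mul ∘ₗ H.s ∘ₗ G.Γ.flip Y)).compr₂ ((H.dia cM.lact).flip n))
        (by intro Z b W; simp [G.linear])
      right := fun Z => Comodule.isBal_left cM.lact (H.sL (G.Γ Z Y)) (by simp) }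
  rw [← cM.coassoc_ev hT, act_apply, ev_map]
  congr 1; ext X n
  rw [cM.δ_lact]

theorem ev_δ_act {g : L → M → Q} (hg : H.Bl cM.lact g) (Y : L) (m : M) :
    ev (cM.δ (G.act cM Y m)) g = ev (cM.δ m) fun X n => ev (H.Δ X)
      fun Z W => g (H.algL.mul (H.s (G.Γ Z Y)) W) n := by
  rw [δ_act, ev_ev hg]
  congr 1; ext X n
  rw [ev_ev hg]
  simp only [ev_tm hg]

/-- `δ(Γ(b, m₋₁) m₀) = Γ(b, m₋₂) m₋₁ ⋄ m₀`. -/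
theorem δ_twL (b : B) (m : M) : cM.δ (G.twL cM b m) = ev (cM.δ m) fun X n =>
    H.dia cM.lact (G.twL H.reg b X) n := by
  have hT : H.Bl₃ cM.lact fun Z W n => H.dia cM.lact (H.algL.mul (H.s (G.Γ (H.s b) Z)) W) n :=
    { left := fun n => IsBal.mk_linear
        (((H.algL.mul ∘ₗ H.s ∘ₗ G.Γ (H.s b))).compr₂ ((H.dia cM.lact).flip n))
        (by intro Z c W; simp [G.lin_left])
      right := fun Z => Comodule.isBal_left cM.lact (H.sL (G.Γ (H.s b) Z)) (by simp) }
  have h := cM.coassoc_ev hT m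
  rw [twL_apply, ev_map]
  refine Eq.trans ?_ (h.trans ?_)
  · congr 1; ext X n
    rw [cM.δ_lact]
  · congr 1; ext X n
    rw [twL_apply, ev_map₂]
    rfl

end Act

section Tw

variable {cM : H.Comodule M} {cN : H.Comodule N} {cP : H.Comodule P}

/-- The twist `f^Γ(m, n) = Γ(m₋₁, n₋₁) f(m₀, n₀)` of a balanced bilinear map. -/
def tw (cM : H.Comodule M) (cN : H.Comodule N) (f : M →ₗ[k] N →ₗ[k] R)
    (hf : ∀ m b n, f (cM.ract m b) n = f m (cN.lact b n)) : M →ₗ[k] N →ₗ[k] R :=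
  (G.sharpAux cM cN).compr₂ (blift (fun m n => f m n) (IsBal.mk_linear f hf))

variable {f : M →ₗ[k] N →ₗ[k] R}

theorem isBal_tw (hf : ∀ m b n, f (cM.ract m b) n = f m (cN.lact b n)) (m : M) :
    H.Bl cN.lact fun Y n' => f (G.act cM Y m) n' :=
  IsBal.mk_linear (f ∘ₗ (G.act cM).flip m) (by intro Y b n; simp [act_t_mul, hf])

theorem tw_apply (hf : ∀ m b n, f (cM.ract m b) n = f m (cN.lact b n)) (m : M) (n : N) :
    G.tw cM cN f hf m n = ev (cN.δ n) fun Y n' => f (G.act cM Y m) n' := by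
  change blift (fun m n => f m n) (IsBal.mk_linear f hf) (G.sharpFst cM cN m (cN.δ n)) = _
  conv_lhs => rw [← ev_tm_self (cN.δ n), ev_map, ev_map]
  rfl

/-- Every twist factors through the twist of the universal balanced map. -/
theorem tw_eq_blift (hf : ∀ m b n, f (cM.ract m b) n = f m (cN.lact b n)) (m : M) (n : N) :
    G.tw cM cN f hf m n = blift (fun m n => f m n) (IsBal.mk_linear f hf)
      (G.tw cM cN (tm cM.ract cN.lact) (tm_bal _ _) m n) := by
  rw [tw_apply, tw_apply, ev_map]
  rfl

/-- `Γ^#` is the twist of the universal balanced map. -/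
theorem sharp_tm (m : M) (n : N) : G.sharp cM cN (tm _ _ m n) =
    G.tw cM cN (tm cM.ract cN.lact) (tm_bal _ _) m n := by
  rw [tw_apply]
  change G.sharpFst cM cN m (cN.δ n) = _
  conv_lhs => rw [← ev_tm_self (cN.δ n), ev_map]
  rfl

/-- `f^Γ` is balanced for the twisted actions. -/
theorem tw_bal (hf : ∀ m b n, f (cM.ract m b) n = f m (cN.lact b n)) (m : M) (b : B) (n : N) :
    G.tw cM cN f hf (G.twR cM m b) n = G.tw cM cN f hf m (G.twL cN b n) := by
  rw [tw_eq_blift, ← sharp_tm, tm_bal, sharp_tm, ← tw_eq_blift]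

/-- Naturality of the twist. -/
theorem tw_nat {cM' : H.Comodule M'} {cN' : H.Comodule N'} {f' : M' →ₗ[k] N' →ₗ[k] S}
    (hf : ∀ m b n, f (cM.ract m b) n = f m (cN.lact b n))
    (hf' : ∀ m b n, f' (cM'.ract m b) n = f' m (cN'.lact b n))
    {φ : M →ₗ[k] M'} {ψ : N →ₗ[k] N'} {χ : R →ₗ[k] S}
    (hφ : ∀ Y m, G.act cM' Y (φ m) = φ (G.act cM Y m)) (hψ : CoHom cN cN' ψ)
    (h : ∀ m n, χ (f m n) = f' (φ m) (ψ n)) (m : M) (n : N) :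
    χ (G.tw cM cN f hf m n) = G.tw cM' cN' f' hf' (φ m) (ψ n) := by
  rw [tw_apply, tw_apply, ev_map, hψ.ev (G.isBal_tw hf' (φ m))]
  simp only [h, hφ]

theorem act_nat {cM' : H.Comodule M'} {φ : M →ₗ[k] M'} (hφ : CoHom cM cM' φ) (Y : L) (m : M) :
    G.act cM' Y (φ m) = φ (G.act cM Y m) := by
  rw [act_apply, act_apply, ev_map, hφ.ev (G.isBal_act cM' Y)]
  simp only [hφ.left]

theorem twL_nat {cM' : H.Comodule M'} {φ : M →ₗ[k] M'} (hφ : CoHom cM cM' φ) (b : B) (m : M) :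
    G.twL cM' b (φ m) = φ (G.twL cM b m) := by
  have hb : H.Bl cM'.lact fun X n => cM'.lact (G.Γ (H.s b) X) n :=
    IsBal.mk_linear (cM'.lact ∘ₗ G.Γ (H.s b)) (by intro X c n; simp [G.lin_left])
  rw [twL_apply, twL_apply, ev_map, hφ.ev hb]
  simp only [hφ.left]

theorem twR_nat {cM' : H.Comodule M'} {φ : M →ₗ[k] M'} (hφ : CoHom cM cM' φ) (b : B) (m : M) :
    G.twR cM' (φ m) b = φ (G.twR cM m b) := G.act_nat hφ (H.s b) m

/-- Twisting does nothing when the first argument is coinvariant. -/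
theorem tw_coinv_left
    (hf : ∀ m b n, f (cM.ract m b) n = f m (cN.lact b n)) {z : M} (hz : Coinv cM z) (n : N) :
    G.tw cM cN f hf z n = f z n := by
  rw [tw_apply]
  have : ∀ Y, G.act cM Y z = cM.ract z (H.ε Y) := by
    intro Y
    rw [act_apply, hz.ev (G.isBal_act cM Y), G.one_left, hz.comm]
  simp only [this, hf]
  rw [← ev_map, cN.counit_ev]

/-- Twisting does nothing when the second argument is coinvariant. -/
theorem tw_coinv_right (hf : ∀ m b n, f (cM.ract m b) n = f m (cN.lact b n)) (m : M) {z : N}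
    (hz : Coinv cN z) : G.tw cM cN f hf m z = f m z := by
  rw [tw_apply, hz.ev (G.isBal_tw hf m), act_one]

/-- The product `X • Y = Γ(X₁, Y₁) X₂ Y₂`. -/
def bul : L →ₗ[k] L →ₗ[k] L := G.tw H.reg H.reg H.algL.mul H.coBilin_mul.bal

theorem bul_apply (X Y : L) : G.bul X Y = ev (H.Δ Y) fun Y₁ Y₂ => ev (H.Δ X) fun X₁ X₂ =>
    H.algL.mul (H.s (G.Γ X₁ Y₁)) (H.algL.mul X₂ Y₂) := by
  refine (G.tw_apply _ X Y).trans ?_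
  congr 1; ext Y₁ Y₂
  rw [act_apply, ev_map₂]
  simp

theorem bul_eq_twMul (X Y : L) (u w : L ⊗[k] L) (hu : H.toDiaL u = H.Δ X)
    (hw : H.toDiaL w = H.Δ Y) : G.bul X Y = H.twMul G.Γ u w := by
  refine (G.tw_apply _ X Y).trans ?_
  rw [reg_δ, ← hw]
  refine ev_toBal_eq (G.isBal_tw (cM := H.reg) (cN := H.reg) H.coBilin_mul.bal X) w
    (H.twMul G.Γ u) fun Y Z => ?_
  rw [act_apply, ev_map₂, reg_δ, ← hu]
  simp only [EnvRing.sL_apply, AlgebraOn.mul_assoc]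
  exact Eq.symm (ev_toBal_eq (G.isBal_twMul Y Z) u ((H.twMul G.Γ).flip (Y ⊗ₜ Z))
    fun X₁ X₂ => by simp)

/-- The cocycle condition. -/
theorem Γ_bul (X Y Z : L) : G.Γ X (G.bul Y Z) = G.Γ (G.bul X Y) Z := by
  obtain ⟨u, hu⟩ := Submodule.mkQ_surjective _ (H.Δ X)
  obtain ⟨w, hw⟩ := Submodule.mkQ_surjective _ (H.Δ Y)
  obtain ⟨z, hz⟩ := Submodule.mkQ_surjective _ (H.Δ Z)
  rw [G.bul_eq_twMul Y Z w z hw hz, G.bul_eq_twMul X Y u w hu hw, G.cocycle X Y Z u w z hu hw hz]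

/-- `X • Y` may be summed over two coactions. This makes sense of the coaction of a twisted map,
see `δ_tw`. -/
theorem isDiagonal_bul : IsDiagonal (H := H) G.bul where
  t_left b X Y := by
    rw [bul_apply, bul_apply, ev_map]
    congr 1; ext Y₁ Y₂
    rw [ev_map, H.ev_Δ_t_mul (G.isBal_twMul Y₁ Y₂)]
    simp
  t_mid b X Y := by
    rw [bul_apply, bul_apply]
    rw [H.ev_Δ_t_mul (f := fun Y₁ Y₂ => ev (H.Δ X) fun X₁ X₂ =>
      H.algL.mul (H.s (G.Γ X₁ Y₁)) (H.algL.mul X₂ Y₂))]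
    · congr 1; ext Y₁ Y₂
      rw [H.ev_Δ_mul_t (G.isBal_twMul Y₁ Y₂)]
      simp
    · refine H.reg.isBal_double (T := fun X₁ X₂ Y₁ Y₂ =>
        H.algL.mul (H.s (G.Γ X₁ Y₁)) (H.algL.mul X₂ Y₂)) ?_ ?_ ?_ ?_ X
      · exact G.isBal_twMul
      · intro X₁ X₂
        exact ⟨(H.algL.mul ∘ₗ H.s ∘ₗ G.Γ X₁).compl₂ (H.algL.mul X₂), fun _ _ => rfl⟩
      · intros; simp [G.balanced]
      · intros; simp

/-- Coaction of a twist: `δ(f^Γ(m, n)) = m₋₁ • n₋₁ ⋄ f(m₀, n₀)`. -/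
theorem δ_tw {f : M →ₗ[k] N →ₗ[k] P} (hf : CoBilin cM cN cP f) (m : M) (n : N) :
    cP.δ (G.tw cM cN f hf.bal m n) = ev (cN.δ n) fun Y n' => ev (cM.δ m) fun X m' =>
      H.dia cP.lact (G.bul X Y) (f m' n') := by
  have hin := fun Y n => isDiagonal_mul.isBal_inner (cM := cM) (l := cP.lact) hf.left Y n
  have hout := fun m => isDiagonal_mul.isBal_outer (cM := cM) (cN := cN) hf.left hf.bal m
  have hT : H.Bl₃ cN.lact fun Y y n' => ev (cM.δ (G.act cM Y m)) fun X m' =>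
      H.dia cP.lact (H.algL.mul X y) (f m' n') :=
    { left := fun n' =>
        { add_left := fun Y Y' y => by
            rw [map_add, LinearMap.add_apply, map_add, ev_add (hin y n')]
          smul_left := fun c Y y => by
            rw [map_smul, LinearMap.smul_apply, map_smul, ev_smul (hin y n')]
          add_right := fun _ _ _ => by simp [ev_add_fun]
          smul_right := fun _ _ _ => by simp [ev_smul_fun]
          bal := fun Y b y => by
            have := cM.ev_δ_ract (hin y n') b (G.act cM Y m)
            rw [← G.act_t_mul] at this
            simpa using this }
      right := fun Y => hout _ }
  rw [tw_apply, ev_map]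
  simp only [hf.colin]
  rw [cN.coassoc_ev hT]
  congr 1; ext Y n'
  calc _ = ev (H.Δ Y) fun y₁ y₂ => ev (cM.δ m) fun X m' => ev (H.Δ X) fun Z W =>
        H.dia cP.lact (H.algL.mul (H.algL.mul (H.s (G.Γ Z y₁)) W) y₂) (f m' n') := by
        congr 1; ext y₁ y₂
        rw [G.ev_δ_act cM (hin y₂ n')]
    _ = _ := by
        rw [ev_comm]
        congr 1; ext X m'
        rw [bul_apply, ev_map₂]
        congr 1; ext Y₁ Y₂
        rw [ev_map₂]
        simp

theorem ev_δ_tw {f : M →ₗ[k] N →ₗ[k] P} (hf : CoBilin cM cN cP f) {g : L → P → Q}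
    (hg : H.Bl cP.lact g) (m : M) (n : N) :
    ev (cP.δ (G.tw cM cN f hf.bal m n)) g = ev (cN.δ n) fun Y n' => ev (cM.δ m) fun X m' =>
      g (G.bul X Y) (f m' n') := by
  rw [G.δ_tw hf, ev_ev hg]
  congr 1; ext Y n'
  rw [ev_ev hg]
  simp only [ev_tm hg]

/-- Twisting preserves associativity: if `g(f(m, n), p) = i(m, h(n, p))`, the same holds for the
twists. The two sides are `Γ(m₋₁ • n₋₁, p₋₁) g(f(m₀, n₀), p₀)` and
`Γ(m₋₁, n₋₁ • p₋₁) i(m₀, h(n₀, p₀))`, so this is the cocycle condition.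
All associativity statements about the cotwist are instances. -/
theorem tw_assoc {cQ : H.Comodule M'} {cS : H.Comodule N'} {f : M →ₗ[k] N →ₗ[k] M'}
    {g : M' →ₗ[k] P →ₗ[k] R} {h : N →ₗ[k] P →ₗ[k] N'} {i : M →ₗ[k] N' →ₗ[k] R}
    (hf : CoBilin cM cN cQ f) (hh : CoBilin cN cP cS h)
    (hg : ∀ m b n, g (cQ.ract m b) n = g m (cP.lact b n))
    (hi : ∀ m b n, i (cM.ract m b) n = i m (cS.lact b n)) (l : B → R → R)
    (hgl : ∀ b m n, g (cQ.lact b m) n = l b (g m n))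
    (hil : ∀ b m n, i (cM.lact b m) n = l b (i m n))
    (H' : ∀ m n p, g (f m n) p = i m (h n p)) (m : M) (n : N) (p : P) :
    G.tw cQ cP g hg (G.tw cM cN f hf.bal m n) p =
      G.tw cM cS i hi m (G.tw cN cP h hh.bal n p) := by
  rw [G.tw_apply hg, G.tw_apply hi, G.ev_δ_tw hh (G.isBal_tw hi m)]
  congr 1; ext Z p'
  rw [act_apply, G.ev_δ_tw hf (G.isBal_act cQ Z), ev_map₂]
  congr 1; ext Y n'
  rw [ev_map₂, act_apply, ev_map₂]
  congr 1; ext X m'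
  rw [hgl, hil, H', Γ_bul]

end Tw

end TwoCocycle
end LeftBialgebroid
end Cocycle

/-! ### The algebra `B^Γ` and the twisted actions -/

section Cocycle

variable {k : Type v} [Field k] {B L : Type u} [AddCommGroup B] [Module k B]
  [AddCommGroup L] [Module k L] {M N P A : Type u} [AddCommGroup M] [Module k M]
  [AddCommGroup N] [Module k N] [AddCommGroup P] [Module k P] [AddCommGroup A] [Module k A]
  {Q : Type*} [AddCommGroup Q] [Module k Q]

namespace LeftBialgebroid

variable {H : LeftBialgebroid k B L}

namespace TwoCocycle

variable (G : H.TwoCocycle)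

section Modules

variable (cM : H.Comodule M) (cN : H.Comodule N) (cP : H.Comodule P)

theorem act_base (Y : L) (b : B) : G.act H.base Y b = G.Γ (H.s b) Y := by
  rw [act_apply, ev_base_δ (G.isBal_act H.base Y)]
  simp

/-- The twisted left action is the twist of the left action, seen as a map `B ⊗_B M → M`. -/
theorem tw_lact (b : B) (m : M) :
    G.tw H.base cM cM.lact cM.coBilin_lact.bal b m = G.twL cM b m := by
  rw [tw_apply, twL_apply]
  simp only [act_base]

/-- The twisted right action is the twist of the right action, seen as a map `M ⊗_B B → M`. -/
theorem tw_ract (m : M) (b : B) :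
    G.tw cM H.base cM.ract cM.coBilin_ract.bal m b = G.twR cM m b := by
  rw [tw_apply, ev_base_δ (G.isBal_tw cM.coBilin_ract.bal m), act_s]
  simp

theorem tw_mul_base (a b : B) :
    G.tw H.base H.base H.algB.mul H.base.coBilin_ract.bal a b = G.Γ (H.s a) (H.s b) := by
  rw [tw_ract, ← act_s, act_base]

/-- The algebra `B^Γ`. -/
def algB : AlgebraOn k B where
  mul := G.Γ.compl₁₂ H.s H.s
  one := H.algB.one
  mul_assoc a b c := by
    simp only [LinearMap.compl₁₂_apply, ← tw_mul_base]
    exact G.tw_assoc H.base.coBilin_ract H.base.coBilin_ract H.base.coBilin_ract.bal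
      H.base.coBilin_ract.bal (fun b m => H.algB.mul b m) (by simp) (by simp) (by simp) a b c
  one_mul a := by simp [G.one_left]
  mul_one a := by simp [G.one_right]

@[simp] theorem algB_mul (a b : B) : G.algB.mul a b = G.Γ (H.s a) (H.s b) := rfl
@[simp] theorem algB_one : G.algB.one = H.algB.one := rfl

@[simp] theorem twL_one (m : M) : G.twL cM H.algB.one m = m := by
  rw [twL_apply]
  simp only [EnvRing.s_one, G.one_left]
  exact cM.counit_ev m

@[simp] theorem twR_one (m : M) : G.twR cM m H.algB.one = m := by
  rw [← act_s, H.s_one, act_one]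

theorem twL_mul (a b : B) (m : M) :
    G.twL cM (G.Γ (H.s a) (H.s b)) m = G.twL cM a (G.twL cM b m) := by
  simp only [← tw_mul_base, ← tw_lact]
  exact G.tw_assoc H.base.coBilin_ract cM.coBilin_lact cM.coBilin_lact.bal
      cM.coBilin_lact.bal (fun b m => cM.lact b m) (by simp) (by simp) (by simp) a b m

theorem twR_mul (a b : B) (m : M) :
    G.twR cM m (G.Γ (H.s a) (H.s b)) = G.twR cM (G.twR cM m a) b := by
  simp only [← tw_mul_base, ← tw_ract]
  exact Eq.symm (G.tw_assoc cM.coBilin_ract H.base.coBilin_ract cM.coBilin_ract.bal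
      cM.coBilin_ract.bal (fun b m => cM.lact b m) (by simp) (by simp) (by simp) m a b)

theorem twR_twL (a b : B) (m : M) :
    G.twR cM (G.twL cM a m) b = G.twL cM a (G.twR cM m b) := by
  simp only [← tw_lact, ← tw_ract]
  exact G.tw_assoc cM.coBilin_lact cM.coBilin_ract cM.coBilin_ract.bal
      cM.coBilin_lact.bal (fun b m => cM.lact b m) (by simp) (by simp) (by simp) a m b

theorem twL_module : IsLeftModule G.algB (G.twL cM) := ⟨by simp, by simp [twL_mul]⟩

theorem twR_module : IsRightModule G.algB (G.twR cM) := ⟨by simp, by simp [twR_mul]⟩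

variable {cM cN cP}

/-- The twist of a morphism `M ⊗_B N → P` is linear for the twisted left actions. -/
theorem tw_left {f : M →ₗ[k] N →ₗ[k] P} (hf : CoBilin cM cN cP f) (a : B) (m : M) (n : N) :
    G.tw cM cN f hf.bal (G.twL cM a m) n = G.twL cP a (G.tw cM cN f hf.bal m n) := by
  simp only [← tw_lact]
  exact G.tw_assoc cM.coBilin_lact hf hf.bal
      cP.coBilin_lact.bal (fun b m => cP.lact b m) hf.left (by simp) hf.left a m n

theorem tw_right {f : M →ₗ[k] N →ₗ[k] P} (hf : CoBilin cM cN cP f) (a : B) (m : M) (n : N) :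
    G.tw cM cN f hf.bal m (G.twR cN n a) = G.twR cP (G.tw cM cN f hf.bal m n) a := by
  simp only [← tw_ract]
  exact Eq.symm (G.tw_assoc hf cN.coBilin_ract cP.coBilin_ract.bal
      hf.bal (fun b m => cP.lact b m) (by simp) hf.left (fun m n b => (hf.right m n b).symm) m n a)

theorem Coinv.twL {z : P} (hz : Coinv cP z) (b : B) : G.twL cP b z = cP.lact b z := by
  rw [← tw_lact, G.tw_coinv_right _ b hz]

theorem Coinv.twR {z : P} (hz : Coinv cP z) (b : B) : G.twR cP z b = cP.ract z b := by
  rw [← tw_ract, G.tw_coinv_left _ hz]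

end Modules

end TwoCocycle

/-! ### Commuting comodule structures -/

/-- Two commuting comodule structures on the same space: the four actions commute, each coaction is
linear for the actions of the other structure, and the two coactions commute. The last condition is
stated through functions `T(x₋₁, x₋₁', x₀)`, since the tensor product with both sets of relations is
not needed otherwise. -/
structure Commutes (c₁ c₂ : H.Comodule A) : Prop where
  ll : ∀ a b x, c₁.lact a (c₂.lact b x) = c₂.lact b (c₁.lact a x)
  lr : ∀ a b x, c₁.lact a (c₂.ract x b) = c₂.ract (c₁.lact a x) b
  rl : ∀ a b x, c₁.ract (c₂.lact b x) a = c₂.lact b (c₁.ract x a)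
  rr : ∀ a b x, c₁.ract (c₂.ract x b) a = c₂.ract (c₁.ract x a) b
  δ₁l : ∀ b x, c₁.δ (c₂.lact b x) = ev (c₁.δ x) fun X y => H.dia c₁.lact X (c₂.lact b y)
  δ₁r : ∀ b x, c₁.δ (c₂.ract x b) = ev (c₁.δ x) fun X y => H.dia c₁.lact X (c₂.ract y b)
  δ₂l : ∀ b x, c₂.δ (c₁.lact b x) = ev (c₂.δ x) fun X y => H.dia c₂.lact X (c₁.lact b y)
  δ₂r : ∀ b x, c₂.δ (c₁.ract x b) = ev (c₂.δ x) fun X y => H.dia c₂.lact X (c₁.ract y b)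
  comm : ∀ (Q : Type u) [AddCommGroup Q] [Module k Q] (T : L → L → A → Q),
    (∀ Z, H.Bl c₁.lact fun Y a => T Y Z a) → (∀ Y, H.Bl c₂.lact fun Z a => T Y Z a) → ∀ x,
      (ev (c₁.δ x) fun Y y => ev (c₂.δ y) fun Z a => T Y Z a) =
        ev (c₂.δ x) fun Z y => ev (c₁.δ y) fun Y a => T Y Z a

namespace Commutes

variable {c₁ c₂ : H.Comodule A} (h : Commutes c₁ c₂)

include h

theorem symm : Commutes c₂ c₁ where
  ll a b x := (h.ll b a x).symm
  lr a b x := (h.rl b a x).symm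
  rl a b x := (h.lr b a x).symm
  rr a b x := (h.rr b a x).symm
  δ₁l := h.δ₂l
  δ₁r := h.δ₂r
  δ₂l := h.δ₁l
  δ₂r := h.δ₁r
  comm Q _ _ T h1 h2 x := (h.comm Q (fun Y Z a => T Z Y a) h2 h1 x).symm

theorem coHom_lact (b : B) : CoHom c₁ c₁ (c₂.lact b) := ⟨fun a m => (h.ll a b m).symm, h.δ₁l b⟩

theorem coHom_ract (b : B) : CoHom c₁ c₁ (c₂.ract.flip b) :=
  ⟨fun a m => (h.lr a b m).symm, h.δ₁r b⟩

/-- A convolution operator `x ↦ F(x₋₁) x₀` for the second structure is a comodule endomorphism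
for the first one. -/
theorem coHom_conv (F : L →ₗ[k] B)
    (hF : ∀ X b, F (H.algL.mul (H.t b) X) = H.algB.mul (F X) b) (φ : A →ₗ[k] A)
    (hφ : ∀ x, φ x = ev (c₂.δ x) fun Z a => c₂.lact (F Z) a) : CoHom c₁ c₁ φ where
  left b x := by
    have hb : H.Bl c₂.lact fun Z a => c₂.lact (F Z) a :=
      IsBal.mk_linear (c₂.lact ∘ₗ F) (by intro X b n; simp [hF])
    rw [hφ, hφ, (h.symm.coHom_lact b).ev hb, ev_map]
    simp only [h.ll]
  colin x := by
    have hT₁ : ∀ Z, H.Bl c₁.lact fun X a => H.dia c₁.lact X (c₂.lact (F Z) a) := fun Z =>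
      IsBal.mk_linear ((H.dia c₁.lact).compl₂ (c₂.lact (F Z)))
        (by intro X b n; simp [H.dia_bal, h.ll])
    have hT₂ : ∀ X, H.Bl c₂.lact fun Z a => H.dia c₁.lact X (c₂.lact (F Z) a) := fun X =>
      IsBal.mk_linear ((c₂.lact ∘ₗ F).compr₂ (H.dia c₁.lact X))
        (by intro Z b n; simp [hF])
    have hc := h.comm _ _ hT₁ hT₂ x
    rw [hφ, ev_map]
    simp only [h.δ₁l]
    rw [← hc]
    congr 1; ext X y
    rw [hφ, ev_map]

theorem ract_conv (F : L →ₗ[k] B)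
    (hF : ∀ X b, F (H.algL.mul (H.t b) X) = H.algB.mul (F X) b) (φ : A →ₗ[k] A)
    (hφ : ∀ x, φ x = ev (c₂.δ x) fun Z a => c₂.lact (F Z) a) (x : A) (b : B) :
    φ (c₁.ract x b) = c₁.ract (φ x) b := by
  have hb : H.Bl c₂.lact fun Z a => c₂.lact (F Z) a :=
    IsBal.mk_linear (c₂.lact ∘ₗ F) (by intro X b n; simp [hF])
  have := (h.symm.coHom_ract b).ev hb x
  simp only [LinearMap.flip_apply] at this
  rw [hφ, hφ, this, ev_map₂]
  simp only [h.rl]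

variable (G : H.TwoCocycle)

theorem coHom_act (Y : L) : CoHom c₁ c₁ (G.act c₂ Y) :=
  h.coHom_conv (G.Γ.flip Y) (by simp [G.linear]) _ fun x => G.act_apply c₂ Y x

theorem ract_act (Y : L) (x : A) (b : B) :
    G.act c₂ Y (c₁.ract x b) = c₁.ract (G.act c₂ Y x) b :=
  h.ract_conv (G.Γ.flip Y) (by simp [G.linear]) _ (fun x => G.act_apply c₂ Y x) x b

theorem coHom_twL (b : B) : CoHom c₁ c₁ (G.twL c₂ b) :=
  h.coHom_conv (G.Γ (H.s b)) (G.lin_left b) _ fun x => G.twL_apply c₂ b x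

theorem coHom_twR (b : B) : CoHom c₁ c₁ ((G.twR c₂).flip b) := h.coHom_act G (H.s b)

variable {f : A →ₗ[k] A →ₗ[k] A}

/-- Twisting an operation along the first structure keeps it a morphism for the second one. -/
theorem coBilin_tw (h₁ : CoBilin c₁ c₁ c₁ f) (h₂ : CoBilin c₂ c₂ c₂ f.flip) :
    CoBilin c₂ c₂ c₂ (G.tw c₁ c₁ f h₁.bal).flip where
  bal a b a' := by
    have e1 := (h.coHom_ract b).ev (G.isBal_tw h₁.bal a') a
    have e2 := fun Y => (h.symm.coHom_act G Y).left b a'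
    simp only [LinearMap.flip_apply] at e1 ⊢
    rw [G.tw_apply, G.tw_apply, e1]
    congr 1; ext Y â
    rw [e2]
    exact h₂.bal _ _ _
  left b a a' := by
    have e1 := (h.coHom_lact b).ev (G.isBal_tw h₁.bal a') a
    simp only [LinearMap.flip_apply]
    rw [G.tw_apply, G.tw_apply, e1, ev_map]
    congr 1; ext Y â
    exact h₂.left _ _ _
  right a a' b := by
    simp only [LinearMap.flip_apply]
    rw [G.tw_apply, G.tw_apply, ev_map₂]
    congr 1; ext Y â
    rw [h.symm.ract_act]
    exact h₂.right _ _ _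
  colin a a' := by
    have hin := fun Y n => isDiagonal_mul.isBal_inner (cM := c₂) (l := c₂.lact) h₂.left Y n
    have hout := fun m => isDiagonal_mul.isBal_outer (cM := c₂) (cN := c₂) h₂.left h₂.bal m
    simp only [LinearMap.flip_apply] at hin hout ⊢
    have e1 : ∀ a a', c₂.δ (f a' a) = _ := fun a a' => h₂.colin a a'
    simp only [LinearMap.flip_apply] at e1
    rw [G.tw_apply, ev_map]
    calc _ = ev (c₁.δ a) fun Y â => ev (c₂.δ a') fun y ã => ev (c₂.δ â) fun Z a₀ =>
          H.dia c₂.lact (H.algL.mul Z y) (f (G.act c₁ Y ã) a₀) := by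
          congr 1; ext Y â
          rw [e1]
          exact (h.symm.coHom_act G Y).ev (hout â) a'
      _ = ev (c₂.δ a') fun y ã => ev (c₁.δ a) fun Y â => ev (c₂.δ â) fun Z a₀ =>
          H.dia c₂.lact (H.algL.mul Z y) (f (G.act c₁ Y ã) a₀) := by rw [ev_comm]
      _ = _ := by
          congr 1; ext y ã
          rw [h.comm]
          · congr 1; ext Z â
            rw [G.tw_apply, ev_map]
          · intro Z
            exact IsBal.mk_linear
              ((f ∘ₗ (G.act c₁).flip ã).compr₂ (H.dia c₂.lact (H.algL.mul Z y)))
              (by intro Y b n; simp [G.act_t_mul, h₁.bal])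
          · intro Y
            exact hin y (G.act c₁ Y ã)

/-- Twists along commuting structures commute. -/
theorem tw_tw (h₁ : CoBilin c₁ c₁ c₁ f) (h₂ : CoBilin c₂ c₂ c₂ f.flip)
    (h₃ : ∀ m b n, (G.tw c₁ c₁ f h₁.bal).flip (c₂.ract m b) n =
      (G.tw c₁ c₁ f h₁.bal).flip m (c₂.lact b n))
    (h₄ : ∀ m b n, (G.tw c₂ c₂ f.flip h₂.bal).flip (c₁.ract m b) n =
      (G.tw c₂ c₂ f.flip h₂.bal).flip m (c₁.lact b n)) (a a' : A) :
    G.tw c₂ c₂ (G.tw c₁ c₁ f h₁.bal).flip h₃ a a' =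
      G.tw c₁ c₁ (G.tw c₂ c₂ f.flip h₂.bal).flip h₄ a' a := by
  rw [G.tw_apply, G.tw_apply]
  simp only [LinearMap.flip_apply]
  calc _ = ev (c₂.δ a') fun y ã => ev (c₁.δ a) fun Y â => f (G.act c₁ Y ã) (G.act c₂ y â) := by
        congr 1; ext y ã
        rw [G.tw_apply, (h.coHom_act G y).ev (G.isBal_tw h₁.bal ã)]
    _ = _ := by
        rw [ev_comm]
        congr 1; ext Y â
        rw [G.tw_apply, (h.symm.coHom_act G Y).ev (G.isBal_tw h₂.bal â)]
        rfl

end Commutes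

end LeftBialgebroid
end Cocycle

/-! ### Coactions on the first factor of a balanced tensor product -/

section Leg

variable {k : Type v} [Field k] {B L : Type u} [AddCommGroup B] [Module k B]
  [AddCommGroup L] [Module k L] {M N P A : Type u} [AddCommGroup M] [Module k M]
  [AddCommGroup N] [Module k N] [AddCommGroup P] [Module k P] [AddCommGroup A] [Module k A]
  {Q : Type*} [AddCommGroup Q] [Module k Q]

namespace LeftBialgebroid

variable {H : LeftBialgebroid k B L}

namespace Comodule

variable (cP : H.Comodule P) (r : P →ₗ[k] B →ₗ[k] P) (l : B →ₗ[k] N →ₗ[k] N)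
  (hr : ∀ b, CoHom cP cP (r.flip b))
  (hr' : ∀ p a b, r (cP.ract p a) b = cP.ract (r p b) a)

/-- `a (p ⊗ n) = a p ⊗ n`. -/
def legLact : B →ₗ[k] Bal r l →ₗ[k] Bal r l :=
  bliftL ((LinearMap.llcomp k P P (N →ₗ[k] Bal r l) (tm r l)) ∘ₗ cP.lact)
    (by
      intro a m b n
      have := (hr b).left a m
      simp only [LinearMap.flip_apply] at this
      simp [← tm_bal, this])

/-- `(p ⊗ n) a = p a ⊗ n`. -/
def legRact : Bal r l →ₗ[k] B →ₗ[k] Bal r l :=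
  (bliftL ((LinearMap.llcomp k P P (N →ₗ[k] Bal r l) (tm r l)) ∘ₗ cP.ract.flip)
    (by
      intro a m b n
      simp [← tm_bal, hr'])).flip

@[simp] theorem legLact_tm (a : B) (p : P) (n : N) :
    cP.legLact r l hr a (tm r l p n) = tm r l (cP.lact a p) n := rfl

@[simp] theorem legRact_tm (a : B) (p : P) (n : N) :
    cP.legRact r l hr' (tm r l p n) a = tm r l (cP.ract p a) n := rfl

theorem isBal_leg (n : N) : H.Bl cP.lact fun X p' =>
    H.dia (cP.legLact r l hr) X (tm r l p' n) :=
  IsBal.mk_linear ((H.dia (cP.legLact r l hr)).compl₂ ((tm r l).flip n)) (by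
    intro X b p'
    exact H.dia_bal (cP.legLact r l hr) b X (tm r l p' n))

/-- `δ(p ⊗ n) = p₋₁ ⋄ p₀ ⊗ n`. -/
noncomputable def legδ : Bal r l →ₗ[k] H.Dia (cP.legLact r l hr) :=
  blift (fun p n => ev (cP.δ p) fun X p' => H.dia (cP.legLact r l hr) X (tm r l p' n))
  { add_left := fun p p' n => by rw [map_add, ev_add (cP.isBal_leg r l hr n)]
    smul_left := fun c p n => by rw [map_smul, ev_smul (cP.isBal_leg r l hr n)]
    add_right := fun _ _ _ => by simp [ev_add_fun]
    smul_right := fun _ _ _ => by simp [ev_smul_fun]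
    bal := fun p b n => by
      refine ((hr b).ev (cP.isBal_leg r l hr n) p).trans ?_
      simp [tm_bal] }

theorem legδ_tm (p : P) (n : N) : cP.legδ r l hr (tm r l p n) =
    ev (cP.δ p) fun X p' => H.dia (cP.legLact r l hr) X (tm r l p' n) := rfl

theorem ev_legδ {g : L → Bal r l → Q} (hg : H.Bl (cP.legLact r l hr) g) (p : P) (n : N) :
    ev (cP.legδ r l hr (tm r l p n)) g = ev (cP.δ p) fun X p' => g X (tm r l p' n) := by
  rw [legδ_tm, ev_ev hg]
  simp only [ev_tm hg]

theorem isBal_of_leg {g : L → Bal r l → Q} (hg : H.Bl (cP.legLact r l hr) g) (n : N) :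
    H.Bl cP.lact fun X p' => g X (tm r l p' n) where
  add_left _ _ _ := by simp [hg.add_left]
  smul_left _ _ _ := by simp [hg.smul_left]
  add_right _ _ _ := by simp [hg.add_right]
  smul_right _ _ _ := by simp [hg.smul_right]
  bal X b p := hg.bal X b (tm r l p n)

theorem legδ_ext {g g' : L → Bal r l → Q} (hg : H.Bl (cP.legLact r l hr) g)
    (hg' : H.Bl (cP.legLact r l hr) g')
    (h : ∀ p n, (ev (cP.δ p) fun X p' => g X (tm r l p' n)) =
      ev (cP.δ p) fun X p' => g' X (tm r l p' n)) (z : Bal r l) :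
    ev (cP.legδ r l hr z) g = ev (cP.legδ r l hr z) g' := by
  rw [ev_eq_blift _ _ hg, ev_eq_blift _ _ hg']
  revert z
  refine LinearMap.ext_iff.1 (Bal.hom_ext (f := blift _ hg ∘ₗ cP.legδ r l hr)
    (g := blift _ hg' ∘ₗ cP.legδ r l hr) fun p n => ?_)
  simp only [LinearMap.comp_apply, ← ev_eq_blift _ _ hg, ← ev_eq_blift _ _ hg']
  rw [ev_legδ _ _ _ _ hg, ev_legδ _ _ _ _ hg', h]

theorem legδ_lact (a : B) (z : Bal r l) : cP.legδ r l hr (cP.legLact r l hr a z) =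
    ev (cP.legδ r l hr z) fun X n => H.dia (cP.legLact r l hr) (H.algL.mul (H.s a) X) n := by
  have hg : H.Bl (cP.legLact r l hr) fun X n =>
      H.dia (cP.legLact r l hr) (H.algL.mul (H.s a) X) n :=
    isBal_left (cP.legLact r l hr) (H.sL a) (by simp)
  rw [ev_eq_blift _ _ hg]
  revert z
  refine LinearMap.ext_iff.1 (Bal.hom_ext (f := cP.legδ r l hr ∘ₗ cP.legLact r l hr a)
    (g := blift _ hg ∘ₗ cP.legδ r l hr) fun m n => ?_)
  simp only [LinearMap.comp_apply, ← ev_eq_blift _ _ hg]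
  rw [ev_legδ _ _ _ _ hg, legLact_tm, legδ_tm]
  exact cP.ev_δ_lact (cP.isBal_leg r l hr n) a m

theorem legδ_ract (a : B) (z : Bal r l) : cP.legδ r l hr (cP.legRact r l hr' z a) =
    ev (cP.legδ r l hr z) fun X n => H.dia (cP.legLact r l hr) (H.algL.mul X (H.s a)) n := by
  have hg : H.Bl (cP.legLact r l hr) fun X n =>
      H.dia (cP.legLact r l hr) (H.algL.mul X (H.s a)) n :=
    isBal_left (cP.legLact r l hr) (H.sR.flip a) (by simp)
  rw [ev_eq_blift _ _ hg]
  revert z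
  refine LinearMap.ext_iff.1 (Bal.hom_ext
    (f := cP.legδ r l hr ∘ₗ (cP.legRact r l hr').flip a)
    (g := blift _ hg ∘ₗ cP.legδ r l hr) fun m n => ?_)
  simp only [LinearMap.comp_apply, ← ev_eq_blift _ _ hg, LinearMap.flip_apply]
  rw [ev_legδ _ _ _ _ hg, legRact_tm, legδ_tm]
  exact cP.ev_δ_ract (cP.isBal_leg r l hr n) a m

theorem legRact_lact (a b : B) (z : Bal r l) :
    cP.legRact r l hr' (cP.legLact r l hr a z) b =
      cP.legLact r l hr a (cP.legRact r l hr' z b) := by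
  revert z
  exact LinearMap.ext_iff.1 (Bal.hom_ext (f := (cP.legRact r l hr').flip b ∘ₗ cP.legLact r l hr a)
    (g := cP.legLact r l hr a ∘ₗ (cP.legRact r l hr').flip b) fun m n => by simp)

theorem legδ_coassoc (z : Bal r l) :
    (ev (cP.legδ r l hr z) fun X n => ev (cP.legδ r l hr n) fun Y p =>
        trip H.tL.flip H.sL H.tL.flip (cP.legLact r l hr) X Y p) =
      ev (cP.legδ r l hr z) fun X n => ev (H.Δ X) fun Y Z =>
        trip H.tL.flip H.sL H.tL.flip (cP.legLact r l hr) Y Z n := by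
  have ht := trip_isBal₃ (r₁ := H.tL.flip) (l₁ := H.sL) (r₂ := H.tL.flip)
    (l₂ := cP.legLact r l hr)
  refine cP.legδ_ext r l hr (isBal_ev_of (H := H) (cP.legδ_lact r l hr) ht)
    (isBal_ev_Δ (H := H) ht) (fun p n => ?_) z
  simp_rw [ev_legδ _ _ _ _ (ht.right _)]
  exact cP.coassoc_ev (T := fun X Y p => trip H.tL.flip H.sL H.tL.flip (cP.legLact r l hr) X Y
    (tm r l p n)) ⟨fun p => ht.left _, fun X => cP.isBal_of_leg r l hr (ht.right X) n⟩ p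

/-- The balanced tensor product `P ⊗ N` along a right action on `P` by comodule endomorphisms,
with the coaction of `P`. -/
noncomputable abbrev leg : H.Comodule (Bal r l) :=
  Comodule.ofSweedler (cP.legLact r l hr) (cP.legRact r l hr')
    ⟨LinearMap.ext_iff.1 (Bal.hom_ext (f := cP.legLact r l hr H.algB.one) (g := LinearMap.id)
        (by simp)),
      fun a b => LinearMap.ext_iff.1 (Bal.hom_ext (f := cP.legLact r l hr (H.algB.mul a b))
        (g := cP.legLact r l hr a ∘ₗ cP.legLact r l hr b) (by simp))⟩
    ⟨LinearMap.ext_iff.1 (Bal.hom_ext (f := (cP.legRact r l hr').flip H.algB.one)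
        (g := LinearMap.id) (by simp)),
      fun a b => LinearMap.ext_iff.1 (Bal.hom_ext (f := (cP.legRact r l hr').flip (H.algB.mul a b))
        (g := (cP.legRact r l hr').flip b ∘ₗ (cP.legRact r l hr').flip a) (by simp))⟩
    (cP.legRact_lact r l hr hr') (cP.legδ r l hr) (cP.legδ_lact r l hr)
    (cP.legδ_ract r l hr hr')
    (fun a => cP.legδ_ext r l hr
      (isBal_left (cP.legLact r l hr) (H.tR.flip a) (by simp))
      (IsBal.mk_linear ((H.dia (cP.legLact r l hr)).compl₂ ((cP.legRact r l hr').flip a))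
        (by intro X b n; simp [H.dia_bal, legRact_lact])) fun p n => by
        simpa using cP.δ_tak_ev (cP.isBal_leg r l hr n) a p)
    (cP.legδ_coassoc r l hr)
    (fun z => by
      have hg : H.Bl (cP.legLact r l hr) fun X n => cP.legLact r l hr (H.ε X) n :=
        IsBal.mk_linear (cP.legLact r l hr ∘ₗ H.ε) (by
          intro X b n
          revert n
          refine LinearMap.ext_iff.1 (Bal.hom_ext
            (f := cP.legLact r l hr (H.ε (H.algL.mul (H.t b) X)))
            (g := cP.legLact r l hr (H.ε X) ∘ₗ cP.legLact r l hr b) fun m n => ?_)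
          simp [H.ε_t_mul])
      rw [ev_eq_blift _ _ hg]
      revert z
      refine LinearMap.ext_iff.1 (Bal.hom_ext (f := blift _ hg ∘ₗ cP.legδ r l hr)
        (g := LinearMap.id) fun m n => ?_)
      simp only [LinearMap.comp_apply, ← ev_eq_blift _ _ hg, LinearMap.id_apply]
      rw [ev_legδ _ _ _ _ hg]
      conv_rhs => rw [← cP.counit_ev m, ev_map₂]
      simp)

theorem coHom_leg (n : N) : CoHom cP (cP.leg r l hr hr') ((tm r l).flip n) :=
  ⟨fun _ _ => rfl, fun _ => rfl⟩

end Comodule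
end LeftBialgebroid
end Leg

/-! ### The translation map `X ↦ X₊ ⊗ X₋` -/

section Hopf

variable {k : Type v} [Field k] {B L : Type u} [AddCommGroup B] [Module k B]
  [AddCommGroup L] [Module k L] {M N P A : Type u} [AddCommGroup M] [Module k M]
  [AddCommGroup N] [Module k N] [AddCommGroup P] [Module k P] [AddCommGroup A] [Module k A]
  {Q : Type*} [AddCommGroup Q] [Module k Q]

theorem LeftBialgebroid.hopfMap_tm (H : LeftBialgebroid k B L) (X Y : L) :
    H.hopfMap (tm H.tR H.tL X Y) = ev (H.Δ X) fun X₁ X₂ => H.dia H.sL X₁ (H.algL.mul X₂ Y) :=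
  (ev_hom (H.Δ X) (H.diaMulRight.flip Y)).symm

namespace LeftHopfAlgebroid

open LeftBialgebroid

variable (H : LeftHopfAlgebroid k B L)

/-- Balanced functions on `L ⊗_{B̄} L`. -/
abbrev Bo (f : L → L → Q) : Prop := IsBal H.tR H.tL f

theorem hopfMap_plusMinus (X : L) :
    H.hopfMap (H.plusMinus X) = H.dia H.sL X H.algL.one :=
  (LinearEquiv.ofBijective H.hopfMap H.hopf_bijective).apply_symm_apply _

theorem plusMinus_eq {X : L} {z : H.OpTensor} (h : H.hopfMap z = H.dia H.sL X H.algL.one) :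
    H.plusMinus X = z :=
  H.hopf_bijective.1 ((H.hopfMap_plusMinus X).trans h.symm)

theorem isBal_hopf {g : L → L → Q} (hg : H.Bl H.sL g) (m : L) :
    H.Bl H.sL fun Y Z => g Y (H.algL.mul Z m) where
  add_left _ _ _ := hg.add_left _ _ _
  smul_left _ _ _ := hg.smul_left _ _ _
  add_right _ _ _ := by simp [hg.add_right]
  smul_right _ _ _ := by simp [hg.smul_right]
  bal X b n := by simpa using hg.bal X b (H.algL.mul n m)

theorem hopfMap_ev {g : L → L → Q} (hg : H.Bl H.sL g) (z : H.OpTensor) :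
    ev (H.hopfMap z) g = ev z fun p m => ev (H.Δ p) fun Y Z => g Y (H.algL.mul Z m) := by
  conv_lhs => rw [← ev_tm_self z, ev_map, ev_ev hg]
  congr 1; ext p m
  rw [hopfMap_tm, ev_ev hg]
  simp only [ev_tm hg]

/-- `X₊₁ ⋄ X₊₂ X₋ = X ⋄ 1`. -/
theorem ev_plusMinus_Δ {g : L → L → Q} (hg : H.Bl H.sL g) (X : L) :
    (ev (H.plusMinus X) fun p m => ev (H.Δ p) fun Y Z => g Y (H.algL.mul Z m)) =
      g X H.algL.one := by
  rw [← H.hopfMap_ev hg, hopfMap_plusMinus, ev_tm hg]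

/-- The Hopf-Galois map on a sum. With `ev_plusMinus_Δ`, identities for `X₊ ⊗ X₋` are proved by
applying the Hopf-Galois map, which is injective. -/
theorem hopfMap_sum {r : M →ₗ[k] A →ₗ[k] M} {l : A →ₗ[k] N →ₗ[k] N} (z : Bal r l)
    (f g : M → N → L) :
    H.hopfMap (ev z fun p m => tm H.tR H.tL (f p m) (g p m)) =
      ev z fun p m => ev (H.Δ (f p m)) fun Y Z => H.dia H.sL Y (H.algL.mul Z (g p m)) := by
  rw [ev_map]
  simp only [hopfMap_tm]

theorem isBal_dia {φ ψ : L →ₗ[k] L} {l : B →ₗ[k] L →ₗ[k] L}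
    (h : ∀ X b Y, H.dia l (φ (H.algL.mul (H.t b) X)) (ψ Y) =
      H.dia l (φ X) (ψ (H.algL.mul (H.s b) Y))) :
    H.Bl H.sL fun Y Z => H.dia l (φ Y) (ψ Z) :=
  IsBal.mk_linear ((H.dia l).compl₁₂ φ ψ) h

theorem isBal_dia_sL : H.Bl H.sL fun Y Z => H.dia H.sL Y Z :=
  IsBal.mk_linear (r := H.tL.flip) (l := H.sL) (H.dia H.sL) (tm_bal _ _)

section PlusMinus

variable {H} {f : L → L → Q} (hf : H.Bo f)
include hf

theorem ev_of_eq {X : L} {z : H.OpTensor} (h : H.plusMinus X = z) :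
    ev (H.plusMinus X) f = blift f hf z := by rw [h, ev_eq_blift _ _ hf]

theorem ev_plusMinus_s_mul (b : B) (X : L) : ev (H.plusMinus (H.algL.mul (H.s b) X)) f =
    ev (H.plusMinus X) fun p m => f (H.algL.mul (H.s b) p) m := by
  refine (ev_of_eq hf (H.plusMinus_eq (z := ev (H.plusMinus X) fun p m =>
    tm H.tR H.tL (H.algL.mul (H.s b) p) m) ?_)).trans (by simp [ev_map])
  rw [hopfMap_sum]
  simp only [H.ev_Δ_s_mul (H.isBal_hopf H.isBal_dia_sL _)]
  exact H.ev_plusMinus_Δ (g := fun Y Z => H.dia H.sL (H.algL.mul (H.s b) Y) Z)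
    (H.isBal_dia (φ := H.sL b) (ψ := LinearMap.id) (by
      intro Y c Z
      simpa using H.dia_bal H.sL c (H.algL.mul (H.s b) Y) Z)) X

theorem ev_plusMinus_mul_s (b : B) (X : L) : ev (H.plusMinus (H.algL.mul X (H.s b))) f =
    ev (H.plusMinus X) fun p m => f (H.algL.mul p (H.s b)) m := by
  refine (ev_of_eq hf (H.plusMinus_eq (z := ev (H.plusMinus X) fun p m =>
    tm H.tR H.tL (H.algL.mul p (H.s b)) m) ?_)).trans (by simp [ev_map])
  rw [hopfMap_sum]
  simp only [H.ev_Δ_mul_s (H.isBal_hopf H.isBal_dia_sL _)]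
  exact H.ev_plusMinus_Δ (g := fun Y Z => H.dia H.sL (H.algL.mul Y (H.s b)) Z)
    (H.isBal_dia (φ := H.sR.flip b) (ψ := LinearMap.id) (by simp [H.dia_bal])) X

theorem ev_plusMinus_t_mul (b : B) (X : L) : ev (H.plusMinus (H.algL.mul (H.t b) X)) f =
    ev (H.plusMinus X) fun p m => f p (H.algL.mul m (H.s b)) := by
  refine (ev_of_eq hf (H.plusMinus_eq (z := ev (H.plusMinus X) fun p m =>
    tm H.tR H.tL p (H.algL.mul m (H.s b))) ?_)).trans (by simp [ev_map])
  rw [hopfMap_sum]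
  simp only [← H.algL.mul_assoc]
  refine (H.ev_plusMinus_Δ (g := fun Y Z => H.dia H.sL Y (H.algL.mul Z (H.s b)))
    (H.isBal_dia (φ := LinearMap.id) (ψ := H.sR.flip b) (by simp [H.dia_bal])) X).trans ?_
  simp [H.dia_bal]

theorem ev_plusMinus_mul_t (b : B) (X : L) : ev (H.plusMinus (H.algL.mul X (H.t b))) f =
    ev (H.plusMinus X) fun p m => f p (H.algL.mul (H.s b) m) := by
  refine (ev_of_eq hf (H.plusMinus_eq (z := ev (H.plusMinus X) fun p m =>
    tm H.tR H.tL p (H.algL.mul (H.s b) m)) ?_)).trans (by simp [ev_map])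
  rw [hopfMap_sum]
  simp only [← H.algL.mul_assoc]
  refine Eq.trans ?_ (H.ev_plusMinus_Δ (g := fun Y Z => H.dia H.sL (H.algL.mul Y (H.t b)) Z)
    (H.isBal_dia (φ := H.tR.flip b) (ψ := LinearMap.id) (by simp [H.dia_bal])) X)
  congr 1; ext p m
  exact (H.ev_Δ_tak (H.isBal_hopf H.isBal_dia_sL m) b p).symm

/-- `b̄ X₊ ⊗ X₋ = X₊ ⊗ X₋ b̄`. -/
theorem ev_plusMinus_tak (b : B) (X : L) :
    (ev (H.plusMinus X) fun p m => f (H.algL.mul (H.t b) p) m) =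
      ev (H.plusMinus X) fun p m => f p (H.algL.mul m (H.t b)) := by
  have h : (ev (H.plusMinus X) fun p m => tm H.tR H.tL (H.algL.mul (H.t b) p) m) =
      ev (H.plusMinus X) fun p m => tm H.tR H.tL p (H.algL.mul m (H.t b)) := by
    apply H.hopf_bijective.1
    rw [hopfMap_sum, hopfMap_sum]
    simp only [H.ev_Δ_t_mul (H.isBal_hopf H.isBal_dia_sL _), ← H.algL.mul_assoc]
    refine Eq.trans ?_ (H.ev_plusMinus_Δ (g := fun Y Z => H.dia H.sL Y (H.algL.mul Z (H.t b)))
      (H.isBal_dia (φ := LinearMap.id) (ψ := H.tR.flip b) (by simp [H.dia_bal])) X).symm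
    simp only [H.algL.mul_assoc]
    refine (H.ev_plusMinus_Δ (g := fun Y Z => H.dia H.sL Y (H.algL.mul (H.t b) Z))
      (H.isBal_dia (φ := LinearMap.id) (ψ := H.tL b) (by simp [H.dia_bal])) X).trans ?_
    simp
  simpa [ev_map] using congrArg (blift f hf) h

theorem ev_plusMinus_one : ev (H.plusMinus H.algL.one) f = f H.algL.one H.algL.one := by
  refine (ev_of_eq hf (H.plusMinus_eq (z := tm H.tR H.tL H.algL.one H.algL.one) ?_)).trans
    (by simp)
  rw [hopfMap_tm, H.ev_Δ_one (H.isBal_hopf H.isBal_dia_sL _)]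
  simp

/-- `(X Y)₊ ⊗ (X Y)₋ = X₊ Y₊ ⊗ Y₋ X₋`. -/
theorem ev_plusMinus_mul (X Y : L) : ev (H.plusMinus (H.algL.mul X Y)) f =
    ev (H.plusMinus X) fun p m => ev (H.plusMinus Y) fun q n =>
      f (H.algL.mul p q) (H.algL.mul n m) := by
  refine (ev_of_eq hf (H.plusMinus_eq (z := ev (H.plusMinus X) fun p m =>
    ev (H.plusMinus Y) fun q n => tm H.tR H.tL (H.algL.mul p q) (H.algL.mul n m)) ?_)).trans
    (by simp [ev_map])
  rw [ev_map]
  simp only [hopfMap_sum]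
  simp only [H.ev_Δ_mul (H.isBal_hopf H.isBal_dia_sL _)]
  have e : ∀ p m, (ev (H.plusMinus Y) fun q n => ev (H.Δ q) fun Y₁ Y₂ => ev (H.Δ p) fun X₁ X₂ =>
      H.dia H.sL (H.algL.mul X₁ Y₁)
        (H.algL.mul (H.algL.mul X₂ Y₂) (H.algL.mul n m))) =
      ev (H.Δ p) fun X₁ X₂ => H.dia H.sL (H.algL.mul X₁ Y) (H.algL.mul X₂ m) := by
    intro p m
    have hg : H.Bl H.sL fun Y₁ Y₂ => ev (H.Δ p) fun X₁ X₂ =>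
        H.dia H.sL (H.algL.mul X₁ Y₁) (H.algL.mul X₂ (H.algL.mul Y₂ m)) :=
      { add_left := fun _ _ _ => by simp [ev_add_fun]
        smul_left := fun _ _ _ => by simp [ev_smul_fun]
        add_right := fun _ _ _ => by simp [ev_add_fun]
        smul_right := fun _ _ _ => by simp [ev_smul_fun]
        bal := fun Y₁ b Y₂ => by
          have := H.ev_Δ_tak (f := fun X₁ X₂ => H.dia H.sL (H.algL.mul X₁ Y₁)
            (H.algL.mul X₂ (H.algL.mul Y₂ m))) (H.isBal_dia (φ := H.algL.mul.flip Y₁)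
              (ψ := H.algL.mul.flip (H.algL.mul Y₂ m)) (by simp [H.dia_bal])) b p
          simpa using this }
    simpa using H.ev_plusMinus_Δ hg Y
  simp only [e]
  exact H.ev_plusMinus_Δ (g := fun Y₁ Z => H.dia H.sL (H.algL.mul Y₁ Y) Z)
    (H.isBal_dia (φ := H.algL.mul.flip Y) (ψ := LinearMap.id) (by simp [H.dia_bal])) X

theorem isBal_mul_right (Y : L) : H.Bo fun p m => f p (H.algL.mul m Y) where
  add_left _ _ _ := hf.add_left _ _ _
  smul_left _ _ _ := hf.smul_left _ _ _
  add_right _ _ _ := by simp [hf.add_right]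
  smul_right _ _ _ := by simp [hf.smul_right]
  bal X b n := by simpa using hf.bal X b (H.algL.mul n Y)

/-- `X₁₊ ⊗ X₁₋ X₂ = X ⊗ 1`. -/
theorem ev_Δ_plusMinus (X : L) :
    (ev (H.Δ X) fun X₁ X₂ => ev (H.plusMinus X₁) fun p m => f p (H.algL.mul m X₂)) =
      f X H.algL.one := by
  have h : (ev (H.Δ X) fun X₁ X₂ => ev (H.plusMinus X₁) fun p m =>
      tm H.tR H.tL p (H.algL.mul m X₂)) = tm H.tR H.tL X H.algL.one := by
    apply H.hopf_bijective.1
    rw [ev_map, hopfMap_tm]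
    simp only [hopfMap_sum, AlgebraOn.mul_one]
    congr 1; ext X₁ X₂
    simp only [← H.algL.mul_assoc]
    refine (H.ev_plusMinus_Δ (g := fun Y Z => H.dia H.sL Y (H.algL.mul Z X₂))
      (H.isBal_hopf H.isBal_dia_sL X₂) X₁).trans ?_
    simp
  have h2 := congrArg (blift f hf) h
  simpa [ev_map] using h2

end PlusMinus

/-- `X₊ X₋ = ε(X)`. -/
theorem ev_plusMinus_mul_self (X : L) :
    (ev (H.plusMinus X) fun p m => H.algL.mul p m) = H.s (H.ε X) := by
  have hg : H.Bl H.sL fun Y Z => H.algL.mul (H.s (H.ε Y)) Z :=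
    IsBal.mk_linear (H.algL.mul ∘ₗ H.s ∘ₗ H.ε) (by intro X b n; simp [H.ε_t_mul])
  have := H.ev_plusMinus_Δ hg X
  rw [H.algL.mul_one] at this
  rw [← this]
  congr 1; ext p m
  conv_lhs => rw [← H.reg.counit_ev p, ev_map₂]
  simp

/-- `X₊ \overline{ε(X₋)} = X`. -/
theorem ev_plusMinus_counit (X : L) :
    (ev (H.plusMinus X) fun p m => H.algL.mul p (H.t (H.ε m))) = X := by
  have hg : H.Bl H.sL fun Y Z => H.algL.mul (H.t (H.ε Z)) Y :=
    IsBal.mk_linear (r := H.tL.flip) (l := H.sL) (H.algL.mul ∘ₗ H.t ∘ₗ H.ε).flip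
      (by intro X b n; simp [H.ε_s_mul])
  have := H.ev_plusMinus_Δ hg X
  rw [H.ε_one, H.t_one, H.algL.one_mul] at this
  conv_rhs => rw [← this]
  congr 1; ext p m
  conv_lhs => rw [← H.counit_right_ev (H.algL.mul p (H.t (H.ε m)))]
  rw [H.ev_Δ_mul_t hg]
  congr 1; ext Y Z
  rw [← H.ε_mul_t]

theorem isBal_swap : H.Bo fun p m => H.dia H.tR.flip m p :=
  IsBal.mk_linear (r := H.tR) (l := H.tL) (H.dia H.tR.flip).flip (by
    intro X b Y
    exact (H.dia_bal H.tR.flip b Y X).symm)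

/-- `X₋ ⊗ X₊` as an element of the left comodule `L` with the action `X b̄`. -/
noncomputable def minusPlus : L →ₗ[k] H.Dia H.tR.flip :=
  blift (fun p m => H.dia H.tR.flip m p) H.isBal_swap ∘ₗ H.plusMinus

theorem minusPlus_apply (X : L) :
    H.minusPlus X = ev (H.plusMinus X) fun p m => H.dia H.tR.flip m p :=
  (ev_eq_blift _ _ H.isBal_swap).symm

theorem ev_minusPlus {f : L → L → Q} (hf : H.Bl H.tR.flip f) (X : L) :
    ev (H.minusPlus X) f = ev (H.plusMinus X) fun p m => f m p := by
  rw [minusPlus_apply, ev_ev hf]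
  simp only [ev_tm hf]

theorem bo_of_bl {f : L → L → Q} (hf : H.Bl H.tR.flip f) : H.Bo fun p m => f m p where
  add_left _ _ _ := hf.add_right _ _ _
  smul_left _ _ _ := hf.smul_right _ _ _
  add_right _ _ _ := hf.add_left _ _ _
  smul_right _ _ _ := hf.smul_left _ _ _
  bal X b n := (hf.bal n b X).symm

end LeftHopfAlgebroid
end Hopf

/-! ### The second comodule structure on `L` -/

section Hopf

variable {k : Type v} [Field k] {B L : Type u} [AddCommGroup B] [Module k B]
  [AddCommGroup L] [Module k L] {M N P A : Type u} [AddCommGroup M] [Module k M]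
  [AddCommGroup N] [Module k N] [AddCommGroup P] [Module k P] [AddCommGroup A] [Module k A]
  {Q : Type*} [AddCommGroup Q] [Module k Q]

namespace LeftHopfAlgebroid

open LeftBialgebroid

variable (H : LeftHopfAlgebroid k B L)

section Coassoc

variable {H} {T : L → L → L → Q} (hT : H.Bl₃ H.tR.flip T)
include hT

theorem isBal_coassoc_inner (c D : L) : H.Bo fun q w => T c (H.algL.mul w D) q :=
  isBal_mul_right (H.bo_of_bl (hT.right c)) D

theorem isBal_coassoc_outer (C D : L) : H.Bo fun p c => ev (H.plusMinus p) fun q w =>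
    T (H.algL.mul c C) (H.algL.mul w D) q where
  add_left _ _ _ := by rw [map_add, ev_add (isBal_coassoc_inner hT _ D)]
  smul_left _ _ _ := by rw [map_smul, ev_smul (isBal_coassoc_inner hT _ D)]
  add_right _ _ _ := by simp [(hT.left _).add_left, ev_add_fun]
  smul_right _ _ _ := by simp [(hT.left _).smul_left, ev_smul_fun]
  bal p b c := by
    refine (ev_plusMinus_mul_t (isBal_coassoc_inner hT _ D) b p).trans ?_
    congr 1; ext q w
    simpa using ((hT.left q).bal (H.algL.mul c C) b (H.algL.mul w D)).symm

theorem isBal₃_coassoc : H.Bl₃ H.sL fun A C D => ev (H.plusMinus A) fun p c =>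
    ev (H.plusMinus p) fun q w => T (H.algL.mul c C) (H.algL.mul w D) q where
  left D :=
    { add_left := fun _ _ _ => by rw [map_add, ev_add (isBal_coassoc_outer hT _ D)]
      smul_left := fun _ _ _ => by rw [map_smul, ev_smul (isBal_coassoc_outer hT _ D)]
      add_right := fun _ _ _ => by simp [(hT.left _).add_left, ev_add_fun]
      smul_right := fun _ _ _ => by simp [(hT.left _).smul_left, ev_smul_fun]
      bal := fun A b C => by
        refine (ev_plusMinus_t_mul (isBal_coassoc_outer hT C D) b A).trans ?_
        simp }
  right A :=
    { add_left := fun _ _ _ => by simp [(hT.left _).add_left, ev_add_fun]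
      smul_left := fun _ _ _ => by simp [(hT.left _).smul_left, ev_smul_fun]
      add_right := fun _ _ _ => by simp [(hT.right _).add_left, ev_add_fun]
      smul_right := fun _ _ _ => by simp [(hT.right _).smul_left, ev_smul_fun]
      bal := fun C b D => by
        have := ev_plusMinus_tak (isBal_coassoc_outer hT C D) b A
        simp only [AlgebraOn.mul_assoc] at this
        refine this.symm.trans ?_
        congr 1; ext p c
        refine (ev_plusMinus_t_mul (isBal_coassoc_inner hT _ D) b p).trans ?_
        simp }

/-- `X₋ ⊗ X₊₋ ⊗ X₊₊ = X₋₁ ⊗ X₋₂ ⊗ X₊`. The function `A ⋄ D ↦ T(A₋ D₁, A₊₋ D₂, A₊₊)` takes the same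
value on both sides of `X ⋄ 1 = X₊₁ ⋄ X₊₂ X₋`. On `X ⋄ 1` it is the left-hand side; on
`X₊₁ ⋄ X₊₂ X₋` it is the right-hand side, by applying `A₁₊ ⊗ A₁₋ A₂ = A ⊗ 1` twice. -/
theorem plusMinus_coassoc (X : L) :
    (ev (H.plusMinus X) fun p m => ev (H.plusMinus p) fun q w => T m w q) =
      ev (H.plusMinus X) fun p m => ev (H.Δ m) fun m₁ m₂ => T m₁ m₂ p := by
  have hK := isBal₃_coassoc hT
  have hΞ : H.Bl H.sL fun A D => ev (H.Δ D) fun C D => ev (H.plusMinus A) fun p c =>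
      ev (H.plusMinus p) fun q w => T (H.algL.mul c C) (H.algL.mul w D) q :=
    H.reg.isBal_ev_δ hK
  have h := H.ev_plusMinus_Δ hΞ X
  rw [H.ev_Δ_one (hK.right X)] at h
  simp only [AlgebraOn.mul_one] at h
  rw [← h]
  congr 1; ext p m
  simp only [H.ev_Δ_mul (hK.right _)]
  rw [ev_comm]
  congr 1; ext m₁ m₂
  have h3 : H.Bl₃ H.sL fun A C D => ev (H.plusMinus A) fun p c =>
    ev (H.plusMinus p) fun q w => T (H.algL.mul c (H.algL.mul C m₁))
      (H.algL.mul w (H.algL.mul D m₂)) q :=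
    { left := fun D => by
        have := hK.left (H.algL.mul D m₂)
        exact ⟨fun _ _ _ => this.add_left _ _ _, fun _ _ _ => this.smul_left _ _ _,
          fun A C C' => by simpa using this.add_right A (H.algL.mul C m₁) (H.algL.mul C' m₁),
          fun c A C => by simpa using this.smul_right c A (H.algL.mul C m₁),
          fun A b C => by simpa using this.bal A b (H.algL.mul C m₁)⟩
      right := fun A => by
        have := hK.right A
        exact ⟨fun C C' D => by
            simpa using this.add_left (H.algL.mul C m₁) (H.algL.mul C' m₁) (H.algL.mul D m₂),
          fun c C D => by simpa using this.smul_left c (H.algL.mul C m₁) (H.algL.mul D m₂),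
          fun C D D' => by
            simpa using this.add_right (H.algL.mul C m₁) (H.algL.mul D m₂) (H.algL.mul D' m₂),
          fun c C D => by simpa using this.smul_right c (H.algL.mul C m₁) (H.algL.mul D m₂),
          fun C b D => by simpa using this.bal (H.algL.mul C m₁) b (H.algL.mul D m₂)⟩ }
  refine (H.reg.coassoc_ev h3 p).trans ?_
  have e : ∀ V D, (ev (H.Δ V) fun A C => ev (H.plusMinus A) fun p c =>
    ev (H.plusMinus p) fun q w => T (H.algL.mul c (H.algL.mul C m₁))
      (H.algL.mul w (H.algL.mul D m₂)) q) = ev (H.plusMinus V) fun q w => T m₁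
      (H.algL.mul w (H.algL.mul D m₂)) q := by
    intro V D
    have := ev_Δ_plusMinus (isBal_coassoc_outer hT m₁ (H.algL.mul D m₂)) V
    simpa using this
  refine (congrArg (ev (H.Δ p)) (funext fun V => funext fun D => e V D)).trans ?_
  have := ev_Δ_plusMinus (isBal_coassoc_inner hT m₁ m₂) p
  simpa using this

end Coassoc

/-- `L` as a left comodule over itself with the actions `X b̄`, `b̄ X` and the coaction
`X ↦ X₋ ⋄ X₊`. -/
noncomputable abbrev cT : H.Comodule L :=
  Comodule.ofSweedler H.tR.flip H.tL.flip ⟨by simp, by simp⟩ ⟨by simp, by simp⟩ (by simp)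
    H.minusPlus
    (fun a m => by
      have hb : H.Bl H.tR.flip fun X n => H.dia H.tR.flip (H.algL.mul (H.s a) X) n :=
        Comodule.isBal_left H.tR.flip (H.sL a) (by simp)
      rw [ev_minusPlus _ hb, minusPlus_apply]
      exact ev_plusMinus_mul_t H.isBal_swap a m)
    (fun a m => by
      have hb : H.Bl H.tR.flip fun X n => H.dia H.tR.flip (H.algL.mul X (H.s a)) n :=
        Comodule.isBal_left H.tR.flip (H.sR.flip a) (by simp)
      rw [ev_minusPlus _ hb, minusPlus_apply]
      exact ev_plusMinus_t_mul H.isBal_swap a m)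
    (fun a m => by
      have hb : H.Bl H.tR.flip fun X n => H.dia H.tR.flip (H.algL.mul X (H.t a)) n :=
        Comodule.isBal_left H.tR.flip (H.tR.flip a) (by simp)
      have hb' : H.Bl H.tR.flip fun X n => H.dia H.tR.flip X (H.algL.mul (H.t a) n) :=
        IsBal.mk_linear ((H.dia H.tR.flip).compl₂ (H.tL a))
          (by intro X b n; simp [H.dia_bal])
      rw [ev_minusPlus _ hb]
      refine Eq.trans ?_ (H.ev_minusPlus hb' m).symm
      exact (ev_plusMinus_tak H.isBal_swap a m).symm)
    (fun m => by
      have ht := trip_isBal₃ (r₁ := H.tL.flip) (l₁ := H.sL) (r₂ := H.tL.flip) (l₂ := H.tR.flip)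
      have hl : ∀ a m, H.minusPlus (H.tR.flip a m) = ev (H.minusPlus m) fun X n =>
          H.dia H.tR.flip (H.algL.mul (H.s a) X) n := fun a m => by
        have hb : H.Bl H.tR.flip fun X n => H.dia H.tR.flip (H.algL.mul (H.s a) X) n :=
          Comodule.isBal_left H.tR.flip (H.sL a) (by simp)
        rw [ev_minusPlus _ hb, minusPlus_apply]
        exact ev_plusMinus_mul_t H.isBal_swap a m
      rw [H.ev_minusPlus (Comodule.isBal_ev_of (H := H.toLeftBialgebroid) hl ht),
        H.ev_minusPlus (isBal_ev_Δ (H := H.toLeftBialgebroid) ht)]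
      simp only [H.ev_minusPlus (ht.right _)]
      exact plusMinus_coassoc ht m)
    (fun m => by
      have hb : H.Bl H.tR.flip fun X n => H.tR.flip (H.ε X) n :=
        IsBal.mk_linear (H.tR.flip ∘ₗ H.ε) (by intro X b n; simp [H.ε_t_mul])
      rw [H.ev_minusPlus hb]
      exact H.ev_plusMinus_counit m)

theorem cT_δ (X : L) : H.cT.δ X = ev (H.plusMinus X) fun p m => H.dia H.tR.flip m p :=
  H.minusPlus_apply X

theorem ev_cT_δ {f : L → L → Q} (hf : H.Bl H.tR.flip f) (X : L) :
    ev (H.cT.δ X) f = ev (H.plusMinus X) fun p m => f m p := H.ev_minusPlus hf X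

/-- The two comodule structures on `L` commute: `X₁ ⊗ X₂₊ ⊗ X₂₋ = X₊₁ ⊗ X₊₂ ⊗ X₋`. -/
theorem commutes_reg_cT : Commutes H.reg H.cT where
  ll := by simp
  lr := by simp
  rl := by simp
  rr := by simp
  δ₁l b x := H.Δ_mul_t' b x
  δ₁r b x := H.Δ_t_mul b x
  δ₂l b x := by
    have hb : H.Bl H.tR.flip fun X y => H.dia H.tR.flip X (H.algL.mul (H.s b) y) :=
      IsBal.mk_linear ((H.dia H.tR.flip).compl₂ (H.sL b))
        (by intro X b n; simp [H.dia_bal])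
    refine Eq.trans ?_ (H.ev_cT_δ hb x).symm
    rw [cT_δ]
    exact ev_plusMinus_s_mul H.isBal_swap b x
  δ₂r b x := by
    have hb : H.Bl H.tR.flip fun X y => H.dia H.tR.flip X (H.algL.mul y (H.s b)) :=
      IsBal.mk_linear ((H.dia H.tR.flip).compl₂ (H.sR.flip b))
        (by intro X b n; simp [H.dia_bal])
    refine Eq.trans ?_ (H.ev_cT_δ hb x).symm
    rw [cT_δ]
    exact ev_plusMinus_mul_s H.isBal_swap b x
  comm Q _ _ T h1 h2 x := by
    have h1' : ∀ Z, H.Bl H.sL fun Y a => T Y Z a := h1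
    have h2' : ∀ Y, H.Bl H.tR.flip fun Z a => T Y Z a := h2
    have ha : ∀ Y D, H.Bo fun p m => T Y (H.algL.mul m D) p := fun Y D =>
      isBal_mul_right (H.bo_of_bl (h2' Y)) D
    have hK : H.Bl₃ H.sL fun A₁ A₂ D => ev (H.plusMinus A₂) fun p m =>
        T A₁ (H.algL.mul m D) p :=
      { left := fun D =>
          { add_left := fun _ _ _ => by simp [(h1' _).add_left, ev_add_fun]
            smul_left := fun _ _ _ => by simp [(h1' _).smul_left, ev_smul_fun]
            add_right := fun _ _ _ => by rw [map_add, ev_add (ha _ D)]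
            smul_right := fun _ _ _ => by rw [map_smul, ev_smul (ha _ D)]
            bal := fun A₁ b A₂ => by
              refine Eq.trans ?_ (ev_plusMinus_s_mul (ha A₁ D) b A₂).symm
              congr 1; ext p m
              exact (h1' _).bal _ _ _ }
        right := fun A₁ =>
          { add_left := fun _ _ _ => by rw [map_add, ev_add (ha A₁ _)]
            smul_left := fun _ _ _ => by rw [map_smul, ev_smul (ha A₁ _)]
            add_right := fun _ _ _ => by simp [(h2' _).add_left, ev_add_fun]
            smul_right := fun _ _ _ => by simp [(h2' _).smul_left, ev_smul_fun]
            bal := fun A₂ b D => by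
              refine (ev_plusMinus_t_mul (ha A₁ D) b A₂).trans ?_
              simp } }
    have h := H.ev_plusMinus_Δ (isBal_ev_Δ hK) x
    simp only [AlgebraOn.mul_one] at h
    have hb : H.Bl H.tR.flip fun Z y => ev (H.Δ y) fun Y a => T Y Z a :=
      { add_left := fun _ _ _ => by simp [(h2' _).add_left, ev_add_fun]
        smul_left := fun _ _ _ => by simp [(h2' _).smul_left, ev_smul_fun]
        add_right := fun Z _ _ => by rw [map_add, ev_add (h1' Z)]
        smul_right := fun _ Z _ => by rw [map_smul, ev_smul (h1' Z)]
        bal := fun Z b y => by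
          refine Eq.trans ?_ (H.ev_Δ_mul_t (h1' Z) b y).symm
          congr 1; ext Y a
          exact (h2' Y).bal Z b a }
    refine Eq.trans ?_ (H.ev_cT_δ hb x).symm
    refine Eq.trans (congrArg (ev (H.Δ x)) (funext fun Y => funext fun y =>
      H.ev_cT_δ (h2' Y) y)) (h.symm.trans ?_)
    congr 1; ext p m
    have hK' : H.Bl₃ H.sL fun A₁ A₂ D => ev (H.plusMinus A₂) fun q n =>
        T A₁ (H.algL.mul n (H.algL.mul D m)) q :=
      { left := fun D => hK.left (H.algL.mul D m)
        right := fun A₁ => H.isBal_hopf (hK.right A₁) m }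
    refine (H.reg.coassoc_ev hK' p).symm.trans ?_
    refine congrArg (ev (H.Δ p)) (funext fun Y => funext fun W => ?_)
    have := ev_Δ_plusMinus (ha Y m) W
    simpa using this

/-- `(Y, X) ↦ X Y` is a morphism of comodules for `X ↦ X₋ ⋄ X₊`. -/
theorem coBilin_mul_flip : CoBilin H.cT H.cT H.cT H.algL.mul.flip where
  bal := by simp
  left := by simp
  right := by simp
  colin Y X := by
    have hin := fun Y n => isDiagonal_mul.isBal_inner (cM := H.cT) (l := H.tR.flip)
      (f := H.algL.mul.flip) (by simp) Y n
    have hout := fun m => isDiagonal_mul.isBal_outer (cM := H.cT) (cN := H.cT) (l := H.tR.flip)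
      (f := H.algL.mul.flip) (by simp) (by simp) m
    refine Eq.trans ?_ (H.ev_cT_δ (hout Y) X).symm
    rw [cT_δ]
    refine (ev_plusMinus_mul H.isBal_swap X Y).trans ?_
    congr 1; ext p m
    exact (H.ev_cT_δ (hin m p) Y).symm

/-- `m₋₁ ⊗ m₀` is coinvariant in the tensor product of the comodules `L` and `M`, where `L` has
the coaction `X ↦ X₋ ⋄ X₊`. -/
theorem coinv_δ (cM : H.Comodule M) (m : M) : Coinv (H.cT.tens cM) (cM.δ m) := by
  have hf : ∀ Y n, H.Bo fun p z => H.dia (H.cT.tensLact cM) (H.algL.mul z Y)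
      (H.dia cM.lact p n) := fun Y n =>
    H.bo_of_bl (isDiagonal_mul.isBal_inner (cM := H.cT) (fun _ _ _ => rfl) Y n)
  have hT : H.Bl₃ cM.lact fun X Y n => ev (H.plusMinus X) fun p z =>
      H.dia (H.cT.tensLact cM) (H.algL.mul z Y) (H.dia cM.lact p n) :=
    { left := fun n =>
        { add_left := fun _ _ _ => by rw [map_add, ev_add (hf _ n)]
          smul_left := fun _ _ _ => by rw [map_smul, ev_smul (hf _ n)]
          add_right := fun _ _ _ => by simp [ev_add_fun]
          smul_right := fun _ _ _ => by simp [ev_smul_fun]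
          bal := fun X b Y => by
            refine (ev_plusMinus_t_mul (hf Y n) b X).trans ?_
            simp }
      right := fun X =>
        { add_left := fun _ _ _ => by simp [ev_add_fun]
          smul_left := fun _ _ _ => by simp [ev_smul_fun]
          add_right := fun _ _ _ => by simp [ev_add_fun]
          smul_right := fun _ _ _ => by simp [ev_smul_fun]
          bal := fun Y b n => by
            have := ev_plusMinus_tak (hf Y n) b X
            simp only [AlgebraOn.mul_assoc] at this
            refine this.symm.trans ?_
            simp [H.dia_bal] } }
  have e : ∀ X n, H.cT.tensδ cM (H.dia cM.lact X n) = ev (cM.δ n) fun Y n' =>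
      ev (H.plusMinus X) fun p z => H.dia (H.cT.tensLact cM) (H.algL.mul z Y)
        (H.dia cM.lact p n') := by
    intro X n
    refine (Comodule.tensδ_tm H.cT cM X n).trans ?_
    congr 1; ext Y n'
    exact H.ev_cT_δ (isDiagonal_mul.isBal_inner (cM := H.cT) (fun _ _ _ => rfl) Y n') X
  have h := cM.coassoc_ev hT m
  change H.cT.tensδ cM (cM.δ m) = _
  refine Eq.trans (b := ev (cM.δ m) fun X n => H.cT.tensδ cM (H.dia cM.lact X n)) ?_ ?_
  · rw [← ev_map, ev_tm_self]
  · simp only [e]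
    rw [h]
    refine Eq.trans (b := ev (cM.δ m) fun X n => H.dia (H.cT.tensLact cM) H.algL.one
      (H.dia cM.lact X n)) ?_ ?_
    · congr 1; ext X n
      have := ev_Δ_plusMinus (f := fun p z => H.dia (H.cT.tensLact cM) z
        (H.dia cM.lact p n)) (by simpa using hf H.algL.one n) X
      exact this
    · rw [← ev_map, ev_tm_self]

end LeftHopfAlgebroid
end Hopf

/-! ### The map `Γ^#` and its inverse -/

section Twist

variable {k : Type v} [Field k] {B L : Type u} [AddCommGroup B] [Module k B]
  [AddCommGroup L] [Module k L] {M N P A R : Type u} [AddCommGroup M] [Module k M]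
  [AddCommGroup N] [Module k N] [AddCommGroup P] [Module k P] [AddCommGroup A] [Module k A]
  [AddCommGroup R] [Module k R]
  {Q : Type*} [AddCommGroup Q] [Module k Q]

theorem ev_congr {r : M →ₗ[k] B →ₗ[k] M} {l : B →ₗ[k] N →ₗ[k] N} (z : Bal r l)
    {f g : M → N → Q} (h : ∀ m n, f m n = g m n) : ev z f = ev z g :=
  congrArg (ev z) (funext fun m => funext fun n => h m n)

theorem ev_fun_zero {r : M →ₗ[k] B →ₗ[k] M} {l : B →ₗ[k] N →ₗ[k] N} (z : Bal r l) :
    ev z (fun _ _ => (0 : Q)) = 0 := by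
  simp [ev]

/-- The exchange `m ⊗ n ↦ n ⊗ m`. -/
def balSwap (r : M →ₗ[k] B →ₗ[k] M) (l : B →ₗ[k] N →ₗ[k] N) : Bal r l ≃ₗ[k] Bal l.flip r.flip :=
  LinearEquiv.ofLinearMap
    (blift (fun m n => tm l.flip r.flip n m)
      (IsBal.mk_linear (r := r) (l := l) (tm l.flip r.flip).flip
        fun m b n => (tm_bal l.flip r.flip n b m).symm))
    (blift (r := l.flip) (l := r.flip) (fun n m => tm r l m n)
      (IsBal.mk_linear (r := l.flip) (l := r.flip) (tm r l).flip
        fun n b m => (tm_bal r l m b n).symm))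
    (Bal.hom_ext fun _ _ => rfl) (Bal.hom_ext fun _ _ => rfl)

@[simp] theorem balSwap_tm (r : M →ₗ[k] B →ₗ[k] M) (l : B →ₗ[k] N →ₗ[k] N) (m : M) (n : N) :
    balSwap r l (tm r l m n) = tm l.flip r.flip n m := rfl

namespace LeftBialgebroid

variable {H : LeftBialgebroid k B L}

/-- If `z` is coinvariant and `f` is a morphism `M ⊗_B N → P`, then `f(z, -)` is a morphism
`N → P`. -/
theorem CoBilin.coHom_of_coinv {cM : H.Comodule M} {cN : H.Comodule N} {cP : H.Comodule P}
    {f : M →ₗ[k] N →ₗ[k] P} (hf : CoBilin cM cN cP f) {z : M} (hz : Coinv cM z) :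
    CoHom cN cP (f z) where
  left b n := by rw [← hf.bal, hz.comm, hf.left]
  colin n := by
    rw [hf.colin]
    refine ev_congr _ fun Y n' => ?_
    rw [hz.ev (isDiagonal_mul.isBal_inner hf.left Y n')]
    simp

/-- If `χ` is an isomorphism of comodules and `χ ∘ φ` is a morphism, so is `φ`. -/
theorem CoHom.of_comp {cM : H.Comodule M} {cN : H.Comodule N} {cP : H.Comodule P}
    {φ : M →ₗ[k] N} {χ : N →ₗ[k] P} (hχ : CoHom cN cP χ) (hb : Function.Bijective χ)
    (h : CoHom cM cP (χ ∘ₗ φ)) : CoHom cM cN φ where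
  left b m := hb.1 (by rw [hχ.left]; exact h.left b m)
  colin m := by
    let e := LinearEquiv.ofBijective χ hb
    have he : ∀ n, e n = χ n := fun _ => rfl
    have hg : H.Bl cP.lact fun X p => H.dia cN.lact X (e.symm p) :=
      IsBal.mk_linear ((H.dia cN.lact).compl₂ e.symm.toLinearMap) (by
        intro X b p
        have : e.symm (cP.lact b p) = cN.lact b (e.symm p) := by
          apply e.injective
          rw [e.apply_symm_apply, he, hχ.left, ← he, e.apply_symm_apply]
        simp [H.dia_bal, this])
    have h1 := hχ.ev hg (φ m)
    have h2 := h.ev hg m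
    have hs : ∀ n, e.symm (χ n) = n := fun n => e.symm_apply_apply n
    simp only [LinearMap.comp_apply, hs] at h1 h2
    rw [← h2, h1, ev_tm_self]

section TensMap

variable (cM : H.Comodule M) {cN : H.Comodule N} {cP : H.Comodule P} {cA : H.Comodule A}

/-- `(m ⊗ n), a ↦ m ⊗ f(n, a)`. -/
def tensMapRight {f : N →ₗ[k] A →ₗ[k] P} (hf : CoBilin cN cA cP f) :
    Bal cM.ract cN.lact →ₗ[k] A →ₗ[k] Bal cM.ract cP.lact :=
  blift (fun m n => tm cM.ract cP.lact m ∘ₗ f n)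
    (IsBal.mk_linear ((LinearMap.llcomp k A P (Bal cM.ract cP.lact)).compl₁₂
      (tm cM.ract cP.lact) f) (by
        intro m b n
        ext a
        simp [tm_bal, hf.left]))

@[simp] theorem tensMapRight_tm {f : N →ₗ[k] A →ₗ[k] P} (hf : CoBilin cN cA cP f) (m : M) (n : N)
    (a : A) : tensMapRight cM hf (tm cM.ract cN.lact m n) a = tm cM.ract cP.lact m (f n a) := rfl

/-- For a morphism `f : N ⊗_B A → P`, the map `(M ⊗_B N) ⊗_B A → M ⊗_B P` is a morphism. -/
theorem coBilin_tensMapRight {f : N →ₗ[k] A →ₗ[k] P} (hf : CoBilin cN cA cP f) :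
    CoBilin (cM.tens cN) cA (cM.tens cP) (tensMapRight cM hf) where
  bal z b a := by
    revert z
    refine LinearMap.ext_iff.1 (Bal.hom_ext
      (f := (tensMapRight cM hf).flip a ∘ₗ (cM.tensRact cN).flip b)
      (g := (tensMapRight cM hf).flip (cA.lact b a)) fun m n => ?_)
    simp [hf.bal]
  left b z a := by
    revert z
    exact LinearMap.ext_iff.1 (Bal.hom_ext
      (f := (tensMapRight cM hf).flip a ∘ₗ cM.tensLact cN b)
      (g := cM.tensLact cP b ∘ₗ (tensMapRight cM hf).flip a) fun m n => rfl)
  right z a b := by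
    revert z
    refine LinearMap.ext_iff.1 (Bal.hom_ext
      (f := (tensMapRight cM hf).flip (cA.ract a b))
      (g := (cM.tensRact cP).flip b ∘ₗ (tensMapRight cM hf).flip a) fun m n => ?_)
    simp [hf.right]
  colin z a := by
    have hl : ∀ b z a, tensMapRight cM hf (cM.tensLact cN b z) a =
        cM.tensLact cP b (tensMapRight cM hf z a) := fun b z a => by
      revert z
      exact LinearMap.ext_iff.1 (Bal.hom_ext
        (f := (tensMapRight cM hf).flip a ∘ₗ cM.tensLact cN b)
        (g := cM.tensLact cP b ∘ₗ (tensMapRight cM hf).flip a) fun m n => rfl)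
    have hin := fun Y a' => isDiagonal_mul.isBal_inner (cM := cM.tens cN) (l := cM.tensLact cP)
      (f := tensMapRight cM hf) hl Y a'
    change cM.tensδ cP _ = ev (cA.δ a) fun Y a' => ev (cM.tensδ cN z) fun X m' =>
        H.dia (cM.tensLact cP) (H.algL.mul X Y) (tensMapRight cM hf m' a')
    induction z using Bal.induction with
    | h0 => simp only [map_zero, LinearMap.zero_apply, ev_zero (hin _ _), ev_fun_zero]
    | ha x y hx hy =>
      simp only [map_add, LinearMap.add_apply, ev_add (hin _ _), ev_add_fun, hx, hy]
    | ht m n =>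
      rw [tensMapRight_tm]
      refine (cM.tensδ_tm cP m _).trans ?_
      rw [hf.ev (cM.isBal_tens_outer cP m)]
      refine ev_congr _ fun Y a' => ?_
      rw [cM.ev_tensδ cN (hin Y a')]
      simp

/-- `a, (m ⊗ n) ↦ ν(a, m) ⊗ n`. -/
def tensMapLeft (cN : H.Comodule N) {ν : A →ₗ[k] M →ₗ[k] P}
    (hr : ∀ a m b, ν a (cM.ract m b) = cP.ract (ν a m) b) :
    A →ₗ[k] Bal cM.ract cN.lact →ₗ[k] Bal cP.ract cN.lact :=
  bliftL ((LinearMap.llcomp k M P (N →ₗ[k] Bal cP.ract cN.lact) (tm cP.ract cN.lact)) ∘ₗ ν) (by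
    intro a m b n
    simp [← tm_bal, hr])

end TensMap

namespace TwoCocycle

variable (G : H.TwoCocycle) (cM : H.Comodule M) (cN : H.Comodule N)
  {r' : M →ₗ[k] B →ₗ[k] M} {l' : B →ₗ[k] N →ₗ[k] N}

/-- The map `Γ^#`, for actions that agree with the twisted ones. -/
def twist (hr : r' = G.twR cM) (hl : l' = G.twL cN) : Bal r' l' →ₗ[k] Bal cM.ract cN.lact :=
  blift (fun m n => G.tw cM cN (tm cM.ract cN.lact) (tm_bal _ _) m n)
    (IsBal.mk_linear _ (by intro m b n; rw [hr, hl, tw_bal]))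

variable {cM cN} (hr : r' = G.twR cM) (hl : l' = G.twL cN)

@[simp] theorem twist_tm (m : M) (n : N) : G.twist cM cN hr hl (tm r' l' m n) =
    G.tw cM cN (tm cM.ract cN.lact) (tm_bal _ _) m n := by
  unfold twist
  rw [blift_tm]

theorem twist_eq_ev (z : Bal r' l') : G.twist cM cN hr hl z =
    ev z fun m n => G.tw cM cN (tm cM.ract cN.lact) (tm_bal _ _) m n := by
  rw [← ev_hom z (G.twist cM cN hr hl)]
  simp only [twist_tm]

/-- Summing `f^Γ` over `z` is summing `f` over `Γ^#(z)`. -/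
theorem ev_tw {f : M →ₗ[k] N →ₗ[k] R} (hf : ∀ m b n, f (cM.ract m b) n = f m (cN.lact b n))
    (z : Bal r' l') : (ev z fun m n => G.tw cM cN f hf m n) =
      ev (G.twist cM cN hr hl z) fun m n => f m n := by
  rw [ev_eq_blift _ _ (IsBal.mk_linear f hf), twist_eq_ev, ev_map]
  exact ev_congr z fun m n => G.tw_eq_blift hf m n

theorem twist_bijective (hG : G.Invertible) : Function.Bijective (G.twist cM cN hr hl) := by
  subst hr hl
  have : G.twist cM cN rfl rfl = G.sharp cM cN := Bal.hom_ext fun m n => by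
    rw [twist_tm, sharp_tm]
  rw [this]
  exact hG M N cM cN

/-- The inverse of `Γ^#`. -/
noncomputable def untwist (hG : G.Invertible) : Bal cM.ract cN.lact →ₗ[k] Bal r' l' :=
  (LinearEquiv.ofBijective _ (G.twist_bijective (cM := cM) (cN := cN) hr hl hG)).symm.toLinearMap

@[simp] theorem twist_untwist (hG : G.Invertible) (z : Bal cM.ract cN.lact) :
    G.twist cM cN hr hl (G.untwist hr hl hG z) = z :=
  (LinearEquiv.ofBijective _ (G.twist_bijective (cM := cM) (cN := cN) hr hl hG)).apply_symm_apply z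

theorem twist_injective (hG : G.Invertible) : Function.Injective (G.twist cM cN hr hl) :=
  (G.twist_bijective hr hl hG).1

end TwoCocycle
end LeftBialgebroid
end Twist

/-! ### The ring underlying the cotwist -/

section Cotwist

variable {k : Type v} [Field k] {B L : Type u} [AddCommGroup B] [Module k B]
  [AddCommGroup L] [Module k L] {M N P A R : Type u} [AddCommGroup M] [Module k M]
  [AddCommGroup N] [Module k N] [AddCommGroup P] [Module k P] [AddCommGroup A] [Module k A]
  [AddCommGroup R] [Module k R]
  {Q : Type*} [AddCommGroup Q] [Module k Q]

namespace LeftBialgebroid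

theorem coinv_reg_t (H : LeftBialgebroid k B L) (b : B) : Coinv H.reg (H.t b) := by
  have h := H.Δ_t_mul b H.algL.one
  have hb : H.Bl H.sL fun Y Z => H.dia H.sL Y (H.algL.mul (H.t b) Z) :=
    IsBal.mk_linear ((H.dia H.sL).compl₂ (H.tL b)) (by intro X b n; simp [H.dia_bal])
  rw [H.ev_Δ_one hb] at h
  simp only [AlgebraOn.mul_one] at h
  exact h

theorem coinv_reg_one (H : LeftBialgebroid k B L) : Coinv H.reg H.algL.one := H.Δ_one'

theorem coHom_s (H : LeftBialgebroid k B L) : CoHom H.base H.reg H.s where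
  left := by simp
  colin b := by
    have hb : H.Bl H.algB.mul fun X n => H.dia H.sL X (H.s n) :=
      IsBal.mk_linear ((H.dia H.sL).compl₂ H.s) (by intro X b n; simp [H.dia_bal])
    refine Eq.trans ?_ (ev_base_δ hb b).symm
    rw [H.s_one]
    exact H.Δ_s b

end LeftBialgebroid

namespace LeftHopfAlgebroid
open LeftBialgebroid

variable (H : LeftHopfAlgebroid k B L)

theorem coinv_cT_s (b : B) : Coinv H.cT (H.s b) := by
  have h := ev_plusMinus_s_mul H.isBal_swap b H.algL.one
  have hb : H.Bo fun p m => H.dia H.tR.flip m (H.algL.mul (H.s b) p) :=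
    IsBal.mk_linear (r := H.tR) (l := H.tL) ((H.dia H.tR.flip).compl₂ (H.sL b)).flip (by
      intro X c Y
      have := (H.dia_bal H.tR.flip c Y (H.algL.mul (H.s b) X)).symm
      simpa using this)
  rw [ev_plusMinus_one hb] at h
  refine (H.cT_δ _).trans ?_
  simpa using h

theorem coinv_cT_one : Coinv H.cT H.algL.one := by
  simpa using H.coinv_cT_s H.algB.one

theorem coHom_t : CoHom H.base H.cT H.t where
  left := by simp
  colin b := by
    have hb : H.Bl H.algB.mul fun X n => H.dia H.tR.flip X (H.t n) :=
      IsBal.mk_linear ((H.dia H.tR.flip).compl₂ H.t) (by intro X b n; simp [H.dia_bal])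
    refine Eq.trans ?_ (ev_base_δ hb b).symm
    refine (H.cT_δ _).trans ?_
    have h := ev_plusMinus_t_mul H.isBal_swap b H.algL.one
    have hb : H.Bo fun p m => H.dia H.tR.flip (H.algL.mul m (H.s b)) p :=
      IsBal.mk_linear (r := H.tR) (l := H.tL) (H.dia H.tR.flip ∘ₗ H.sR.flip b).flip (by
        intro X c Y
        have := (H.dia_bal H.tR.flip c (H.algL.mul Y (H.s b)) X).symm
        simpa using this)
    rw [ev_plusMinus_one hb] at h
    simpa using h

end LeftHopfAlgebroid

namespace LeftBialgebroid.TwoCocycle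

variable {H : LeftHopfAlgebroid k B L} (G : H.TwoCocycle)

/-- The product `X ∘ Y = X₊ Y₊ \overline{Γ(Y₋, X₋)}`. -/
noncomputable def circ : L →ₗ[k] L →ₗ[k] L :=
  (G.tw H.cT H.cT H.algL.mul.flip H.coBilin_mul_flip.bal).flip

theorem circ_apply (X Y : L) : G.circ X Y =
    G.tw H.cT H.cT H.algL.mul.flip H.coBilin_mul_flip.bal Y X := rfl

/-- The product twisted along the structure `X ↦ X₋ ⋄ X₊` is still a morphism for `Δ`, so that it
may be twisted again along `Δ`. -/
theorem coBilin_circ : CoBilin H.reg H.reg H.reg G.circ :=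
  H.commutes_reg_cT.symm.coBilin_tw G H.coBilin_mul_flip H.coBilin_mul

/-- The product twisted along `Δ` is still a morphism for `X ↦ X₋ ⋄ X₊`. -/
theorem coBilin_bul_flip : CoBilin H.cT H.cT H.cT G.bul.flip :=
  H.commutes_reg_cT.coBilin_tw G H.coBilin_mul H.coBilin_mul_flip

/-- The product `X ·_Γ Y` of the cotwist. -/
noncomputable def mulΓ : L →ₗ[k] L →ₗ[k] L := G.tw H.reg H.reg G.circ G.coBilin_circ.bal

theorem mulΓ_apply (X Y : L) : G.mulΓ X Y = G.tw H.reg H.reg G.circ G.coBilin_circ.bal X Y := rfl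

/-- The two twists of the product may be applied in either order. -/
theorem mulΓ_eq (X Y : L) :
    G.mulΓ X Y = G.tw H.cT H.cT G.bul.flip G.coBilin_bul_flip.bal Y X :=
  (H.commutes_reg_cT.tw_tw G H.coBilin_mul H.coBilin_mul_flip G.coBilin_bul_flip.bal
    G.coBilin_circ.bal Y X).symm

theorem circ_assoc (X Y Z : L) : G.circ (G.circ X Y) Z = G.circ X (G.circ Y Z) := by
  simp only [circ_apply]
  exact Eq.symm (G.tw_assoc H.coBilin_mul_flip H.coBilin_mul_flip H.coBilin_mul_flip.bal
    H.coBilin_mul_flip.bal (fun b X => H.cT.lact b X) (by simp) (by simp) (by simp) Z Y X)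

theorem bul_assoc (X Y Z : L) : G.bul (G.bul X Y) Z = G.bul X (G.bul Y Z) :=
  G.tw_assoc H.coBilin_mul H.coBilin_mul H.coBilin_mul.bal H.coBilin_mul.bal
    (fun b X => H.reg.lact b X) (by simp) (by simp) (by simp) X Y Z

theorem mulΓ_assoc (X Y Z : L) : G.mulΓ (G.mulΓ X Y) Z = G.mulΓ X (G.mulΓ Y Z) :=
  G.tw_assoc G.coBilin_circ G.coBilin_circ G.coBilin_circ.bal G.coBilin_circ.bal
    (fun b X => H.reg.lact b X) G.coBilin_circ.left G.coBilin_circ.left G.circ_assoc X Y Z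

theorem s_circ (b : B) (X : L) : G.circ (H.s b) X = H.algL.mul (H.s b) X := by
  rw [circ_apply, G.tw_coinv_right _ _ (H.coinv_cT_s b)]
  rfl

theorem circ_s (b : B) (X : L) : G.circ X (H.s b) = H.algL.mul X (H.s b) := by
  rw [circ_apply, G.tw_coinv_left _ (H.coinv_cT_s b)]
  rfl

theorem t_bul (b : B) (X : L) : G.bul (H.t b) X = H.algL.mul (H.t b) X := by
  rw [bul, G.tw_coinv_left _ (H.coinv_reg_t b)]

theorem bul_t (b : B) (X : L) : G.bul X (H.t b) = H.algL.mul X (H.t b) := by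
  rw [bul, G.tw_coinv_right _ _ (H.coinv_reg_t b)]

theorem s_mulΓ (b : B) (X : L) : G.mulΓ (H.s b) X = G.twL H.reg b X := by
  rw [← tw_lact, mulΓ_apply]
  exact (G.tw_nat (χ := LinearMap.id) (ψ := LinearMap.id) H.reg.coBilin_lact.bal
    G.coBilin_circ.bal (G.act_nat H.coHom_s) (CoHom.id _) (fun m n => (G.s_circ m n).symm)
    b X).symm

theorem mulΓ_s (b : B) (X : L) : G.mulΓ X (H.s b) = G.twR H.reg X b := by
  rw [← tw_ract, mulΓ_apply]
  exact (G.tw_nat (χ := LinearMap.id) (φ := LinearMap.id) H.reg.coBilin_ract.bal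
    G.coBilin_circ.bal (fun _ _ => rfl) H.coHom_s (fun m n => (G.circ_s n m).symm)
    X b).symm

theorem t_mulΓ (b : B) (X : L) : G.mulΓ (H.t b) X = G.twR H.cT X b := by
  rw [← tw_ract, mulΓ_eq]
  exact (G.tw_nat (χ := LinearMap.id) (φ := LinearMap.id) H.cT.coBilin_ract.bal
    G.coBilin_bul_flip.bal (fun _ _ => rfl) H.coHom_t (fun m n => (G.t_bul n m).symm)
    X b).symm

theorem mulΓ_t (b : B) (X : L) : G.mulΓ X (H.t b) = G.twL H.cT b X := by
  rw [← tw_lact, mulΓ_eq]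
  exact (G.tw_nat (χ := LinearMap.id) (ψ := LinearMap.id) H.cT.coBilin_lact.bal
    G.coBilin_bul_flip.bal (G.act_nat H.coHom_t) (CoHom.id _) (fun m n => (G.bul_t m n).symm)
    b X).symm

theorem twL_base (a b : B) : G.twL H.base a b = G.Γ (H.s a) (H.s b) := by
  rw [← tw_lact]
  exact G.tw_mul_base a b

/-- The `B^Γ`-ring underlying the cotwist. -/
noncomputable def ring : EnvRing k B L where
  algB := G.algB
  algL :=
    { mul := G.mulΓ
      one := H.algL.one
      mul_assoc := G.mulΓ_assoc
      one_mul := fun X => by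
        have := G.s_mulΓ H.algB.one X
        rwa [H.s_one, twL_one] at this
      mul_one := fun X => by
        have := G.mulΓ_s H.algB.one X
        rwa [H.s_one, twR_one] at this }
  s := H.s
  t := H.t
  s_one := H.s_one
  s_mul a b := by
    rw [algB_mul, s_mulΓ, G.twL_nat H.coHom_s, twL_base]
  t_one := H.t_one
  t_mul a b := by
    rw [algB_mul, mulΓ_t, G.twL_nat H.coHom_t, twL_base]
  s_t_comm a b := by
    rw [s_mulΓ, mulΓ_s, Coinv.twL _ (H.coinv_reg_t b), Coinv.twR _ (H.coinv_reg_t b)]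
    simp

theorem ring_mul : G.ring.algL.mul = G.mulΓ := rfl
theorem ring_one : G.ring.algL.one = H.algL.one := rfl

theorem ring_sL : G.ring.sL = G.twL H.reg := by
  ext b X; exact G.s_mulΓ b X

theorem ring_sR : G.ring.sR = G.twR H.reg := by
  ext X b; exact G.mulΓ_s b X

theorem ring_tL : G.ring.tL.flip = G.twR H.cT := by
  ext X b; exact G.t_mulΓ b X

theorem ring_tR : G.ring.tR.flip = G.twL H.cT := by
  ext b X; exact G.mulΓ_t b X

end LeftBialgebroid.TwoCocycle
end Cotwist

/-! ### The twisted coaction -/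

section Cotwist

variable {k : Type v} [Field k] {B L : Type u} [AddCommGroup B] [Module k B]
  [AddCommGroup L] [Module k L] {M N P A R : Type u} [AddCommGroup M] [Module k M]
  [AddCommGroup N] [Module k N] [AddCommGroup P] [Module k P] [AddCommGroup A] [Module k A]
  [AddCommGroup R] [Module k R]
  {Q : Type*} [AddCommGroup Q] [Module k Q]

namespace LeftBialgebroid.TwoCocycle

variable {H : LeftHopfAlgebroid k B L} (G : H.TwoCocycle)

section

variable {H : LeftBialgebroid k B L} (G : H.TwoCocycle) {cM : H.Comodule M} {cN : H.Comodule N}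
  {cP : H.Comodule P}

theorem tw_compl₂ {f : M →ₗ[k] P →ₗ[k] R} {ψ : N →ₗ[k] P}
    (hf' : ∀ m b n, f.compl₂ ψ (cM.ract m b) n = f.compl₂ ψ m (cN.lact b n))
    (hf : ∀ m b n, f (cM.ract m b) n = f m (cP.lact b n)) (hψ : CoHom cN cP ψ) (m : M) (n : N) :
    G.tw cM cN (f.compl₂ ψ) hf' m n = G.tw cM cP f hf m (ψ n) :=
  G.tw_nat (χ := LinearMap.id) (φ := LinearMap.id) hf' hf (fun _ _ => rfl) hψ (fun _ _ => rfl) m n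

theorem tw_comp {f : P →ₗ[k] N →ₗ[k] R} {φ : M →ₗ[k] P}
    (hf' : ∀ m b n, (f ∘ₗ φ) (cM.ract m b) n = (f ∘ₗ φ) m (cN.lact b n))
    (hf : ∀ m b n, f (cP.ract m b) n = f m (cN.lact b n))
    (hφ : ∀ Y m, G.act cP Y (φ m) = φ (G.act cM Y m)) (m : M) (n : N) :
    G.tw cM cN (f ∘ₗ φ) hf' m n = G.tw cP cN f hf (φ m) n :=
  G.tw_nat (χ := LinearMap.id) (ψ := LinearMap.id) hf' hf hφ (CoHom.id _) (fun _ _ => rfl) m n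

end

-- The twists are used through their universal properties only; unification would otherwise unfold
-- them when it compares balanced tensor products.
attribute [local irreducible] tw twist untwist

section Coact

variable {cM : H.Comodule M} {cN : H.Comodule N} {lM : B →ₗ[k] M →ₗ[k] M}
  {lN : B →ₗ[k] N →ₗ[k] N} (hM : lM = G.twL cM) (hN : lN = G.twL cN) (hG : G.Invertible)

/-- The twisted coaction `(Γ^#)⁻¹ ∘ δ`. -/
noncomputable def coact (cM : H.Comodule M) (hM : lM = G.twL cM) (hG : G.Invertible) :
    M →ₗ[k] G.ring.Dia lM :=
  G.untwist (cM := H.cT) (cN := cM) G.ring_tL hM hG ∘ₗ cM.δ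

theorem twist_coact (m : M) :
    G.twist H.cT cM G.ring_tL hM (G.coact cM hM hG m) = cM.δ m :=
  G.twist_untwist (cM := H.cT) (cN := cM) G.ring_tL hM hG (cM.δ m)

theorem coact_eq {m : M} {w : G.ring.Dia lM} (h : G.twist H.cT cM G.ring_tL hM w = cM.δ m) :
    G.coact cM hM hG m = w :=
  G.twist_injective G.ring_tL hM hG ((G.twist_coact hM hG m).trans h.symm)

/-- Summing `f^Γ` over the twisted coaction is summing `f` over the coaction. -/
theorem ev_coact_tw {f : L →ₗ[k] M →ₗ[k] R}
    (hf : ∀ X b m, f (H.cT.ract X b) m = f X (cM.lact b m)) (m : M) :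
    (ev (G.coact cM hM hG m) fun X n => G.tw H.cT cM f hf X n) =
      ev (cM.δ m) fun X n => f X n := by
  rw [G.ev_tw G.ring_tL hM hf, twist_coact]

theorem twist_ev {A' N' M' : Type u} [AddCommGroup A'] [Module k A'] [AddCommGroup N']
    [Module k N'] [AddCommGroup M'] [Module k M'] {r : M' →ₗ[k] A' →ₗ[k] M'}
    {l : A' →ₗ[k] N' →ₗ[k] N'} (z : Bal r l) (a : M' → N' → L) (b : M' → N' → M) :
    G.twist H.cT cM G.ring_tL hM (ev z fun p q => G.ring.dia lM (a p q) (b p q)) =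
      ev z fun p q => G.tw H.cT cM (H.dia cM.lact) (tm_bal _ _) (a p q) (b p q) := by
  rw [ev_map]
  exact ev_congr z fun p q => G.twist_tm G.ring_tL hM _ _

theorem ev_coact_tm (m : M) :
    (ev (G.coact cM hM hG m) fun X n =>
      G.tw H.cT cM (H.dia cM.lact) (tm_bal _ _) X n) = cM.δ m := by
  rw [G.ev_coact_tw hM hG (tm_bal _ _)]
  exact ev_tm_self _

/-- Naturality of the twisted coaction. -/
theorem coact_nat {φ : M →ₗ[k] N} (hφ : CoHom cM cN φ) (m : M) :
    G.coact cN hN hG (φ m) = ev (G.coact cM hM hG m) fun X n => G.ring.dia lN X (φ n) := by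
  have hf : ∀ X b m, (H.dia cN.lact).compl₂ φ (H.cT.ract X b) m =
      (H.dia cN.lact).compl₂ φ X (cM.lact b m) := by
    intro X b m
    simp [H.dia_bal, hφ.left]
  apply G.coact_eq hN hG
  rw [twist_ev, hφ.colin]
  refine Eq.trans (ev_congr _ fun X n => ?_) (G.ev_coact_tw hM hG hf m)
  exact (G.tw_compl₂ hf (tm_bal _ _) hφ X n).symm

theorem coact_twL (a : B) (m : M) : G.coact cM hM hG (G.twL cM a m) =
    ev (G.coact cM hM hG m) fun X n => G.ring.dia lM (G.ring.algL.mul (H.s a) X) n := by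
  have hc := H.commutes_reg_cT.symm.coHom_twL G a
  have hf : ∀ X b m, (H.dia cM.lact ∘ₗ G.twL H.reg a) (H.cT.ract X b) m =
      (H.dia cM.lact ∘ₗ G.twL H.reg a) X (cM.lact b m) := by
    intro X b m
    have := H.commutes_reg_cT.symm.ract_conv (G.Γ (H.s a)) (G.lin_left a) (G.twL H.reg a)
      (fun x => G.twL_apply H.reg a x) X b
    simp only [LinearMap.comp_apply]
    rw [this]
    exact H.dia_bal _ _ _ _
  apply G.coact_eq hM hG
  rw [twist_ev, δ_twL]
  refine Eq.trans (ev_congr _ fun X n => ?_) (G.ev_coact_tw hM hG hf m)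
  rw [ring_mul, s_mulΓ]
  exact (G.tw_comp (cP := H.cT) (f := H.dia cM.lact) hf
      (tm_bal H.tL.flip cM.lact) (G.act_nat hc) X n).symm

theorem coact_twR (a : B) (m : M) : G.coact cM hM hG (G.twR cM m a) =
    ev (G.coact cM hM hG m) fun X n => G.ring.dia lM (G.ring.algL.mul X (H.s a)) n := by
  have hc := H.commutes_reg_cT.symm.coHom_twR G a
  have hf : ∀ X b m, (H.dia cM.lact ∘ₗ (G.twR H.reg).flip a) (H.cT.ract X b) m =
      (H.dia cM.lact ∘ₗ (G.twR H.reg).flip a) X (cM.lact b m) := by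
    intro X b m
    have := H.commutes_reg_cT.symm.ract_act G (H.s a) X b
    exact (congrArg (fun z => H.dia cM.lact z m) this).trans (H.dia_bal _ _ _ _)
  apply G.coact_eq hM hG
  rw [twist_ev, ← act_s, δ_act]
  refine Eq.trans (ev_congr _ fun X n => ?_) ((G.ev_coact_tw hM hG hf m).trans ?_)
  · rw [ring_mul, mulΓ_s]
    exact (G.tw_comp (cP := H.cT) (f := H.dia cM.lact) hf
      (tm_bal H.tL.flip cM.lact) (G.act_nat hc) X n).symm
  · refine ev_congr _ fun X n => ?_
    simp only [LinearMap.comp_apply, LinearMap.flip_apply]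
    rw [← act_s, act_apply, ev_map₂]
    rfl

/-- The Takeuchi condition for the twisted coaction. The two sides differ by the two actions on
`m₋₁ ⊗ m₀`, which is coinvariant in `L ⊗_B M` for the second comodule structure on `L`. -/
theorem coact_tak (a : B) (m : M) :
    (ev (G.coact cM hM hG m) fun X n => G.ring.dia lM (G.ring.algL.mul X (H.t a)) n) =
      ev (G.coact cM hM hG m) fun X n => G.ring.dia lM X (G.twR cM n a) := by
  apply G.twist_injective G.ring_tL hM hG
  rw [twist_ev, twist_ev]
  have hz := H.coinv_δ cM m
  have h1 : ∀ X n, G.tw H.cT cM (H.dia cM.lact) (tm_bal _ _) (G.ring.algL.mul X (H.t a)) n =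
      G.twL (H.cT.tens cM) a (G.tw H.cT cM (H.dia cM.lact) (tm_bal _ _) X n) := by
    intro X n
    rw [ring_mul, mulΓ_t]
    exact G.tw_left (H.cT.coBilin_tm cM) a X n
  have h2 : ∀ X n, G.tw H.cT cM (H.dia cM.lact) (tm_bal _ _) X (G.twR cM n a) =
      G.twR (H.cT.tens cM) (G.tw H.cT cM (H.dia cM.lact) (tm_bal _ _) X n) a := fun X n =>
    G.tw_right (H.cT.coBilin_tm cM) a X n
  simp only [h1, h2]
  rw [← ev_map, ← ev_map₂, ev_coact_tm, Coinv.twL G hz, Coinv.twR G hz, hz.comm]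

/-- The comodule `L ⋄_{B^Γ} M`, with the coaction of the first factor. -/
noncomputable abbrev legΓ (l : B →ₗ[k] M →ₗ[k] M) : H.Comodule (G.ring.Dia l) :=
  H.reg.leg G.ring.tL.flip l
    (fun b => by
      rw [ring_tL]
      exact H.commutes_reg_cT.coHom_twR G b)
    (fun p a b => by
      rw [ring_tL]
      exact H.commutes_reg_cT.ract_act G (H.s b) p a)

/-- The twisted actions on `L ⋄_{B^Γ} M` are given by the product of the cotwist. -/
theorem twL_legΓ (l : B →ₗ[k] M →ₗ[k] M) (b : B) (X : L) (n : M) :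
    G.twL (G.legΓ l) b (G.ring.dia l X n) = G.ring.dia l (G.mulΓ (H.s b) X) n :=
  (G.twL_nat (H.reg.coHom_leg G.ring.tL.flip l
    (fun b => by rw [ring_tL]; exact H.commutes_reg_cT.coHom_twR G b)
    (fun p a b => by rw [ring_tL]; exact H.commutes_reg_cT.ract_act G (H.s b) p a) n) b X).trans
    (congrArg (fun Z => G.ring.dia l Z n) (G.s_mulΓ b X).symm)

theorem twR_legΓ (l : B →ₗ[k] M →ₗ[k] M) (b : B) (X : L) (n : M) :
    G.twR (G.legΓ l) (G.ring.dia l X n) b = G.ring.dia l (G.mulΓ X (H.s b)) n :=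
  (G.twR_nat (H.reg.coHom_leg G.ring.tL.flip l
    (fun b => by rw [ring_tL]; exact H.commutes_reg_cT.coHom_twR G b)
    (fun p a b => by rw [ring_tL]; exact H.commutes_reg_cT.ract_act G (H.s b) p a) n) b X).trans
    (congrArg (fun Z => G.ring.dia l Z n) (G.mulΓ_s b X).symm)

/-- The comodule `L ⋄ M`, with the coaction of the first factor. -/
noncomputable abbrev cofree (H : LeftHopfAlgebroid k B L) (l : B →ₗ[k] M →ₗ[k] M) :
    H.Comodule (H.Dia l) :=
  H.reg.leg H.tL.flip l (H.commutes_reg_cT.coHom_ract)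
    (fun p a b => by simp)

theorem isBal₃_cofree (H : LeftHopfAlgebroid k B L) (l : B →ₗ[k] M →ₗ[k] M) :
    H.Bl₃ l fun X Y n => H.dia (cofree H l).lact X (H.dia l Y n) where
  left n := IsBal.mk_linear ((H.dia (cofree H l).lact).compl₂ ((H.dia l).flip n))
    (fun X b Y => tm_bal _ _ X b (H.dia l Y n))
  right X := IsBal.mk_linear ((H.dia l).compr₂ (H.dia (cofree H l).lact X)) (by
    intro Y b n
    simp [H.dia_bal])

/-- `Γ^#` is a morphism `L ⋄_{B^Γ} M → L ⋄_B M` for the coactions of the first factors. -/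
theorem coHom_twist : CoHom (G.legΓ lM) (cofree H cM.lact)
    (G.twist H.cT cM G.ring_tL hM) where
  left b z := by
    revert z
    refine LinearMap.ext_iff.1 (Bal.hom_ext
      (f := G.twist H.cT cM G.ring_tL hM ∘ₗ (G.legΓ lM).lact b)
      (g := (cofree H cM.lact).lact b ∘ₗ G.twist H.cT cM G.ring_tL hM) fun X n => ?_)
    refine (G.twist_tm G.ring_tL hM _ _).trans (Eq.trans ?_ (congrArg
      ((cofree H cM.lact).lact b) (G.twist_tm G.ring_tL hM X n).symm))
    rw [tw_apply, tw_apply, ev_map]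
    refine ev_congr _ fun Y n' => ?_
    rw [(H.commutes_reg_cT.coHom_act G Y).left b X]
    rfl
  colin z := by
    have hg : H.Bl (G.legΓ lM).lact fun X n =>
        H.dia (cofree H cM.lact).lact X (G.twist H.cT cM G.ring_tL hM n) :=
      IsBal.mk_linear ((H.dia (cofree H cM.lact).lact).compl₂
        (G.twist H.cT cM G.ring_tL hM)) (by
        intro X b n
        revert n
        refine LinearMap.ext_iff.1 (Bal.hom_ext
          (f := H.dia (cofree H cM.lact).lact (H.tL.flip X b) ∘ₗ G.twist H.cT cM G.ring_tL hM)
          (g := H.dia (cofree H cM.lact).lact X ∘ₗ G.twist H.cT cM G.ring_tL hM ∘ₗ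
            (G.legΓ lM).lact b) fun Z n => ?_)
        refine (H.dia_bal (cofree H cM.lact).lact b X _).trans (congrArg
          (H.dia (cofree H cM.lact).lact X) ?_)
        refine (congrArg ((cofree H cM.lact).lact b) (G.twist_tm G.ring_tL hM Z n)).trans
          (Eq.trans ?_ (G.twist_tm G.ring_tL hM _ _).symm)
        rw [tw_apply, tw_apply, ev_map]
        refine ev_congr _ fun Y n' => ?_
        rw [(H.commutes_reg_cT.coHom_act G Y).left b Z]
        rfl)
    rw [ev_eq_blift _ _ hg]
    revert z
    refine LinearMap.ext_iff.1 (Bal.hom_ext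
      (f := (cofree H cM.lact).δ ∘ₗ G.twist H.cT cM G.ring_tL hM)
      (g := blift _ hg ∘ₗ (G.legΓ lM).δ) fun X n => ?_)
    simp only [LinearMap.comp_apply, ← ev_eq_blift _ _ hg]
    refine Eq.trans ?_ (H.reg.ev_legδ _ _ _ hg X n).symm
    refine (congrArg (cofree H cM.lact).δ (G.twist_tm G.ring_tL hM X n)).trans (Eq.trans ?_
      (ev_congr _ fun X₁ X₂ => congrArg (H.dia (cofree H cM.lact).lact X₁)
        (G.twist_tm G.ring_tL hM X₂ n)).symm)
    rw [tw_apply, ev_map]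
    have e : ∀ Y n', (cofree H cM.lact).δ (H.dia cM.lact (G.act H.cT Y X) n') =
        ev (H.Δ X) fun X₁ X₂ => H.dia (cofree H cM.lact).lact X₁
          (H.dia cM.lact (G.act H.cT Y X₂) n') := fun Y n' =>
      (H.commutes_reg_cT.coHom_act G Y).ev (H.reg.isBal_leg H.tL.flip cM.lact
        H.commutes_reg_cT.coHom_ract n') X
    refine (ev_congr _ e).trans ?_
    rw [ev_comm]
    refine ev_congr _ fun X₁ X₂ => ?_
    rw [tw_apply, ev_map]

/-- Coassociativity: the coaction is a morphism from `M` to the comodule `L ⋄ M`. -/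
theorem coHom_δ (cM : H.Comodule M) : CoHom cM (cofree H cM.lact) cM.δ where
  left b m := by
    rw [cM.δ_lact]
    exact ((ev_map (cM.δ m) _ ((cofree H cM.lact).lact b)).symm).trans
      (congrArg ((cofree H cM.lact).lact b) (ev_tm_self (cM.δ m)))
  colin m := by
    have h := cM.coassoc_ev (isBal₃_cofree H cM.lact) m
    refine Eq.trans ?_ (h.symm.trans ?_)
    · exact (congrArg (cofree H cM.lact).δ (ev_tm_self (cM.δ m)).symm).trans
        (ev_map (cM.δ m) _ (cofree H cM.lact).δ)
    · refine ev_congr _ fun X n => ?_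
      rw [← ev_map, ev_tm_self]

/-- The twisted coaction is a morphism of comodules `M → L ⋄_{B^Γ} M`. -/
theorem coHom_coact : CoHom cM (G.legΓ lM) (G.coact cM hM hG) := by
  refine CoHom.of_comp (G.coHom_twist hM) (G.twist_bijective G.ring_tL hM hG) ?_
  have : G.twist H.cT cM G.ring_tL hM ∘ₗ G.coact cM hM hG = cM.δ :=
    LinearMap.ext fun m => G.twist_coact hM hG m
  rw [this]
  exact coHom_δ cM

end Coact

end LeftBialgebroid.TwoCocycle
end Cotwist

/-! ### The counit of the cotwist -/

section Cotwist

variable {k : Type v} [Field k] {B L : Type u} [AddCommGroup B] [Module k B]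
  [AddCommGroup L] [Module k L] {M N P A R : Type u} [AddCommGroup M] [Module k M]
  [AddCommGroup N] [Module k N] [AddCommGroup P] [Module k P] [AddCommGroup A] [Module k A]
  [AddCommGroup R] [Module k R]
  {Q : Type*} [AddCommGroup Q] [Module k Q]

namespace LeftBialgebroid.TwoCocycle

variable {H : LeftHopfAlgebroid k B L} (G : H.TwoCocycle)

attribute [local irreducible] tw twist untwist

theorem bo_Γ : H.Bo fun p m => G.Γ p m := IsBal.mk_linear G.Γ (by simp [G.balanced])

/-- The counit `ε^Γ(X) = Γ(X₊, X₋)` of the cotwist. -/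
noncomputable def epsΓ : L →ₗ[k] B := blift _ G.bo_Γ ∘ₗ H.plusMinus

theorem epsΓ_apply (X : L) : G.epsΓ X = ev (H.plusMinus X) fun p m => G.Γ p m :=
  (ev_eq_blift _ _ G.bo_Γ).symm

theorem bl_Γ : H.Bl H.tR.flip fun m p => G.Γ p m :=
  IsBal.mk_linear (r := H.tL.flip) (l := H.tR.flip) G.Γ.flip (by simp [G.balanced])

theorem epsΓ_eq (X : L) : G.epsΓ X = ev (H.cT.δ X) fun m p => G.Γ p m := by
  rw [H.ev_cT_δ G.bl_Γ, epsΓ_apply]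

theorem bl_bul : H.Bl H.tR.flip fun m p => G.bul p m :=
  IsBal.mk_linear (r := H.tL.flip) (l := H.tR.flip) G.bul.flip
    (fun Y b X => (G.isDiagonal_bul.t_mid b X Y).symm)

/-- `X₊ • X₋ = ε^Γ(X)`. -/
theorem ev_bul (X : L) : (ev (H.cT.δ X) fun m p => G.bul p m) = H.s (G.epsΓ X) := by
  have hg : H.Bl H.sL fun Y Z => H.algL.mul (H.s (G.Γ Y H.algL.one)) Z := by
    simpa using G.isBal_twMul H.algL.one H.algL.one
  have hin : ∀ m₁ m₂, H.Bl H.sL fun p₁ p₂ =>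
      H.algL.mul (H.s (G.Γ p₁ m₁)) (H.algL.mul p₂ m₂) := G.isBal_twMul
  have hT : H.Bl₃ H.tR.flip fun m₁ m₂ p => ev (H.Δ p) fun p₁ p₂ =>
      H.algL.mul (H.s (G.Γ p₁ m₁)) (H.algL.mul p₂ m₂) :=
    { left := fun p =>
        { add_left := fun _ _ _ => by simp [ev_add_fun]
          smul_left := fun _ _ _ => by simp [ev_smul_fun]
          add_right := fun _ _ _ => by simp [ev_add_fun]
          smul_right := fun _ _ _ => by simp [ev_smul_fun]
          bal := fun m₁ b m₂ => by
            have := H.ev_Δ_tak (hin m₁ m₂) b p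
            simpa [G.balanced] using this }
      right := fun m₁ =>
        { add_left := fun _ _ _ => by simp [ev_add_fun]
          smul_left := fun _ _ _ => by simp [ev_smul_fun]
          add_right := fun m₂ _ _ => by rw [map_add, ev_add (hin m₁ m₂)]
          smul_right := fun _ m₂ _ => by rw [map_smul, ev_smul (hin m₁ m₂)]
          bal := fun m₂ b p => by
            have := H.ev_Δ_mul_t (hin m₁ m₂) b p
            simpa using this.symm } }
  rw [H.ev_cT_δ G.bl_bul]
  simp only [bul_apply]
  refine (LeftHopfAlgebroid.plusMinus_coassoc hT X).symm.trans ?_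
  rw [epsΓ_apply, ev_map]
  refine ev_congr _ fun p m => ?_
  have := H.ev_plusMinus_Δ (hin m H.algL.one) p
  simpa using this

theorem one_bul (X : L) : G.bul H.algL.one X = X := by
  simpa using G.t_bul H.algB.one X

theorem bul_one (X : L) : G.bul X H.algL.one = X := by
  simpa using G.bul_t H.algB.one X

/-- `ε^Γ(X ·_Γ Y) = Γ(X₊, ε^Γ(Y) • X₋)`, which depends on `Y` through `ε^Γ(Y)` only. -/
theorem epsΓ_mul (X Y : L) : G.epsΓ (G.mulΓ X Y) =
    ev (H.cT.δ X) fun z p => G.Γ p (G.bul (H.s (G.epsΓ Y)) z) := by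
  rw [mulΓ_eq, epsΓ_eq, G.ev_δ_tw G.coBilin_bul_flip G.bl_Γ]
  refine ev_congr _ fun z p => ?_
  rw [← ev_bul]
  simp only [LinearMap.flip_apply, ← Γ_bul, ← bul_assoc]
  rw [ev_map₂, ev_map]

theorem bl_epsΓ_mul (c : B) : H.Bl H.tR.flip fun z p => G.Γ p (G.bul (H.s c) z) :=
  IsBal.mk_linear (r := H.tL.flip) (l := H.tR.flip) (G.Γ.flip ∘ₗ G.bul (H.s c)) (by
    intro z b p
    have := G.isDiagonal_bul.t_mid b (H.s c) z
    simp only [LinearMap.comp_apply, LinearMap.flip_apply, EnvRing.tL_apply, EnvRing.tR_apply]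
    rw [← this, H.s_t_comm, G.isDiagonal_bul.t_left, G.balanced])

theorem epsΓ_one : G.epsΓ H.algL.one = H.algB.one := by
  rw [epsΓ_eq, H.coinv_cT_one.ev G.bl_Γ, G.one_left, H.ε_one]

@[simp] theorem epsΓ_s (b : B) : G.epsΓ (H.s b) = b := by
  rw [epsΓ_eq, (H.coinv_cT_s b).ev G.bl_Γ, G.one_right, H.ε_s]

theorem cT_δ_t (b : B) : H.cT.δ (H.t b) = H.dia H.tR.flip (H.s b) H.algL.one := by
  rw [H.coHom_t.colin]
  refine (ev_base_δ (CoHom.isBal H.coHom_t) b).trans ?_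
  rw [H.t_one]

@[simp] theorem epsΓ_t (b : B) : G.epsΓ (H.t b) = b := by
  rw [epsΓ_eq, cT_δ_t, ev_tm G.bl_Γ, G.one_left, H.ε_s]

theorem epsΓ_mul_s (X Y : L) : G.epsΓ (G.mulΓ X Y) = G.epsΓ (G.mulΓ X (H.s (G.epsΓ Y))) := by
  rw [epsΓ_mul, epsΓ_mul, epsΓ_s]

theorem epsΓ_mul_t (X Y : L) : G.epsΓ (G.mulΓ X Y) = G.epsΓ (G.mulΓ X (H.t (G.epsΓ Y))) := by
  rw [epsΓ_mul, epsΓ_mul, epsΓ_t]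

theorem epsΓ_s_mul (b : B) (X : L) :
    G.epsΓ (G.mulΓ (H.s b) X) = G.Γ (H.s b) (H.s (G.epsΓ X)) := by
  rw [epsΓ_mul, (H.coinv_cT_s b).ev (G.bl_epsΓ_mul _), bul_one]

theorem epsΓ_t_mul (b : B) (X : L) :
    G.epsΓ (G.mulΓ (H.t b) X) = G.Γ (H.s (G.epsΓ X)) (H.s b) := by
  rw [epsΓ_mul, cT_δ_t, ev_tm (G.bl_epsΓ_mul _), Γ_bul, one_bul]

section Counit

variable (cM : H.Comodule M)

theorem isBal_evalR : H.Bl (H.cT.tensLact cM) fun C w => G.evalR cM w C :=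
  IsBal.mk_linear (r := H.tL.flip) (l := H.cT.tensLact cM) (G.evalR cM).flip (by
    intro C b w
    revert w
    refine LinearMap.ext_iff.1 (Bal.hom_ext (f := (G.evalR cM).flip (H.tL.flip C b))
      (g := (G.evalR cM).flip C ∘ₗ H.cT.tensLact cM b) fun Z m => ?_)
    exact congrArg (fun b => cM.lact b m) (G.balanced Z C b).symm)

/-- `X ⊗ m ↦ Γ(X₊, X₋ m₋₁) m₀`. -/
noncomputable def evalΓ : H.Dia cM.lact →ₗ[k] M :=
  blift _ (G.isBal_evalR cM) ∘ₗ H.cT.tensδ cM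

theorem evalΓ_apply (z : H.Dia cM.lact) : G.evalΓ cM z =
    ev (H.cT.tensδ cM z) fun C w => G.evalR cM w C :=
  (ev_eq_blift _ _ (G.isBal_evalR cM)).symm

/-- `evalΓ` composed with `Γ^#` is `X ⊗ m ↦ ε^Γ(X) ·_Γ m`. -/
theorem evalΓ_tw (X : L) (m : M) :
    G.evalΓ cM (G.tw H.cT cM (H.dia cM.lact) (tm_bal _ _) X m) = G.twL cM (G.epsΓ X) m := by
  rw [evalΓ_apply]
  refine (G.ev_δ_tw (H.cT.coBilin_tm cM) (G.isBal_evalR cM) X m).trans ?_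
  rw [twL_apply]
  refine ev_congr _ fun Y m' => ?_
  rw [← ev_bul, ev_map₂, ev_map₂]
  refine ev_congr _ fun Z X' => ?_
  rw [← Γ_bul]
  exact G.evalR_tmul cM X' (G.bul Z Y) m'

/-- Since `m₋₁ ⊗ m₀` is coinvariant, `evalΓ` is a retraction of the coaction. With `evalΓ_tw`, this
is the counit axiom for the twisted coaction. -/
theorem evalΓ_δ (m : M) : G.evalΓ cM (cM.δ m) = m := by
  rw [evalΓ_apply]
  refine (Coinv.ev (H.coinv_δ cM m) (G.isBal_evalR cM)).trans ?_
  exact G.act_one cM m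

variable {cM} {lM : B →ₗ[k] M →ₗ[k] M} (hM : lM = G.twL cM) (hG : G.Invertible)

theorem coact_counit (m : M) :
    (ev (G.coact cM hM hG m) fun X n => G.twL cM (G.epsΓ X) n) = m := by
  simp only [← evalΓ_tw]
  rw [← ev_map, ev_coact_tm, evalΓ_δ]

/-- The coproduct of the cotwist. -/
noncomputable abbrev comulΓ (hG : G.Invertible) : L →ₗ[k] G.ring.Dia G.ring.sL :=
  G.coact H.reg G.ring_sL hG

/-- Coassociativity of the twisted coaction: it is natural with respect to itself, being a morphism
`M → L ⋄_{B^Γ} M`. -/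
theorem coact_coassoc {T : L → L → M → Q}
    (hT : IsBal₃ G.ring.tL.flip G.ring.sL G.ring.tL.flip lM T) (m : M) :
    (ev (G.coact cM hM hG m) fun X n => ev (G.coact cM hM hG n) fun Y p => T X Y p) =
      ev (G.coact cM hM hG m) fun X n => ev (G.comulΓ hG X) fun Y Z => T Y Z n := by
  have h1 := G.coact_nat hM rfl hG (G.coHom_coact hM hG) m
  have h2 : ∀ X n, G.coact (G.legΓ lM) rfl hG (G.ring.dia lM X n) = ev (G.comulΓ hG X)
      fun Y Z => G.ring.dia (G.twL (G.legΓ lM)) Y (G.ring.dia lM Z n) := fun X n =>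
    G.coact_nat G.ring_sL rfl hG (H.reg.coHom_leg G.ring.tL.flip lM _ _ n) X
  have h3 := ev_hom (G.coact cM hM hG m) (G.coact (G.legΓ lM) rfl hG)
  rw [h1] at h3
  have hF : IsBal G.ring.tL.flip (G.twL (G.legΓ lM)) fun X z => blift (T X) (hT.right X) z :=
    { add_left := fun X X' z => by
        revert z
        exact LinearMap.ext_iff.1 (Bal.hom_ext (f := blift _ (hT.right (X + X')))
          (g := blift _ (hT.right X) + blift _ (hT.right X')) fun Y n =>
            (hT.left n).add_left X X' Y)
      smul_left := fun c X z => by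
        revert z
        exact LinearMap.ext_iff.1 (Bal.hom_ext (f := blift _ (hT.right (c • X)))
          (g := c • blift _ (hT.right X)) fun Y n => (hT.left n).smul_left c X Y)
      add_right := fun _ _ _ => map_add _ _ _
      smul_right := fun _ _ _ => map_smul _ _ _
      bal := fun X b z => by
        revert z
        refine LinearMap.ext_iff.1 (Bal.hom_ext (f := blift _ (hT.right (G.ring.tL.flip X b)))
          (g := blift _ (hT.right X) ∘ₗ G.twL (G.legΓ lM) b) fun Y n => ?_)
        exact ((hT.left n).bal X b Y).trans
          (congrArg (blift _ (hT.right X)) (G.twL_legΓ lM b Y n)).symm }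
  have h4 := congrArg (blift _ hF) h3
  rw [ev_map, ev_map] at h4
  refine Eq.trans (ev_congr _ fun X n => ?_) (h4.symm.trans (ev_congr _ fun X n => ?_))
  · rw [blift_tm, ev_eq_blift _ _ (hT.right X)]
  · rw [h2, ev_map]
    rfl

end Counit

end LeftBialgebroid.TwoCocycle
end Cotwist

/-! ### The Hopf-Galois map and the multiplicativity of the coproduct -/

section Cotwist

variable {k : Type v} [Field k] {B L : Type u} [AddCommGroup B] [Module k B]
  [AddCommGroup L] [Module k L] {M N P A R : Type u} [AddCommGroup M] [Module k M]
  [AddCommGroup N] [Module k N] [AddCommGroup P] [Module k P] [AddCommGroup A] [Module k A]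
  [AddCommGroup R] [Module k R]
  {Q : Type*} [AddCommGroup Q] [Module k Q]

namespace LeftBialgebroid.TwoCocycle

variable {H : LeftHopfAlgebroid k B L} (G : H.TwoCocycle)

attribute [local irreducible] tw twist untwist

section Star

variable {cM : H.Comodule M} {cN : H.Comodule N} {cP : H.Comodule P}
  {lM : B →ₗ[k] M →ₗ[k] M} {lN : B →ₗ[k] N →ₗ[k] N} (hM : lM = G.twL cM) (hN : lN = G.twL cN)
  (hG : G.Invertible)

/-- The sum of `Γ^#(X ⊗ f^Γ(m', n))` over the twisted coaction `m ↦ X ⊗ m'` is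
`m₋₁ ⊗ f(m₀, n)`. -/
theorem ev_coact_tw_tw {f : M →ₗ[k] N →ₗ[k] P} (hf : CoBilin cM cN cP f) (m : M) (n : N) :
    (ev (G.coact cM hM hG m) fun X m' =>
      G.tw H.cT cP (H.dia cP.lact) (tm_bal _ _) X (G.tw cM cN f hf.bal m' n)) =
      tensMapRight H.cT hf (cM.δ m) n := by
  have hb := (coBilin_tensMapRight H.cT hf).bal
  have h : ∀ X m', G.tw H.cT cP (H.dia cP.lact) (tm_bal _ _) X (G.tw cM cN f hf.bal m' n) =
      G.tw (H.cT.tens cM) cN (tensMapRight H.cT hf) hb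
        (G.tw H.cT cM (H.dia cM.lact) (tm_bal _ _) X m') n := fun X m' =>
    (G.tw_assoc (H.cT.coBilin_tm cM) hf hb (tm_bal _ _)
      (fun b z => H.cT.tensLact cP b z)
      (coBilin_tensMapRight H.cT hf).left (fun _ _ _ => rfl) (fun _ _ _ => rfl) X m' n).symm
  simp only [h]
  rw [← ev_map₂, ev_coact_tm]
  exact G.tw_coinv_left hb (H.coinv_δ cM m) n

theorem tensMapRight_δ {f : M →ₗ[k] N →ₗ[k] P} (hf : CoBilin cM cN cP f) (m : M) (n : N) :
    tensMapRight H.cT hf (cM.δ m) n = ev (cM.δ m) fun X m' => H.dia cP.lact X (f m' n) := by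
  have := ev_map₂ (cM.δ m) (fun X m' => tm H.cT.ract cM.lact X m') (tensMapRight H.cT hf) n
  rw [ev_tm_self] at this
  exact this

theorem tensMapLeft_bal {ν : L →ₗ[k] L →ₗ[k] L} (hν : CoBilin H.cT H.cT H.cT ν) (Y : L) (b : B)
    (z : H.Dia cP.lact) : tensMapLeft H.cT cP hν.right (H.cT.ract Y b) z =
      tensMapLeft H.cT cP hν.right Y (H.cT.tensLact cP b z) := by
  revert z
  refine LinearMap.ext_iff.1 (Bal.hom_ext
    (f := tensMapLeft H.cT cP hν.right (H.cT.ract Y b))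
    (g := tensMapLeft H.cT cP hν.right Y ∘ₗ H.cT.tensLact cP b) fun X p => ?_)
  exact congrArg (fun Z => H.dia cP.lact Z p) (hν.bal Y b X)

theorem tensMapLeft_left {ν : L →ₗ[k] L →ₗ[k] L} (hν : CoBilin H.cT H.cT H.cT ν) (b : B) (Y : L)
    (z : H.Dia cP.lact) : tensMapLeft H.cT cP hν.right (H.cT.lact b Y) z =
      H.cT.tensLact cP b (tensMapLeft H.cT cP hν.right Y z) := by
  revert z
  refine LinearMap.ext_iff.1 (Bal.hom_ext
    (f := tensMapLeft H.cT cP hν.right (H.cT.lact b Y))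
    (g := H.cT.tensLact cP b ∘ₗ tensMapLeft H.cT cP hν.right Y) fun X p => ?_)
  exact congrArg (fun Z => H.dia cP.lact Z p) (hν.left b Y X)

/-- For morphisms `ν` and `f`, the sum of `Γ^#(ν^Γ(Y, X) ⊗ f^Γ(m', n'))` over the twisted
coactions `m ↦ X ⊗ m'` and `n ↦ Y ⊗ n'` is `ν(n₋₁, m₋₁) ⊗ f(m₀, n₀)`. -/
theorem ev_coact_coact {ν : L →ₗ[k] L →ₗ[k] L} (hν : CoBilin H.cT H.cT H.cT ν)
    {f : M →ₗ[k] N →ₗ[k] P} (hf : CoBilin cM cN cP f) (m : M) (n : N) :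
    (ev (G.coact cN hN hG n) fun Y n' => ev (G.coact cM hM hG m) fun X m' =>
      G.tw H.cT cP (H.dia cP.lact) (tm_bal _ _) (G.tw H.cT H.cT ν hν.bal Y X)
        (G.tw cM cN f hf.bal m' n')) =
      ev (cN.δ n) fun Y n' => ev (cM.δ m) fun X m' => H.dia cP.lact (ν Y X) (f m' n') := by
  have hi := tensMapLeft_bal (cP := cP) hν
  have hφ := (coBilin_tensMapRight H.cT hf).coHom_of_coinv (H.coinv_δ cM m)
  have h1 : ∀ Y n', (ev (G.coact cM hM hG m) fun X m' =>
      G.tw H.cT cP (H.dia cP.lact) (tm_bal _ _) (G.tw H.cT H.cT ν hν.bal Y X)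
        (G.tw cM cN f hf.bal m' n')) = G.tw H.cT (H.cT.tens cP) (tensMapLeft H.cT cP hν.right) hi
        Y (tensMapRight H.cT hf (cM.δ m) n') := by
    intro Y n'
    rw [← G.ev_coact_tw_tw hM hG hf, ev_map]
    refine ev_congr _ fun X m' => ?_
    exact G.tw_assoc hν (H.cT.coBilin_tm cP) (tm_bal _ _) hi
      (fun b z => H.cT.tensLact cP b z)
      (fun _ _ _ => rfl) (tensMapLeft_left hν) (fun _ _ _ => rfl) Y X _
  simp only [h1]
  have hi' : ∀ Y b n', (tensMapLeft H.cT cP hν.right).compl₂ (tensMapRight H.cT hf (cM.δ m))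
      (H.cT.ract Y b) n' = (tensMapLeft H.cT cP hν.right).compl₂
        (tensMapRight H.cT hf (cM.δ m)) Y (cN.lact b n') := by
    intro Y b n'
    exact (hi Y b _).trans (congrArg (tensMapLeft H.cT cP hν.right Y) (hφ.left b n').symm)
  have h2 := G.ev_coact_tw hN hG hi' n
  refine Eq.trans (ev_congr _ fun Y n' => ?_) (h2.trans (ev_congr _ fun Y n' => ?_))
  · exact (G.tw_compl₂ hi' hi hφ Y n').symm
  · rw [LinearMap.compl₂_apply, tensMapRight_δ, ev_map]
    rfl

end Star

section Product

variable (hG : G.Invertible)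

/-- Multiplicativity of the coproduct: after `Γ^#`, both sides are the coaction of the twisted
product, by `ev_coact_coact` with `ν(Y, X) = X • Y` and `f(X, Y) = X ∘ Y`. -/
theorem comulΓ_mul (X Y : L) : G.comulΓ hG (G.mulΓ X Y) =
    ev (G.comulΓ hG Y) fun Y₁ Y₂ => ev (G.comulΓ hG X) fun X₁ X₂ =>
      G.ring.dia G.ring.sL (G.mulΓ X₁ Y₁) (G.mulΓ X₂ Y₂) := by
  apply G.coact_eq G.ring_sL hG
  have h := G.ev_coact_coact (cM := H.reg) (cN := H.reg) G.ring_sL G.ring_sL hG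
    G.coBilin_bul_flip G.coBilin_circ X Y
  rw [ev_map]
  refine Eq.trans (ev_congr _ fun Y₁ Y₂ => ?_) (h.trans (G.δ_tw G.coBilin_circ X Y).symm)
  rw [twist_ev]
  refine ev_congr _ fun X₁ X₂ => ?_
  rw [mulΓ_eq G X₁ Y₁, mulΓ_apply]

theorem comulΓ_one : G.comulΓ hG H.algL.one =
    G.ring.dia G.ring.sL H.algL.one H.algL.one := by
  apply G.coact_eq G.ring_sL hG
  rw [twist_tm, G.tw_coinv_left _ H.coinv_cT_one]
  exact H.Δ_one'.symm

theorem comulΓ_t_mul (b : B) (X : L) : G.comulΓ hG (G.mulΓ (H.t b) X) =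
    ev (G.comulΓ hG X) fun Y Z => G.ring.dia G.ring.sL Y (G.mulΓ (H.t b) Z) := by
  simp only [t_mulΓ]
  exact G.coact_nat G.ring_sL G.ring_sL hG (H.commutes_reg_cT.coHom_twR G b) X

/-- The Hopf-Galois map of the cotwist, composed with `Γ^#`, is the Hopf-Galois map of `L` composed
with `Γ^#` for the second comodule structure on `L`. -/
theorem twist_galois (X Y : L) : G.twist H.cT H.reg G.ring_tL G.ring_sL
    (ev (G.comulΓ hG X) fun X₁ X₂ => G.ring.dia G.ring.sL X₁ (G.mulΓ X₂ Y)) =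
      H.hopfMap ((balSwap H.tR H.tL).symm (G.tw H.cT H.cT (tm H.cT.ract H.cT.lact) (tm_bal _ _)
        Y X)) := by
  rw [twist_ev]
  refine (G.ev_coact_tw_tw (cM := H.reg) G.ring_sL hG G.coBilin_circ X Y).trans ?_
  rw [tensMapRight_δ]
  have hT₁ : ∀ m, H.Bl H.sL fun p₁ p₂ => H.dia H.sL p₁ (H.algL.mul p₂ (G.act H.cT m Y)) :=
    fun m => H.isBal_hopf H.isBal_dia_sL _
  have hT₂ : ∀ p₁, H.Bl H.tR.flip fun m p₂ =>
      H.dia H.sL p₁ (H.algL.mul p₂ (G.act H.cT m Y)) := fun p₁ =>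
    IsBal.mk_linear ((H.algL.mul.flip ∘ₗ (G.act H.cT).flip Y).compr₂ (H.dia H.sL p₁)) (by
      intro m b p₂
      have := G.act_t_mul H.cT b m Y
      simp only [LinearMap.compr₂_apply, LinearMap.comp_apply, LinearMap.flip_apply,
        EnvRing.tL_apply, EnvRing.tR_apply]
      rw [this]
      simp)
  have h := H.commutes_reg_cT.comm _ _ hT₁ hT₂ X
  refine Eq.trans (ev_congr _ fun X₁ X₂ => ?_) (h.trans ?_)
  · rw [circ_apply, tw_apply, ev_map]
    rfl
  · rw [tw_apply]
    refine Eq.trans ?_ (ev_map (H.cT.δ X) _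
      (H.hopfMap ∘ₗ (balSwap H.tR H.tL).symm.toLinearMap)).symm
    refine ev_congr _ fun m p => ?_
    exact (LeftBialgebroid.hopfMap_tm _ _ _).symm

end Product

end LeftBialgebroid.TwoCocycle
end Cotwist

/-! ### The cotwist -/

section Cotwist

variable {k : Type v} [Field k] {B L : Type u} [AddCommGroup B] [Module k B]
  [AddCommGroup L] [Module k L] {M N P A R : Type u} [AddCommGroup M] [Module k M]
  [AddCommGroup N] [Module k N] [AddCommGroup P] [Module k P] [AddCommGroup A] [Module k A]
  [AddCommGroup R] [Module k R]
  {Q : Type*} [AddCommGroup Q] [Module k Q]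

namespace LeftBialgebroid

/-- A left bialgebroid from Sweedler formulas. -/
abbrev ofSweedler (R : EnvRing k B L) (Δ : L →ₗ[k] R.Dia R.sL) (ε : L →ₗ[k] B)
    (hs : ∀ a X, Δ (R.algL.mul (R.s a) X) =
      ev (Δ X) fun Y Z => R.dia R.sL (R.algL.mul (R.s a) Y) Z)
    (ht : ∀ a X, Δ (R.algL.mul (R.t a) X) =
      ev (Δ X) fun Y Z => R.dia R.sL Y (R.algL.mul (R.t a) Z))
    (htak : ∀ a X, (ev (Δ X) fun Y Z => R.dia R.sL (R.algL.mul Y (R.t a)) Z) =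
      ev (Δ X) fun Y Z => R.dia R.sL Y (R.algL.mul Z (R.s a)))
    (hco : ∀ X, (ev (Δ X) fun X n => ev (Δ n) fun Y p =>
        trip R.tL.flip R.sL R.tL.flip R.sL X Y p) =
      ev (Δ X) fun X n => ev (Δ X) fun Y Z => trip R.tL.flip R.sL R.tL.flip R.sL Y Z n)
    (h1 : Δ R.algL.one = R.dia R.sL R.algL.one R.algL.one)
    (hmul : ∀ X Y, Δ (R.algL.mul X Y) = ev (Δ Y) fun Y₁ Y₂ => ev (Δ X) fun X₁ X₂ =>
      R.dia R.sL (R.algL.mul X₁ Y₁) (R.algL.mul X₂ Y₂))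
    (hεs : ∀ a X, ε (R.algL.mul (R.s a) X) = R.algB.mul a (ε X))
    (hεt : ∀ a X, ε (R.algL.mul (R.t a) X) = R.algB.mul (ε X) a)
    (hcl : ∀ X, (ev (Δ X) fun Y Z => R.algL.mul (R.s (ε Y)) Z) = X)
    (hcr : ∀ X, (ev (Δ X) fun Y Z => R.algL.mul (R.t (ε Z)) Y) = X)
    (hε1 : ε R.algL.one = R.algB.one)
    (hεms : ∀ X Y, ε (R.algL.mul X Y) = ε (R.algL.mul X (R.s (ε Y))))
    (hεmt : ∀ X Y, ε (R.algL.mul X Y) = ε (R.algL.mul X (R.t (ε Y)))) :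
    LeftBialgebroid k B L where
  toEnvRing := R
  Δ := Δ
  ε := ε
  Δ_bilin a b X u hu := by
    have hb : IsBal R.tL.flip R.sL fun Y Z => R.dia R.sL (R.algL.mul (R.s a) Y) Z :=
      IsBal.mk_linear (R.dia R.sL ∘ₗ R.sL a) (by
        intro Y c Z
        simpa using R.dia_bal R.sL c (R.algL.mul (R.s a) Y) Z)
    have hb' : IsBal R.tL.flip R.sL fun Y Z =>
        R.dia R.sL (R.algL.mul (R.s a) Y) (R.algL.mul (R.t b) Z) :=
      IsBal.mk_linear ((R.dia R.sL).compl₁₂ (R.sL a) (R.tL b)) (by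
        intro Y c Z
        simpa using R.dia_bal R.sL c (R.algL.mul (R.s a) Y) (R.algL.mul (R.t b) Z))
    rw [hs, ht, ev_ev hb, toBal_map (R.sL a) (R.tL b) (fun _ _ => rfl) hb', hu]
    exact ev_congr _ fun Y Z => ev_tm hb _ _
  Δ_takeuchi a X u hu := by
    have hb : IsBal R.tL.flip R.sL fun Y Z => R.dia R.sL (R.algL.mul Y (R.t a)) Z :=
      IsBal.mk_linear (R.dia R.sL ∘ₗ R.tR.flip a) (by
        intro Y c Z
        simpa using R.dia_bal R.sL c (R.algL.mul Y (R.t a)) Z)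
    have hb' : IsBal R.tL.flip R.sL fun Y Z => R.dia R.sL Y (R.algL.mul Z (R.s a)) :=
      IsBal.mk_linear (r := R.tL.flip) (l := R.sL) ((R.dia R.sL).compl₂ (R.sR.flip a)) (by
        intro Y c Z
        simpa using R.dia_bal R.sL c Y (R.algL.mul Z (R.s a)))
    rw [toBal_map (R.tR.flip a) LinearMap.id (fun _ _ => rfl) hb,
      toBal_map LinearMap.id (R.sR.flip a) (fun _ _ => rfl) hb', hu]
    exact htak a X
  coassoc X u hu := by
    have ht₃ := trip_isBal₃ (r₁ := R.tL.flip) (l₁ := R.sL) (r₂ := R.tL.flip) (l₂ := R.sL)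
    have hr : IsBal R.tL.flip R.sL fun X n => ev (Δ n) fun Y p =>
        trip R.tL.flip R.sL R.tL.flip R.sL X Y p :=
      { add_left := fun _ _ _ => by simp only [(ht₃.left _).add_left, ev_add_fun]
        smul_left := fun _ _ _ => by simp only [(ht₃.left _).smul_left, ev_smul_fun]
        add_right := fun X _ _ => by rw [map_add, ev_add (ht₃.right X)]
        smul_right := fun _ X _ => by rw [map_smul, ev_smul (ht₃.right X)]
        bal := fun X b n => by
          change _ = ev (Δ (R.algL.mul (R.s b) n)) _
          rw [hs, ev_ev (ht₃.right X)]
          refine ev_congr _ fun Y Z => ?_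
          rw [ev_tm (ht₃.right X)]
          exact (ht₃.left Z).bal X b Y }
    have hl : IsBal R.tL.flip R.sL fun X n => ev (Δ X) fun Y Z =>
        trip R.tL.flip R.sL R.tL.flip R.sL Y Z n :=
      { add_left := fun _ _ n => by rw [map_add, ev_add (ht₃.left n)]
        smul_left := fun _ _ n => by rw [map_smul, ev_smul (ht₃.left n)]
        add_right := fun _ _ _ => by simp only [(ht₃.right _).add_right, ev_add_fun]
        smul_right := fun _ _ _ => by simp only [(ht₃.right _).smul_right, ev_smul_fun]
        bal := fun X b n => by
          change ev (Δ (R.algL.mul (R.t b) X)) _ = _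
          rw [ht, ev_ev (ht₃.left n)]
          refine ev_congr _ fun Y Z => ?_
          rw [ev_tm (ht₃.left n)]
          exact (ht₃.right Y).bal Z b n }
    refine (ev_toBal_eq hr u (tripleR R.tL.flip R.sL R.tL.flip R.sL ∘ₗ
      TensorProduct.map LinearMap.id Δ) fun X n => tripleR_eq_ev X (Δ n)).symm.trans
      (Eq.trans ?_ (ev_toBal_eq hl u (tripleL R.tL.flip R.sL R.tL.flip R.sL ∘ₗ
      TensorProduct.map Δ LinearMap.id) fun X n => tripleL_eq_ev (Δ X) n))
    rw [hu]
    exact hco X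
  Δ_one := h1
  Δ_mul X Y u w hu hw := by
    have hin : ∀ Y₁ Y₂, IsBal R.tL.flip R.sL fun X₁ X₂ =>
        R.dia R.sL (R.algL.mul X₁ Y₁) (R.algL.mul X₂ Y₂) := fun Y₁ Y₂ =>
      IsBal.mk_linear (r := R.tL.flip) (l := R.sL) ((R.dia R.sL).compl₁₂ (R.algL.mul.flip Y₁)
        (R.algL.mul.flip Y₂)) (by
          intro X₁ c X₂
          simpa using R.dia_bal R.sL c (R.algL.mul X₁ Y₁) (R.algL.mul X₂ Y₂))
    have hout : IsBal R.tL.flip R.sL fun Y₁ Y₂ => ev (Δ X) fun X₁ X₂ =>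
        R.dia R.sL (R.algL.mul X₁ Y₁) (R.algL.mul X₂ Y₂) :=
      { add_left := fun _ _ _ => by simp [ev_add_fun]
        smul_left := fun _ _ _ => by simp [ev_smul_fun]
        add_right := fun _ _ _ => by simp [ev_add_fun]
        smul_right := fun _ _ _ => by simp [ev_smul_fun]
        bal := fun Y₁ b Y₂ => by
          have := congrArg (blift _ (hin Y₁ Y₂)) (htak b X)
          simpa [ev_map] using this }
    rw [hmul, ← hw]
    refine ev_toBal_eq hout w (R.toDia R.sL ∘ₗ
      TensorProduct.map₂ R.algL.mul R.algL.mul u) fun Y Z => ?_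
    rw [← hu]
    have h := ev_toBal_eq (hin Y Z) u (R.toDia R.sL ∘ₗ
      (TensorProduct.map₂ R.algL.mul R.algL.mul).flip (Y ⊗ₜ[k] Z)) fun _ _ => rfl
    exact h.symm
  ε_bilin a b X := by rw [hεs, hεt]
  counit_left X u hu := by
    refine Eq.trans ?_ (hcl X)
    rw [← hu]
    refine (ev_toBal_eq ?_ u (TensorProduct.lift (R.sL ∘ₗ ε)) (by simp)).symm
    refine IsBal.mk_linear (r := R.tL.flip) (l := R.sL) (R.sL ∘ₗ ε) ?_
    intro X b n
    simp [hεt]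
  counit_right X u hu := by
    refine Eq.trans ?_ (hcr X)
    rw [← hu]
    refine (ev_toBal_eq ?_ u (TensorProduct.lift (R.tL ∘ₗ ε).flip) (by simp)).symm
    refine IsBal.mk_linear (r := R.tL.flip) (l := R.sL) (R.tL ∘ₗ ε).flip ?_
    intro X b n
    simp [hεs]
  ε_one := hε1
  ε_mul_s := hεms
  ε_mul_t := hεmt

end LeftBialgebroid

namespace LeftBialgebroid.TwoCocycle

variable {H : LeftHopfAlgebroid k B L} (G : H.TwoCocycle)

attribute [local irreducible] tw twist untwist

variable (hG : G.Invertible)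

theorem epsΓ_s_mul' (b : B) (X : L) :
    G.epsΓ (G.ring.algL.mul (G.ring.s b) X) = G.ring.algB.mul b (G.epsΓ X) := G.epsΓ_s_mul b X

theorem epsΓ_t_mul' (b : B) (X : L) :
    G.epsΓ (G.ring.algL.mul (G.ring.t b) X) = G.ring.algB.mul (G.epsΓ X) b := G.epsΓ_t_mul b X

/-- The Hopf-Galois map of the cotwist, as a composite of bijections. -/
noncomputable def hopfΓ : G.ring.OpTensor →ₗ[k] G.ring.Dia G.ring.sL :=
  G.untwist (cM := H.cT) (cN := H.reg) G.ring_tL G.ring_sL hG ∘ₗ H.hopfMap ∘ₗ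
    (balSwap H.tR H.tL).symm.toLinearMap ∘ₗ
    G.twist H.cT H.cT G.ring_tL G.ring_tR ∘ₗ (balSwap G.ring.tR G.ring.tL).toLinearMap

theorem twist_hopfΓ (z : G.ring.OpTensor) :
    G.twist H.cT H.reg G.ring_tL G.ring_sL (G.hopfΓ hG z) =
      H.hopfMap ((balSwap H.tR H.tL).symm
        (G.twist H.cT H.cT G.ring_tL G.ring_tR (balSwap G.ring.tR G.ring.tL z))) :=
  G.twist_untwist (cM := H.cT) (cN := H.reg) G.ring_tL G.ring_sL hG _

theorem hopfΓ_bijective : Function.Bijective (G.hopfΓ hG) := by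
  have h : Function.Bijective (G.twist H.cT H.reg G.ring_tL G.ring_sL ∘ G.hopfΓ hG) := by
    have e : G.twist H.cT H.reg G.ring_tL G.ring_sL ∘ G.hopfΓ hG =
        H.hopfMap ∘ (balSwap H.tR H.tL).symm ∘ G.twist H.cT H.cT G.ring_tL G.ring_tR ∘
          balSwap G.ring.tR G.ring.tL := funext fun z => G.twist_hopfΓ hG z
    rw [e]
    exact H.hopf_bijective.comp ((balSwap H.tR H.tL).symm.bijective.comp
      ((G.twist_bijective (cM := H.cT) (cN := H.cT) G.ring_tL G.ring_tR hG).comp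
        (balSwap G.ring.tR G.ring.tL).bijective))
  exact ((G.twist_bijective G.ring_tL G.ring_sL hG).of_comp_iff' _).1 h

theorem hopfΓ_tm (X Y : L) : G.hopfΓ hG (tm G.ring.tR G.ring.tL X Y) =
    ev (G.comulΓ hG X) fun X₁ X₂ => G.ring.dia G.ring.sL X₁ (G.mulΓ X₂ Y) := by
  apply G.twist_injective (cM := H.cT) (cN := H.reg) G.ring_tL G.ring_sL hG
  rw [twist_galois, twist_hopfΓ, balSwap_tm, twist_tm]

theorem comulΓ_mul_t (b : B) (X : L) : G.comulΓ hG (G.mulΓ X (H.t b)) =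
    ev (G.comulΓ hG X) fun Y Z => G.ring.dia G.ring.sL Y (G.mulΓ Z (H.t b)) := by
  simp only [mulΓ_t]
  exact G.coact_nat G.ring_sL G.ring_sL hG (H.commutes_reg_cT.coHom_twL G b) X

theorem comulΓ_counit_left (X : L) :
    (ev (G.comulΓ hG X) fun Y Z => G.mulΓ (H.s (G.epsΓ Y)) Z) = X := by
  simp only [s_mulΓ]
  exact G.coact_counit G.ring_sL hG X

theorem isBal_counit_right : IsBal G.ring.tL.flip G.ring.sL fun Y Z =>
    G.ring.algL.mul (G.ring.t (G.epsΓ Z)) Y :=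
  IsBal.mk_linear (r := G.ring.tL.flip) (l := G.ring.sL) (G.ring.tL ∘ₗ G.epsΓ).flip (by
    intro X b n
    simp [epsΓ_s_mul'])

/-- The right counit axiom. The operator `Φ(X) = \overline{ε(X₂)} X₁` is idempotent by
coassociativity and the left counit axiom, and it is surjective since the Hopf-Galois map is. -/
theorem comulΓ_counit_right (X : L) :
    (ev (G.comulΓ hG X) fun Y Z => G.ring.algL.mul (G.ring.t (G.epsΓ Z)) Y) = X := by
  have hb := G.isBal_counit_right
  have hq : IsBal G.ring.tR G.ring.tL fun Y Z =>
      G.ring.algL.mul Y (G.ring.t (G.epsΓ Z)) :=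
    IsBal.mk_linear (r := G.ring.tR) (l := G.ring.tL) (G.ring.tR.compl₂ G.epsΓ) (by
      intro X b n
      simp [epsΓ_t_mul'])
  let Φ : L →ₗ[k] L := blift _ hb ∘ₗ G.comulΓ hG
  have hΦ : ∀ X, Φ X = ev (G.comulΓ hG X) fun Y Z =>
      G.ring.algL.mul (G.ring.t (G.epsΓ Z)) Y := fun X => (ev_eq_blift _ _ hb).symm
  have hsurj : ∀ X, ∃ Y, Φ Y = X := by
    intro X
    obtain ⟨z, hz⟩ := (G.hopfΓ_bijective hG).2 (G.ring.dia G.ring.sL X G.ring.algL.one)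
    refine ⟨blift _ hq z, ?_⟩
    have e : blift _ hb ∘ₗ G.hopfΓ hG = Φ ∘ₗ blift _ hq := Bal.hom_ext fun Y Z => by
      rw [LinearMap.comp_apply, LinearMap.comp_apply, hopfΓ_tm, blift_tm, ev_map]
      refine Eq.trans (ev_congr _ fun Y₁ Y₂ => ?_) (Eq.trans (b := blift _ hb
        (ev (G.comulΓ hG Y) fun Y₁ Y₂ => G.ring.dia G.ring.sL Y₁
          (G.mulΓ Y₂ (H.t (G.epsΓ Z))))) (ev_map _ _ _).symm ?_)
      · rw [blift_tm, blift_tm, epsΓ_mul_t]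
      · rw [← comulΓ_mul_t]
        rfl
    have e' := LinearMap.congr_fun e z
    rw [LinearMap.comp_apply, hz, blift_tm, G.ring_one, epsΓ_one] at e'
    refine e'.symm.trans ?_
    change G.ring.algL.mul (G.ring.t G.ring.algB.one) X = X
    simp
  have hidem : ∀ X, Φ (Φ X) = Φ X := by
    intro X
    have hT : IsBal₃ G.ring.tL.flip G.ring.sL G.ring.tL.flip G.ring.sL fun X Y Z =>
        G.ring.algL.mul (G.ring.t (G.ring.algB.mul (G.epsΓ Y) (G.epsΓ Z))) X :=
      { left := fun Z => IsBal.mk_linear (r := G.ring.tL.flip) (l := G.ring.sL)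
          (G.ring.tL ∘ₗ G.ring.algB.mul.flip (G.epsΓ Z) ∘ₗ G.epsΓ).flip (by
            intro X b Y
            simp [epsΓ_s_mul'])
        right := fun X => IsBal.mk_linear (r := G.ring.tL.flip) (l := G.ring.sL)
          ((G.ring.algB.mul.compl₁₂ G.epsΓ G.epsΓ).compr₂ (G.ring.tL.flip X)) (by
            intro Y b Z
            simp [epsΓ_s_mul', epsΓ_t_mul']) }
    have h := G.coact_coassoc G.ring_sL hG hT X
    rw [hΦ X, ev_map]
    refine Eq.trans (ev_congr _ fun Y Z => ?_) (h.symm.trans (ev_congr _ fun Y Z => ?_))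
    · refine (congrArg (blift _ hb) (G.comulΓ_t_mul hG (G.epsΓ Z) Y)).trans ?_
      rw [ev_map]
      refine ev_congr _ fun Y₁ Y₂ => ?_
      rw [blift_tm, ← epsΓ_t_mul']
      rfl
    · have h2 := congrArg (fun W => G.ring.algL.mul (G.ring.t (G.epsΓ W)) Y)
        (G.comulΓ_counit_left hG Z)
      refine Eq.trans ?_ h2
      refine Eq.trans (ev_congr _ fun Y₁ Y₂ => ?_)
        (ev_map (G.comulΓ hG Z) _ (G.ring.tL.flip Y ∘ₗ G.epsΓ)).symm
      simp only [← epsΓ_s_mul']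
      rfl
  obtain ⟨Y, hY⟩ := hsurj X
  rw [← hΦ, ← hY, hidem]

/-- The cotwist `L^Γ` as a bialgebroid. -/
noncomputable abbrev cotwistBialgebroid : LeftBialgebroid k B L :=
  LeftBialgebroid.ofSweedler G.ring (G.comulΓ hG) G.epsΓ
    (fun a X => (congrArg (G.comulΓ hG) (G.s_mulΓ a X)).trans (G.coact_twL G.ring_sL hG a X))
    (G.comulΓ_t_mul hG)
    (fun a X => (G.coact_tak G.ring_sL hG a X).trans
      (ev_congr _ fun Y Z => congrArg (G.ring.dia G.ring.sL Y) (G.mulΓ_s a Z).symm))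
    (G.coact_coassoc G.ring_sL hG trip_isBal₃)
    (G.comulΓ_one hG) (G.comulΓ_mul hG) G.epsΓ_s_mul' G.epsΓ_t_mul' (G.comulΓ_counit_left hG)
    (G.comulΓ_counit_right hG) G.epsΓ_one G.epsΓ_mul_s G.epsΓ_mul_t

/-- The cotwist `L^Γ` as a left Hopf algebroid. -/
noncomputable abbrev cotwist : LeftHopfAlgebroid k B L where
  toLeftBialgebroid := G.cotwistBialgebroid hG
  hopf_bijective := by
    have : (G.cotwistBialgebroid hG).hopfMap = G.hopfΓ hG := Bal.hom_ext fun X Y => by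
      rw [hopfΓ_tm]
      exact LeftBialgebroid.hopfMap_tm _ X Y
    rw [this]
    exact G.hopfΓ_bijective hG

/-- The cotwist of a comodule. -/
noncomputable abbrev cotwistComodule (cM : H.Comodule M) : (G.cotwist hG).Comodule M :=
  Comodule.ofSweedler (H := G.cotwistBialgebroid hG) (G.twL cM) (G.twR cM) (G.twL_module cM)
    (G.twR_module cM) (G.twR_twL cM) (G.coact cM rfl hG)
    (fun a m => G.coact_twL rfl hG a m) (fun a m => G.coact_twR rfl hG a m)
    (fun a m => G.coact_tak rfl hG a m) (G.coact_coassoc rfl hG trip_isBal₃)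
    (G.coact_counit rfl hG)

end LeftBialgebroid.TwoCocycle
end Cotwist

/-! ### Comparison with the formulas on representatives -/

section IsCotwist

variable {k : Type v} [Field k] {B L : Type u} [AddCommGroup B] [Module k B]
  [AddCommGroup L] [Module k L] {M N P A R : Type u} [AddCommGroup M] [Module k M]
  [AddCommGroup N] [Module k N] [AddCommGroup P] [Module k P] [AddCommGroup A] [Module k A]
  [AddCommGroup R] [Module k R]
  {Q : Type*} [AddCommGroup Q] [Module k Q]

/-- If `x` represents `u` after applying `φ` to its second factor, then functions that are
balanced in that factor may be computed on `x`. -/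
theorem eq_of_map_id_toBal {r : M →ₗ[k] B →ₗ[k] M} {l : B →ₗ[k] N →ₗ[k] N} {φ : P →ₗ[k] Bal r l}
    {x : A ⊗[k] (M ⊗[k] N)} {u : A ⊗[k] P}
    (h : TensorProduct.map LinearMap.id (toBal r l) x = TensorProduct.map LinearMap.id φ u)
    (F : A ⊗[k] (M ⊗[k] N) →ₗ[k] Q) (hF : ∀ a, IsBal r l fun m n => F (a ⊗ₜ[k] (m ⊗ₜ[k] n)))
    (E : A ⊗[k] P →ₗ[k] Q)
    (hE : ∀ a p, E (a ⊗ₜ[k] p) = ev (φ p) fun m n => F (a ⊗ₜ[k] (m ⊗ₜ[k] n))) : F x = E u := by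
  let T : A →ₗ[k] M →ₗ[k] N →ₗ[k] Q :=
    (TensorProduct.lcurry (.id k) M N Q) ∘ₗ TensorProduct.curry F
  have hT : ∀ a m n, T a m n = F (a ⊗ₜ[k] (m ⊗ₜ[k] n)) := fun _ _ _ => rfl
  let F' : A ⊗[k] Bal r l →ₗ[k] Q := TensorProduct.lift (bliftL T fun a => (hF a).bal)
  have h1 : F' ∘ₗ TensorProduct.map LinearMap.id (toBal r l) = F := by
    refine TensorProduct.ext (LinearMap.ext fun a => TensorProduct.ext' fun m n => ?_)
    rfl
  have h2 : F' ∘ₗ TensorProduct.map LinearMap.id φ = E := by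
    refine TensorProduct.ext' fun a p => ?_
    rw [hE, ev_eq_blift _ _ (hF a)]
    rfl
  rw [← h1, ← h2, LinearMap.comp_apply, h, LinearMap.comp_apply]

/-- The mirror image of `eq_of_map_id_toBal`. -/
theorem eq_of_map_toBal_id {r : M →ₗ[k] B →ₗ[k] M} {l : B →ₗ[k] N →ₗ[k] N} {φ : P →ₗ[k] Bal r l}
    {x : (M ⊗[k] N) ⊗[k] A} {u : P ⊗[k] A}
    (h : TensorProduct.map (toBal r l) LinearMap.id x = TensorProduct.map φ LinearMap.id u)
    (F : (M ⊗[k] N) ⊗[k] A →ₗ[k] Q) (hF : ∀ a, IsBal r l fun m n => F ((m ⊗ₜ[k] n) ⊗ₜ[k] a))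
    (E : P ⊗[k] A →ₗ[k] Q)
    (hE : ∀ p a, E (p ⊗ₜ[k] a) = ev (φ p) fun m n => F ((m ⊗ₜ[k] n) ⊗ₜ[k] a)) : F x = E u := by
  have h' : TensorProduct.map LinearMap.id (toBal r l) (TensorProduct.comm k _ _ x) =
      TensorProduct.map LinearMap.id φ (TensorProduct.comm k _ _ u) := by
    rw [TensorProduct.map_comm, TensorProduct.map_comm, h]
  have := eq_of_map_id_toBal h' (F ∘ₗ (TensorProduct.comm k A (M ⊗[k] N)).toLinearMap) hF
    (E ∘ₗ (TensorProduct.comm k A P).toLinearMap) (fun a p => hE p a)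
  simpa using this

namespace LeftBialgebroid.TwoCocycle

variable {H : LeftHopfAlgebroid k B L} (G : H.TwoCocycle)

attribute [local irreducible] tw twist untwist

/-- The operator `X ↦ X₊ \overline{Γ(X₋, Y)}` from which `Γ^# : L ⋄_{B^Γ} M → L ⋄_B M` is built. -/
theorem act_cT (Y X : L) : G.act H.cT Y X =
    ev (H.plusMinus X) fun p m => H.algL.mul p (H.t (G.Γ m Y)) := by
  rw [act_apply]
  exact H.ev_cT_δ (G.isBal_act H.cT Y) X

/-- The condition on representatives that defines the twisted coaction says `Γ^# ∘ δ' = δ`. -/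
theorem isTwistedCoaction_iff {R' : EnvRing k B L} (hR : R'.tL.flip = G.twR H.cT)
    {cM : H.Comodule M} {lM : B →ₗ[k] M →ₗ[k] M} (hM : lM = G.twL cM)
    (δ' : M →ₗ[k] R'.Dia lM) : H.IsTwistedCoaction G.Γ R' cM.lact cM.δ lM δ' ↔
      ∀ m, G.twist H.cT cM hR hM (δ' m) = cM.δ m := by
  have key : ∀ (u : L ⊗[k] M) (q : L ⊗[k] (L ⊗[k] M)) (p : (L ⊗[k] L) ⊗[k] (L ⊗[k] M)),
      TensorProduct.map LinearMap.id (H.toDia cM.lact) q =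
        TensorProduct.map LinearMap.id cM.δ u →
      TensorProduct.map H.toOp LinearMap.id p = TensorProduct.map H.plusMinus LinearMap.id q →
      H.toDia cM.lact (H.sharpDia G.Γ M p) = G.twist H.cT cM hR hM (R'.toDia lM u) := by
    intro u q p hq hp
    let E : L ⊗[k] (L ⊗[k] M) →ₗ[k] H.Dia cM.lact :=
      H.toDia cM.lact ∘ₗ TensorProduct.map (TensorProduct.lift (G.act H.cT).flip) LinearMap.id ∘ₗ
        (TensorProduct.assoc k L L M).symm.toLinearMap
    have hE : ∀ X Y n, E (X ⊗ₜ[k] (Y ⊗ₜ[k] n)) = H.dia cM.lact (G.act H.cT Y X) n :=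
      fun _ _ _ => rfl
    have hF : ∀ (Y : L) (n : M), H.Bo fun p m =>
        H.dia cM.lact (H.algL.mul p (H.t (G.Γ m Y))) n := fun Y n =>
      IsBal.mk_linear (r := H.tR) (l := H.tL)
        ((H.algL.mul.compl₂ (H.t ∘ₗ G.Γ.flip Y)).compr₂ ((H.dia cM.lact).flip n)) (by
          intro p b m
          simp [G.linear])
    have h1 : (H.toDia cM.lact ∘ₗ H.sharpDia G.Γ M) p = E q := by
      have hs : ∀ p m Y n, (H.toDia cM.lact ∘ₗ H.sharpDia G.Γ M)
          ((p ⊗ₜ[k] m) ⊗ₜ[k] (Y ⊗ₜ[k] n)) = H.dia cM.lact (H.algL.mul p (H.t (G.Γ m Y))) n := by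
        intro p m Y n
        rw [LinearMap.comp_apply, LeftHopfAlgebroid.sharpDia_tmul]
        rfl
      have hB : ∀ a : L ⊗[k] M, H.Bo fun p m =>
          (H.toDia cM.lact ∘ₗ H.sharpDia G.Γ M) ((p ⊗ₜ[k] m) ⊗ₜ[k] a) := fun a =>
        IsBal.mk_linear (r := H.tR) (l := H.tL) (TensorProduct.curry
          ((TensorProduct.curry (H.toDia cM.lact ∘ₗ H.sharpDia G.Γ M)).flip a)) (by
            intro p b m
            induction a using TensorProduct.induction_on with
            | zero => simp
            | tmul Y n =>
              refine (hs _ _ _ _).trans (Eq.trans ?_ (hs _ _ _ _).symm)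
              exact (hF Y n).bal p b m
            | add x y hx hy =>
              simp only [map_add, TensorProduct.curry_apply, LinearMap.add_apply] at hx hy ⊢
              rw [hx, hy])
      refine eq_of_map_toBal_id hp _ hB E fun X a => ?_
      induction a using TensorProduct.induction_on with
      | zero => simp only [TensorProduct.tmul_zero, map_zero, ev_fun_zero]
      | tmul Y n =>
        rw [hE, act_cT, ev_map₂]
        exact ev_congr _ fun p m => (hs p m Y n).symm
      | add x y hx hy =>
        rw [TensorProduct.tmul_add, map_add, hx, hy, ← ev_add_fun]
        exact ev_congr _ fun p m => by rw [TensorProduct.tmul_add, map_add]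
    have h2 := eq_of_map_id_toBal (r := H.tL.flip) (l := cM.lact) hq E (fun X =>
      IsBal.mk_linear (r := H.tL.flip) (l := cM.lact) (H.dia cM.lact ∘ₗ (G.act H.cT).flip X) (by
        intro Y b n
        have := G.act_t_mul H.cT b Y X
        exact (congrArg (fun z => H.dia cM.lact z n) this).trans (H.dia_bal _ _ _ _)))
      (TensorProduct.lift (G.tw H.cT cM (H.dia cM.lact) (tm_bal _ _)))
      (fun X n => G.tw_apply (cM := H.cT) (cN := cM) (f := H.dia cM.lact) (tm_bal _ _) X n)
    have h3 : TensorProduct.lift (G.tw H.cT cM (H.dia cM.lact) (tm_bal _ _)) =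
        G.twist H.cT cM hR hM ∘ₗ R'.toDia lM := TensorProduct.ext' fun X n => by
      rw [TensorProduct.lift.tmul]
      exact (G.twist_tm (cM := H.cT) (cN := cM) hR hM X n).symm
    exact h1.trans (h2.trans (LinearMap.congr_fun h3 u))
  constructor
  · intro h m
    obtain ⟨u, hu⟩ := Submodule.mkQ_surjective _ (δ' m)
    obtain ⟨q, hq⟩ := TensorProduct.map_surjective (g := LinearMap.id) (g' := H.toDia cM.lact)
      Function.surjective_id (Submodule.mkQ_surjective _) (TensorProduct.map LinearMap.id cM.δ u)
    obtain ⟨p, hp⟩ := TensorProduct.map_surjective (g := H.toOp) (g' := LinearMap.id)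
      (Submodule.mkQ_surjective _) Function.surjective_id
      (TensorProduct.map H.plusMinus LinearMap.id q)
    have h' := h m u q p hu hq hp
    rwa [key u q p hq hp, show R'.toDia lM u = δ' m from hu] at h'
  · intro h m u q p hu hq hp
    rw [key u q p hq hp, hu, h]

theorem circ_eq_ev (X Y : L) :
    G.circ X Y = ev (H.plusMinus X) fun p m => H.algL.mul p (G.act H.cT m Y) := by
  rw [circ_apply, tw_apply]
  exact H.ev_cT_δ (G.isBal_tw (cN := H.cT) H.coBilin_mul_flip.bal Y) X

/-- The twisted product in terms of representatives. -/
theorem twProd_eq {X Y : L} {x y : L ⊗[k] (L ⊗[k] L)} (hx : H.RepOnePlusMinus X x)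
    (hy : H.RepOnePlusMinus Y y) : H.twProd G.Γ x y = G.mulΓ X Y := by
  obtain ⟨u, hu, hx⟩ := hx
  obtain ⟨w, hw, hy⟩ := hy
  -- Pass from representatives of `X₁ ⊗ X₂₊ ⊗ X₂₋` and `Y₁ ⊗ Y₂₊ ⊗ Y₂₋` to those of `Δ X` and `Δ Y`,
  -- one argument at a time.
  let K : L ⊗[k] L →ₗ[k] L →ₗ[k] L := TensorProduct.lift
    (((LinearMap.llcomp k L L L) ∘ₗ H.algL.mul).compl₂ (G.act H.cT))
  let E₁ : L ⊗[k] (L ⊗[k] L) →ₗ[k] L ⊗[k] L →ₗ[k] L :=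
    (TensorProduct.map₂ G.Γ K).compr₂ (TensorProduct.lift H.sL)
  have hE₁ : ∀ X₁ p m Y₁ Y₂, E₁ (X₁ ⊗ₜ[k] (p ⊗ₜ[k] m)) (Y₁ ⊗ₜ[k] Y₂) =
      H.algL.mul (H.s (G.Γ X₁ Y₁)) (H.algL.mul p (G.act H.cT m Y₂)) := by
    intro X₁ p m Y₁ Y₂
    simp [E₁, K]
  let E₂ : L ⊗[k] L →ₗ[k] L ⊗[k] L →ₗ[k] L :=
    (TensorProduct.map₂ G.Γ G.circ).compr₂ (TensorProduct.lift H.sL)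
  have hE₂ : ∀ X₁ X₂ Y₁ Y₂, E₂ (X₁ ⊗ₜ[k] X₂) (Y₁ ⊗ₜ[k] Y₂) =
      H.algL.mul (H.s (G.Γ X₁ Y₁)) (G.circ X₂ Y₂) := by
    intro X₁ X₂ Y₁ Y₂
    simp [E₂]
  have h1 : (H.twProd G.Γ).flip y = E₁.flip w := by
    refine TensorProduct.ext (LinearMap.ext fun X₁ => TensorProduct.ext' fun p m => ?_)
    refine eq_of_map_id_toBal (r := H.tR) (l := H.tL) hy
      (H.twProd G.Γ (X₁ ⊗ₜ[k] (p ⊗ₜ[k] m))) (fun Y₁ => ?_)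
      (E₁ (X₁ ⊗ₜ[k] (p ⊗ₜ[k] m))) fun Y₁ Y₂ => ?_
    · refine IsBal.mk_linear (r := H.tR) (l := H.tL)
        (TensorProduct.curry (TensorProduct.curry (H.twProd G.Γ (X₁ ⊗ₜ[k] (p ⊗ₜ[k] m))) Y₁)) ?_
      intro q b n
      simp only [TensorProduct.curry_apply, LeftHopfAlgebroid.twProd_tmul]
      simp [G.linear]
    · rw [hE₁, act_cT, ev_map, ev_map]
      refine ev_congr _ fun q n => ?_
      rw [LeftHopfAlgebroid.twProd_tmul, H.algL.mul_assoc p]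
  have h2 : E₁ x = E₂ u := by
    refine TensorProduct.ext' fun Y₁ Y₂ => ?_
    refine eq_of_map_id_toBal (r := H.tR) (l := H.tL) hx (E₁.flip (Y₁ ⊗ₜ[k] Y₂)) (fun X₁ => ?_)
      (E₂.flip (Y₁ ⊗ₜ[k] Y₂)) fun X₁ X₂ => ?_
    · refine IsBal.mk_linear (r := H.tR) (l := H.tL)
        (TensorProduct.curry (TensorProduct.curry (E₁.flip (Y₁ ⊗ₜ[k] Y₂)) X₁)) ?_
      intro p b m
      simp only [TensorProduct.curry_apply, LinearMap.flip_apply, hE₁]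
      have := G.act_t_mul H.cT b m Y₂
      rw [EnvRing.tL_apply, this]
      simp
    · simp only [LinearMap.flip_apply]
      rw [hE₂, circ_eq_ev, ev_map]
      exact ev_congr _ fun p m => (hE₁ X₁ p m Y₁ Y₂).symm
  have h3 : E₂ u w = G.mulΓ X Y := by
    rw [mulΓ_apply]
    refine Eq.symm ((G.tw_apply _ X Y).trans ?_)
    rw [reg_δ, ← hw]
    refine ev_toBal_eq (G.isBal_tw (cM := H.reg) (cN := H.reg) G.coBilin_circ.bal X) w
      (E₂ u) fun Y₁ Y₂ => ?_
    rw [act_apply, ev_map₂, reg_δ, ← hu]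
    have hb : H.Bl H.sL fun X₁ X₂ => H.algL.mul (H.s (G.Γ X₁ Y₁)) (G.circ X₂ Y₂) :=
      IsBal.mk_linear (r := H.tL.flip) (l := H.sL)
        ((H.algL.mul ∘ₗ H.s ∘ₗ G.Γ.flip Y₁).compl₂ (G.circ.flip Y₂)) (by
          intro X b n
          have := G.coBilin_circ.left b n Y₂
          simp only [EnvRing.sL_apply] at this
          simp [G.linear, this])
    refine Eq.trans (ev_toBal_eq hb u (E₂.flip (Y₁ ⊗ₜ[k] Y₂)) fun X₁ X₂ => ?_).symm
      (ev_congr _ fun X₁ X₂ => ?_)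
    · exact hE₂ X₁ X₂ Y₁ Y₂
    · exact (G.coBilin_circ.left (G.Γ X₁ Y₁) X₂ Y₂).symm
  have h1' := LinearMap.congr_fun h1 x
  simp only [LinearMap.flip_apply] at h1'
  rw [h1', h2, h3]

variable (hG : G.Invertible)

theorem isCotwist_cotwist : H.IsCotwist G (G.cotwist hG) where
  mul_B _ _ := rfl
  one_B := rfl
  mul_L X Y x y hx hy := (G.twProd_eq hx hy).symm
  one_L := rfl
  s_eq := rfl
  t_eq := rfl
  comul := (G.isTwistedCoaction_iff (R' := G.ring) G.ring_tL (cM := H.reg) G.ring_sL _).2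
    (G.twist_coact G.ring_sL hG)
  counit X p hp := by
    change G.epsΓ X = _
    rw [epsΓ_apply, ← hp]
    exact ev_toBal_eq G.bo_Γ p _ fun _ _ => rfl

theorem isCotwistComodule_cotwistComodule (cM : H.Comodule M) :
    H.IsCotwistComodule G (G.cotwist hG) cM (G.cotwistComodule hG cM) where
  lact_eq := rfl
  ract_eq := rfl
  coact := (G.isTwistedCoaction_iff (R' := G.ring) G.ring_tL rfl _).2 (G.twist_coact rfl hG)

theorem twist_δ_of_isCotwistComodule {cM : H.Comodule M} {cM' : (G.cotwist hG).Comodule M}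
    (h : H.IsCotwistComodule G (G.cotwist hG) cM cM') (m : M) :
    G.twist H.cT cM G.ring_tL h.lact_eq (cM'.δ m) = cM.δ m :=
  (G.isTwistedCoaction_iff (R' := G.ring) G.ring_tL h.lact_eq _).1 h.coact m

theorem δ_of_isCotwistComodule {cM : H.Comodule M} {cM' : (G.cotwist hG).Comodule M}
    (h : H.IsCotwistComodule G (G.cotwist hG) cM cM') (m : M) :
    cM'.δ m = G.coact cM h.lact_eq hG m :=
  (G.coact_eq h.lact_eq hG (G.twist_δ_of_isCotwistComodule hG h m)).symm

end LeftBialgebroid.TwoCocycle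
end IsCotwist

/-! ### The inverse cocycle -/

section Inverse

variable {k : Type v} [Field k] {B L : Type u} [AddCommGroup B] [Module k B]
  [AddCommGroup L] [Module k L] {M N P A R : Type u} [AddCommGroup M] [Module k M]
  [AddCommGroup N] [Module k N] [AddCommGroup P] [Module k P] [AddCommGroup A] [Module k A]
  [AddCommGroup R] [Module k R]
  {Q : Type*} [AddCommGroup Q] [Module k Q]

theorem LeftHopfAlgebroid.balSwap_plusMinus (H : LeftHopfAlgebroid k B L) (X : L) :
    balSwap H.tR H.tL (H.plusMinus X) = H.cT.δ X := by
  rw [H.cT_δ]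
  exact (ev_hom (H.plusMinus X) (balSwap H.tR H.tL).toLinearMap).symm

namespace LeftBialgebroid.TwoCocycle

variable {H : LeftHopfAlgebroid k B L} (G : H.TwoCocycle)

attribute [local irreducible] tw twist untwist

section Diamond

variable {cM : H.Comodule M} {cN : H.Comodule N} {cP : H.Comodule P}
  {lM : B →ₗ[k] M →ₗ[k] M} {lN : B →ₗ[k] N →ₗ[k] N} (hM : lM = G.twL cM) (hN : lN = G.twL cN)
  (hG : G.Invertible)

/-- Twisting `f^Γ` by `(X, Y) ↦ ε^Γ(X ∘ Y)` along the twisted coactions gives back `f`. -/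
theorem ev_coact_inverse {f : M →ₗ[k] N →ₗ[k] P} (hf : CoBilin cM cN cP f) (m : M) (n : N) :
    (ev (G.coact cN hN hG n) fun Y n' => ev (G.coact cM hM hG m) fun X m' =>
      G.twL cP (G.epsΓ (G.circ X Y)) (G.tw cM cN f hf.bal m' n')) = f m n := by
  have h := congrArg (G.evalΓ cP) (G.ev_coact_coact hM hN hG H.coBilin_mul_flip hf m n)
  refine Eq.trans ?_ (h.trans ?_)
  · rw [ev_map]
    refine ev_congr _ fun Y n' => ?_
    rw [ev_map]
    refine ev_congr _ fun X m' => ?_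
    exact (G.evalΓ_tw cP _ _).symm
  · refine (congrArg (G.evalΓ cP) (hf.colin m n).symm).trans ?_
    exact G.evalΓ_δ cP (f m n)

end Diamond

variable (hG : G.Invertible)

theorem circ_balanced (X Y : L) (b : B) :
    G.circ (G.mulΓ X (H.t b)) Y = G.circ X (G.mulΓ (H.t b) Y) := by
  rw [mulΓ_t, t_mulΓ, circ_apply, circ_apply]
  exact (G.tw_bal (cM := H.cT) (cN := H.cT) H.coBilin_mul_flip.bal Y b X).symm

theorem t_mulΓ_circ (X Y : L) (b : B) :
    G.circ (G.mulΓ (H.t b) X) Y = G.mulΓ (H.t b) (G.circ X Y) := by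
  rw [t_mulΓ, t_mulΓ, circ_apply, circ_apply]
  exact G.tw_right (cM := H.cT) (cN := H.cT) (cP := H.cT) H.coBilin_mul_flip b Y X

/-- The form `Σ(X, Y) = ε^Γ(X ∘ Y)`. -/
noncomputable def sigmaForm : L →ₗ[k] L →ₗ[k] B := G.circ.compr₂ G.epsΓ

theorem sigmaForm_apply (X Y : L) : G.sigmaForm X Y = G.epsΓ (G.circ X Y) := rfl

theorem sigmaForm_balanced (X Y : L) (b : B) :
    G.sigmaForm (G.mulΓ X (H.t b)) Y = G.sigmaForm X (G.mulΓ (H.t b) Y) := by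
  rw [sigmaForm_apply, sigmaForm_apply, circ_balanced]

theorem sigmaForm_linear (X Y : L) (b : B) :
    G.sigmaForm (G.mulΓ (H.t b) X) Y = G.ring.algB.mul (G.sigmaForm X Y) b := by
  rw [sigmaForm_apply, sigmaForm_apply, t_mulΓ_circ]
  exact G.epsΓ_t_mul b _

/-- The left twist by `Σ` of the product of the cotwist is `X ∘ Y`. The cocycle condition for `Σ`
therefore is the associativity of `∘`. -/
theorem sigma_twMul (X Y : L) (u w : L ⊗[k] L) (hu : (G.cotwist hG).toDiaL u = (G.cotwist hG).Δ X)
    (hw : (G.cotwist hG).toDiaL w = (G.cotwist hG).Δ Y) :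
    (G.cotwist hG).twMul G.sigmaForm u w = G.circ X Y := by
  have hin : ∀ Y₁ Y₂, (G.cotwist hG).Bl (G.cotwist hG).sL fun X₁ X₂ =>
      (G.cotwist hG).algL.mul ((G.cotwist hG).s (G.sigmaForm X₁ Y₁))
        ((G.cotwist hG).algL.mul X₂ Y₂) := fun Y₁ Y₂ =>
    IsBal.mk_linear (r := (G.cotwist hG).tL.flip) (l := (G.cotwist hG).sL)
      (((G.cotwist hG).algL.mul ∘ₗ (G.cotwist hG).s ∘ₗ G.sigmaForm.flip Y₁).compl₂
        ((G.cotwist hG).algL.mul.flip Y₂)) (by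
      intro X b X'
      have h : G.sigmaForm ((G.cotwist hG).algL.mul ((G.cotwist hG).t b) X) Y₁ =
        (G.cotwist hG).algB.mul (G.sigmaForm X Y₁) b := G.sigmaForm_linear X Y₁ b
      simp [h])
  have hout : ∀ X, (G.cotwist hG).Bl (G.cotwist hG).sL fun Y₁ Y₂ =>
      ev ((G.cotwist hG).Δ X) fun X₁ X₂ =>
        (G.cotwist hG).algL.mul ((G.cotwist hG).s (G.sigmaForm X₁ Y₁))
          ((G.cotwist hG).algL.mul X₂ Y₂) := fun X =>
    (G.cotwist hG).reg.isBal_double (T := fun X₁ X₂ Y₁ Y₂ =>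
        (G.cotwist hG).algL.mul ((G.cotwist hG).s (G.sigmaForm X₁ Y₁))
          ((G.cotwist hG).algL.mul X₂ Y₂)) hin
      (fun X₁ X₂ => ⟨((G.cotwist hG).algL.mul ∘ₗ (G.cotwist hG).s ∘ₗ G.sigmaForm X₁).compl₂
        ((G.cotwist hG).algL.mul X₂), fun _ _ => rfl⟩)
      (fun X₁ X₂ Y₁ Y₂ b => by
        have h : G.sigmaForm ((G.cotwist hG).algL.mul X₁ ((G.cotwist hG).t b)) Y₁ =
          G.sigmaForm X₁ ((G.cotwist hG).algL.mul ((G.cotwist hG).t b) Y₁) :=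
          G.sigmaForm_balanced X₁ Y₁ b
        rw [h])
      (fun X₁ X₂ Y₁ Y₂ b => by simp) X
  have h := G.ev_coact_inverse (cM := H.reg) (cN := H.reg) G.ring_sL G.ring_sL hG G.coBilin_circ X Y
  refine Eq.trans ?_ h
  refine Eq.trans (b := ev ((G.cotwist hG).Δ Y) fun Y₁ Y₂ => ev ((G.cotwist hG).Δ X) fun X₁ X₂ =>
        (G.cotwist hG).algL.mul ((G.cotwist hG).s (G.sigmaForm X₁ Y₁))
          ((G.cotwist hG).algL.mul X₂ Y₂)) ?_ ?_
  · rw [← hw]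
    refine Eq.symm (ev_toBal_eq (hout X) w ((G.cotwist hG).twMul G.sigmaForm u)
      fun Y₁ Y₂ => ?_)
    rw [← hu]
    exact Eq.symm (ev_toBal_eq (hin Y₁ Y₂) u
      (((G.cotwist hG).twMul G.sigmaForm).flip (Y₁ ⊗ₜ[k] Y₂)) fun X₁ X₂ => by simp)
  · refine ev_congr _ fun Y₁ Y₂ => ev_congr _ fun X₁ X₂ => ?_
    exact G.s_mulΓ _ _

/-- The inverse cocycle `Σ(X, Y) = Γ(X₊ Y₊, Γ(Y₋₁, X₋₁) Y₋₂ X₋₂)` on the cotwist, written as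
`ε^Γ(X ∘ Y)`. -/
noncomputable def sigma : (G.cotwist hG).TwoCocycle where
  Γ := G.sigmaForm
  balanced := G.sigmaForm_balanced
  linear := G.sigmaForm_linear
  cocycle X Y Z u w z hu hw hz := by
    rw [G.sigma_twMul hG Y Z w z hw hz, G.sigma_twMul hG X Y u w hu hw, sigmaForm_apply,
      sigmaForm_apply, circ_assoc]
  one_left X := by
    change G.epsΓ (G.circ H.algL.one X) = G.epsΓ X
    have := G.s_circ H.algB.one X
    rw [H.s_one, H.algL.one_mul] at this
    rw [this]
  one_right X := by
    change G.epsΓ (G.circ X H.algL.one) = G.epsΓ X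
    have := G.circ_s H.algB.one X
    rw [H.s_one, H.algL.mul_one] at this
    rw [this]

theorem sigma_Γ (X Y : L) : (G.sigma hG).Γ X Y = G.epsΓ (G.circ X Y) := rfl

section Cot

variable {G hG} {cM : H.Comodule M} {cN : H.Comodule N} {cP : H.Comodule P}
  {cM' : (G.cotwist hG).Comodule M} {cN' : (G.cotwist hG).Comodule N}

theorem isCotwistComodule_mk (hl : cM'.lact = G.twL cM) (hr : cM'.ract = G.twR cM)
    (hδ : ∀ m, G.twist H.cT cM G.ring_tL hl (cM'.δ m) = cM.δ m) :
    H.IsCotwistComodule G (G.cotwist hG) cM cM' where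
  lact_eq := hl
  ract_eq := hr
  coact := (G.isTwistedCoaction_iff (R' := G.ring) G.ring_tL hl _).2 hδ

theorem isCotwistComodule_reg :
    H.IsCotwistComodule G (G.cotwist hG) H.reg (G.cotwist hG).reg :=
  isCotwistComodule_mk G.ring_sL G.ring_sR (G.twist_coact G.ring_sL hG)

theorem isCotwistComodule_base :
    H.IsCotwistComodule G (G.cotwist hG) H.base (G.cotwist hG).base := by
  have hl : (G.cotwist hG).algB.mul = G.twL H.base := by
    ext a b
    exact (G.twL_base a b).symm
  refine isCotwistComodule_mk hl ?_ fun b => ?_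
  · ext a b
    exact (G.act_base (H.s b) a).symm.trans (G.act_s H.base b a)
  · refine (G.twist_tm (cM := H.cT) (cN := H.base) G.ring_tL hl _ _).trans ?_
    exact G.tw_coinv_left _ (H.coinv_cT_s b) _

/-- The translation map of the cotwist is the twisted coaction `(Γ^#)⁻¹(X₋ ⊗ X₊)`. -/
theorem balSwap_plusMinus (X : L) : balSwap G.ring.tR G.ring.tL ((G.cotwist hG).plusMinus X) =
    G.coact H.cT G.ring_tR hG X := by
  have h : (G.cotwist hG).plusMinus X =
      (balSwap G.ring.tR G.ring.tL).symm (G.coact H.cT G.ring_tR hG X) := by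
    refine (G.cotwist hG).plusMinus_eq ?_
    have : (G.cotwist hG).hopfMap = G.hopfΓ hG := Bal.hom_ext fun X Y => by
      rw [hopfΓ_tm]
      exact LeftBialgebroid.hopfMap_tm _ X Y
    rw [this]
    apply G.twist_injective (cM := H.cT) (cN := H.reg) G.ring_tL G.ring_sL hG
    rw [twist_hopfΓ, LinearEquiv.apply_symm_apply, twist_coact]
    refine Eq.trans ?_ (G.twist_tm (cM := H.cT) (cN := H.reg) G.ring_tL G.ring_sL _ _).symm
    refine Eq.trans ?_ (G.tw_coinv_right (cM := H.cT) (cN := H.reg) _ _ H.coinv_reg_one).symm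
    refine Eq.trans ?_ (H.hopfMap_plusMinus X)
    refine congrArg H.hopfMap ?_
    rw [← H.balSwap_plusMinus, LinearEquiv.symm_apply_apply]
  rw [h, LinearEquiv.apply_symm_apply]

/-- The comodule structure `X ↦ X₋ ⋄ X₊` of the cotwist is the cotwist of that of `L`. -/
theorem isCotwistComodule_cT :
    H.IsCotwistComodule G (G.cotwist hG) H.cT (G.cotwist hG).cT := by
  refine isCotwistComodule_mk G.ring_tR G.ring_tL fun X => ?_
  have h : (G.cotwist hG).cT.δ X = G.coact H.cT G.ring_tR hG X := by
    rw [← balSwap_plusMinus]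
    exact ((G.cotwist hG).balSwap_plusMinus X).symm
  rw [h]
  exact G.twist_coact (cM := H.cT) G.ring_tR hG X

/-- Twisting by `Σ` undoes twisting by `Γ`. -/
theorem sigma_tw (hM : H.IsCotwistComodule G (G.cotwist hG) cM cM')
    (hN : H.IsCotwistComodule G (G.cotwist hG) cN cN') {f : M →ₗ[k] N →ₗ[k] P}
    (hf : CoBilin cM cN cP f)
    (hf' : ∀ m b n, G.tw cM cN f hf.bal (cM'.ract m b) n = G.tw cM cN f hf.bal m (cN'.lact b n))
    (m : M) (n : N) : (G.sigma hG).tw cM' cN' (G.tw cM cN f hf.bal) hf' m n = f m n := by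
  rw [tw_apply, G.δ_of_isCotwistComodule hG hN]
  refine Eq.trans (ev_congr _ fun Y n' => ?_) (G.ev_coact_inverse hM.lact_eq hN.lact_eq hG hf m n)
  rw [act_apply, G.δ_of_isCotwistComodule hG hM, ev_map₂]
  refine ev_congr _ fun X m' => ?_
  rw [hM.lact_eq]
  exact G.tw_left hf _ m' n'

variable (hM : H.IsCotwistComodule G (G.cotwist hG) cM cM')
  (hN : H.IsCotwistComodule G (G.cotwist hG) cN cN')

include hM in
/-- Twisting the actions twice gives back the original ones. -/
theorem sigma_twL : (G.sigma hG).twL cM' = cM.lact := by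
  ext b m
  have e : ∀ b n, G.tw H.base cM cM.lact cM.coBilin_lact.bal b n = cM'.lact b n := fun b n => by
    rw [tw_lact, hM.lact_eq]
  have h := (G.sigma hG).tw_lact cM' b m
  refine h.symm.trans ?_
  have e' : cM'.lact = G.tw H.base cM cM.lact cM.coBilin_lact.bal := by
    ext b n; exact (e b n).symm
  refine Eq.trans ?_ (sigma_tw isCotwistComodule_base hM cM.coBilin_lact (by
    intro a b n
    simp only [e]
    exact cM'.coBilin_lact.bal a b n) b m)
  rw [tw_apply, tw_apply]
  exact ev_congr _ fun Y n => (e _ n).symm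

include hM in
theorem sigma_twR : (G.sigma hG).twR cM' = cM.ract := by
  ext m b
  have e : ∀ n b, G.tw cM H.base cM.ract cM.coBilin_ract.bal n b = cM'.ract n b := fun n b => by
    rw [tw_ract, hM.ract_eq]
  refine ((G.sigma hG).tw_ract cM' m b).symm.trans ?_
  refine Eq.trans ?_ (sigma_tw hM isCotwistComodule_base cM.coBilin_ract (by
    intro a b n
    simp only [e]
    exact cM'.coBilin_ract.bal a b n) m b)
  rw [tw_apply, tw_apply]
  exact ev_congr _ fun Y n => (e _ n).symm

/-- `Γ^# ∘ Σ^# = id`. -/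
theorem twist_sigma_twist (z : Bal cM.ract cN.lact) :
    G.twist cM cN hM.ract_eq hN.lact_eq
      ((G.sigma hG).twist cM' cN' (sigma_twR hM).symm (sigma_twL hN).symm z) = z := by
  revert z
  refine LinearMap.ext_iff.1 (Bal.hom_ext
    (f := G.twist cM cN hM.ract_eq hN.lact_eq ∘ₗ
      (G.sigma hG).twist cM' cN' (sigma_twR hM).symm (sigma_twL hN).symm)
    (g := LinearMap.id) fun m n => ?_)
  rw [LinearMap.comp_apply, twist_tm, LinearMap.id_apply]
  have h := sigma_tw hM hN (cM.coBilin_tm cN) (fun m b n => by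
    rw [hM.ract_eq, hN.lact_eq, tw_bal]) m n
  refine Eq.trans ?_ h
  rw [tw_apply, tw_apply, ev_map]
  exact ev_congr _ fun Y n => G.twist_tm hM.ract_eq hN.lact_eq _ _

theorem sigma_twist_twist (z : Bal cM'.ract cN'.lact) :
    (G.sigma hG).twist cM' cN' (sigma_twR hM).symm (sigma_twL hN).symm
      (G.twist cM cN hM.ract_eq hN.lact_eq z) = z := by
  apply G.twist_injective hM.ract_eq hN.lact_eq hG
  exact twist_sigma_twist hM hN _

theorem sigma_twist_bijective : Function.Bijective
    ((G.sigma hG).twist cM' cN' (sigma_twR hM).symm (sigma_twL hN).symm) :=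
  Function.bijective_iff_has_inverse.2 ⟨G.twist cM cN hM.ract_eq hN.lact_eq,
    twist_sigma_twist hM hN, sigma_twist_twist hM hN⟩

end Cot

end LeftBialgebroid.TwoCocycle
end Inverse

/-! ### Cotwisting back -/

section Inverse

variable {k : Type v} [Field k] {B L : Type u} [AddCommGroup B] [Module k B]
  [AddCommGroup L] [Module k L] {M N P A R : Type u} [AddCommGroup M] [Module k M]
  [AddCommGroup N] [Module k N] [AddCommGroup P] [Module k P] [AddCommGroup A] [Module k A]
  [AddCommGroup R] [Module k R]
  {Q : Type*} [AddCommGroup Q] [Module k Q]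

namespace LeftBialgebroid.TwoCocycle

variable {H : LeftHopfAlgebroid k B L} (G : H.TwoCocycle)

attribute [local irreducible] tw twist untwist

theorem sharp_bijective_of_twist {H : LeftBialgebroid k B L} {G : H.TwoCocycle}
    {cM : H.Comodule M} {cN : H.Comodule N} {r' : M →ₗ[k] B →ₗ[k] M} {l' : B →ₗ[k] N →ₗ[k] N}
    (hr : r' = G.twR cM) (hl : l' = G.twL cN) (h : Function.Bijective (G.twist cM cN hr hl)) :
    Function.Bijective (G.sharp cM cN) := by
  subst hr hl
  have : G.twist cM cN rfl rfl = G.sharp cM cN := Bal.hom_ext fun m n => by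
    rw [twist_tm, sharp_tm]
  rwa [← this]

section Cot

variable {G} {hG : G.Invertible} {cM : H.Comodule M} {cN : H.Comodule N} {cP : H.Comodule P}
  {cM' : (G.cotwist hG).Comodule M} {cN' : (G.cotwist hG).Comodule N}
  (hM : H.IsCotwistComodule G (G.cotwist hG) cM cM')
  (hN : H.IsCotwistComodule G (G.cotwist hG) cN cN')

include hM hN in
theorem sigma_sharp_toBal (y : M ⊗[k] N) :
    (G.sigma hG).sharp cM' cN' (toBal _ _ y) =
      (G.sigma hG).twist cM' cN' (sigma_twR hM).symm (sigma_twL hN).symm (toBal _ _ y) := by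
  have h : (G.sigma hG).sharp cM' cN' ∘ₗ toBal _ _ =
      (G.sigma hG).twist cM' cN' (sigma_twR hM).symm (sigma_twL hN).symm ∘ₗ toBal _ _ :=
    TensorProduct.ext' fun m n => ((G.sigma hG).sharp_tm m n).trans
      ((G.sigma hG).twist_tm (sigma_twR hM).symm (sigma_twL hN).symm m n).symm
  exact LinearMap.congr_fun h y

theorem sharp_toBal (hr : cM'.ract = G.twR cM) (hl : cN'.lact = G.twL cN) (x : M ⊗[k] N) :
    G.sharp cM cN (toBal _ _ x) = G.twist cM cN hr hl (toBal _ _ x) := by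
  have h : G.sharp cM cN ∘ₗ toBal _ _ = G.twist cM cN hr hl ∘ₗ toBal _ _ :=
    TensorProduct.ext' fun m n => (G.sharp_tm m n).trans (G.twist_tm hr hl m n).symm
  exact LinearMap.congr_fun h x

include hM hN in
/-- `Γ^#` and `Σ^#` are mutually inverse. The target of each is the source of the other only up to
an equality of actions, hence the formulation with representatives. -/
theorem sharp_eq_iff (x y : M ⊗[k] N) :
    G.sharp cM cN (toBal (G.twR cM) (G.twL cN) x) = toBal cM.ract cN.lact y ↔
      (G.sigma hG).sharp cM' cN'
        (toBal ((G.sigma hG).twR cM') ((G.sigma hG).twL cN') y) = toBal cM'.ract cN'.lact x := by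
  rw [sigma_sharp_toBal hM hN, sharp_toBal hM.ract_eq hN.lact_eq]
  constructor
  · intro h
    rw [← h, sigma_twist_twist hM hN]
  · intro h
    rw [← h, twist_sigma_twist hM hN]

include hM hN in
theorem sigma_sharp_bijective : Function.Bijective ((G.sigma hG).sharp cM' cN') :=
  sharp_bijective_of_twist (sigma_twR hM).symm (sigma_twL hN).symm
    (sigma_twist_bijective hM hN)

/-- The product `•` of the cotwist formed with `Σ` is the product `∘` of `L` formed with `Γ`. -/
theorem sigma_bul (X Y : L) : (G.sigma hG).bul X Y = G.circ X Y := by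
  obtain ⟨u, hu⟩ := Submodule.mkQ_surjective _ ((G.cotwist hG).Δ X)
  obtain ⟨w, hw⟩ := Submodule.mkQ_surjective _ ((G.cotwist hG).Δ Y)
  exact ((G.sigma hG).bul_eq_twMul X Y u w hu hw).trans (G.sigma_twMul hG X Y u w hu hw)

/-- Cotwisting the product of the cotwist by `Σ` gives back the product of `L`. -/
theorem sigma_mulΓ (X Y : L) : (G.sigma hG).mulΓ X Y = H.algL.mul X Y := by
  rw [mulΓ_eq]
  have e : ∀ Y X, (G.sigma hG).bul.flip Y X =
      G.tw H.cT H.cT H.algL.mul.flip H.coBilin_mul_flip.bal Y X := fun Y X => sigma_bul X Y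
  refine Eq.trans ?_ (sigma_tw (hG := hG) isCotwistComodule_cT isCotwistComodule_cT
    H.coBilin_mul_flip (by
    intro a b n
    simp only [← e]
    exact (G.sigma hG).coBilin_bul_flip.bal a b n) Y X)
  rw [tw_apply, tw_apply]
  exact ev_congr _ fun _ _ => e _ _

end Cot

variable (hG : G.Invertible)

theorem isCotwist_sigma : (G.cotwist hG).IsCotwist (G.sigma hG) H where
  mul_B a b := by
    change H.algB.mul a b = G.epsΓ (G.circ (H.s a) (H.s b))
    rw [s_circ, ← H.s_mul, epsΓ_s]
  one_B := rfl
  mul_L X Y x y hx hy := by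
    rw [(G.sigma hG).twProd_eq hx hy, sigma_mulΓ]
  one_L := rfl
  s_eq := rfl
  t_eq := rfl
  comul := by
    refine ((G.sigma hG).isTwistedCoaction_iff (R' := H.toEnvRing)
      (sigma_twR isCotwistComodule_cT).symm (cM := (G.cotwist hG).reg)
      (sigma_twL isCotwistComodule_reg).symm _).2 fun X => ?_
    have h := G.twist_coact (cM := H.reg) G.ring_sL hG X
    have h' := sigma_twist_twist (hG := hG) isCotwistComodule_cT isCotwistComodule_reg
      (G.coact H.reg G.ring_sL hG X)
    refine Eq.trans ?_ h'
    exact congrArg _ h.symm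
  counit X p hp := by
    have h1 : TensorProduct.lift (G.sigma hG).Γ p =
        ev ((G.cotwist hG).plusMinus X) fun p m => (G.sigma hG).Γ p m := by
      rw [← hp]
      exact (ev_toBal_eq (G.sigma hG).bo_Γ p _ fun _ _ => rfl).symm
    rw [h1, ← (G.cotwist hG).ev_cT_δ (G.sigma hG).bl_Γ,
      G.δ_of_isCotwistComodule hG isCotwistComodule_cT]
    have h2 := G.ev_coact_tw (cM := H.cT) G.ring_tR hG H.coBilin_mul_flip.bal X
    have h3 := congrArg G.epsΓ (h2.trans (H.ev_cT_δ
      (IsBal.mk_linear (r := H.tL.flip) (l := H.tR.flip) H.algL.mul.flip (by simp)) X))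
    rw [ev_map] at h3
    refine Eq.trans ?_ h3.symm
    refine Eq.trans ?_ (congrArg G.epsΓ (H.ev_plusMinus_mul_self X)).symm
    rw [epsΓ_s]

/-- `Σ(X, Y) = ε^Γ(X ∘ Y)` agrees with `inverseForm`, on all representatives. -/
theorem sigma_eq_inverseForm {X Y : L} {x y : L ⊗[k] (L ⊗[k] L)} (hx : H.RepPlusMinusDelta X x)
    (hy : H.RepPlusMinusDelta Y y) : (G.sigma hG).Γ X Y = H.inverseForm G.Γ x y := by
  obtain ⟨p, hp, hx⟩ := hx
  obtain ⟨q, hq, hy⟩ := hy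
  -- Pass from representatives of `X₊ ⊗ Δ X₋` and `Y₊ ⊗ Δ Y₋` to those of `X₊ ⊗ X₋` and `Y₊ ⊗ Y₋`,
  -- one argument at a time.
  let K : L ⊗[k] L →ₗ[k] L →ₗ[k] L := TensorProduct.lift
    (((LinearMap.llcomp k L L L) ∘ₗ H.algL.mul.flip).flip.compl₁₂ (G.act H.reg) LinearMap.id)
  have hK : ∀ X₁ X₂ Y, K (X₁ ⊗ₜ[k] X₂) Y = H.algL.mul (G.act H.reg X₁ Y) X₂ := by
    intro X₁ X₂ Y
    simp [K]
  let E₁ : L ⊗[k] (L ⊗[k] L) →ₗ[k] L ⊗[k] L →ₗ[k] B :=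
    (TensorProduct.map₂ H.algL.mul K).compr₂ (TensorProduct.lift G.Γ)
  have hE₁ : ∀ Xp X₁ X₂ Yp Ym, E₁ (Xp ⊗ₜ[k] (X₁ ⊗ₜ[k] X₂)) (Yp ⊗ₜ[k] Ym) =
      G.Γ (H.algL.mul Xp Yp) (H.algL.mul (G.act H.reg X₁ Ym) X₂) := by
    intro Xp X₁ X₂ Yp Ym
    simp [E₁, hK]
  let E₂ : L ⊗[k] L →ₗ[k] L ⊗[k] L →ₗ[k] B :=
    (TensorProduct.map₂ H.algL.mul G.bul.flip).compr₂ (TensorProduct.lift G.Γ)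
  have hE₂ : ∀ Xp Xm Yp Ym, E₂ (Xp ⊗ₜ[k] Xm) (Yp ⊗ₜ[k] Ym) =
      G.Γ (H.algL.mul Xp Yp) (G.bul Ym Xm) := by
    intro Xp Xm Yp Ym
    simp [E₂]
  have h1 : (H.inverseForm G.Γ).flip y = E₁.flip q := by
    refine TensorProduct.ext (LinearMap.ext fun Xp => TensorProduct.ext' fun X₁ X₂ => ?_)
    refine eq_of_map_id_toBal (r := H.tL.flip) (l := H.sL) hy
      (H.inverseForm G.Γ (Xp ⊗ₜ[k] (X₁ ⊗ₜ[k] X₂))) (fun Yp => ?_)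
      (E₁ (Xp ⊗ₜ[k] (X₁ ⊗ₜ[k] X₂))) fun Yp Ym => ?_
    · refine IsBal.mk_linear (r := H.tL.flip) (l := H.sL)
        (TensorProduct.curry (TensorProduct.curry (H.inverseForm G.Γ
          (Xp ⊗ₜ[k] (X₁ ⊗ₜ[k] X₂))) Yp)) ?_
      intro Y₁ b Y₂
      simp only [TensorProduct.curry_apply, LeftHopfAlgebroid.inverseForm_tmul]
      simp [G.linear]
    · rw [hE₁, act_apply, ev_map₂, ev_map]
      refine ev_congr _ fun Y₁ Y₂ => ?_
      rw [LeftHopfAlgebroid.inverseForm_tmul]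
      simp
  have h2 : E₁ x = E₂ p := by
    refine TensorProduct.ext' fun Yp Ym => ?_
    refine eq_of_map_id_toBal (r := H.tL.flip) (l := H.sL) hx (E₁.flip (Yp ⊗ₜ[k] Ym))
      (fun Xp => ?_) (E₂.flip (Yp ⊗ₜ[k] Ym)) fun Xp Xm => ?_
    · refine IsBal.mk_linear (r := H.tL.flip) (l := H.sL)
        (TensorProduct.curry (TensorProduct.curry (E₁.flip (Yp ⊗ₜ[k] Ym)) Xp)) ?_
      intro X₁ b X₂
      simp only [TensorProduct.curry_apply, LinearMap.flip_apply, hE₁]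
      have := G.act_t_mul H.reg b X₁ Ym
      rw [EnvRing.tL_apply, this]
      simp
    · simp only [LinearMap.flip_apply]
      rw [hE₂, bul, tw_apply, ev_map]
      exact ev_congr _ fun X₁ X₂ => (hE₁ Xp X₁ X₂ Yp Ym).symm
  have h3 : E₂ p q = (G.sigma hG).Γ X Y := by
    rw [sigma_Γ, epsΓ_eq, circ_apply]
    refine Eq.symm ((G.ev_δ_tw (cM := H.cT) (cN := H.cT) H.coBilin_mul_flip G.bl_Γ Y X).trans ?_)
    have hin : ∀ Xm Xp, H.Bl H.tR.flip fun Ym Yp => G.Γ (H.algL.mul Xp Yp) (G.bul Ym Xm) :=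
      fun Xm Xp => IsBal.mk_linear (r := H.tL.flip) (l := H.tR.flip)
        (G.Γ.compl₁₂ (H.algL.mul Xp) (G.bul.flip Xm)).flip (by
          intro Ym b Yp
          have := G.isDiagonal_bul.t_left b Ym Xm
          simp [this, ← G.balanced])
    have hout : H.Bl H.tR.flip fun Xm Xp => ev (H.cT.δ Y) fun Ym Yp =>
        G.Γ (H.algL.mul Xp Yp) (G.bul Ym Xm) :=
      H.cT.isBal_double (T := fun Ym Yp Xm Xp => G.Γ (H.algL.mul Xp Yp) (G.bul Ym Xm)) hin
        (fun Ym Yp => ⟨(G.Γ.compl₁₂ (H.algL.mul.flip Yp) (G.bul Ym)).flip, fun _ _ => rfl⟩)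
        (fun Ym Yp Xm Xp b => by rw [G.isDiagonal_bul.t_mid]) (fun Ym Yp Xm Xp b => by simp) Y
    refine (H.ev_cT_δ hout X).trans ?_
    rw [← hp]
    refine ev_toBal_eq (H.bo_of_bl hout) p (E₂.flip q) fun Xp Xm => ?_
    refine Eq.trans ?_ (H.ev_cT_δ (hin Xm Xp) Y).symm
    rw [← hq]
    exact (ev_toBal_eq (H.bo_of_bl (hin Xm Xp)) q (E₂ (Xp ⊗ₜ[k] Xm))
      fun Yp Ym => hE₂ Xp Xm Yp Ym).symm
  have h1' := LinearMap.congr_fun h1 x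
  simp only [LinearMap.flip_apply] at h1'
  rw [h1', h2, h3]

end LeftBialgebroid.TwoCocycle
end Inverse

/-! ### Kernels of comodule morphisms -/

section Kernel

variable {k : Type v} [Field k] {B L : Type u} [AddCommGroup B] [Module k B]
  [AddCommGroup L] [Module k L] {M N P A R : Type u} [AddCommGroup M] [Module k M]
  [AddCommGroup N] [Module k N] [AddCommGroup P] [Module k P] [AddCommGroup A] [Module k A]
  [AddCommGroup R] [Module k R]
  {Q : Type*} [AddCommGroup Q] [Module k Q]

theorem exists_lift_of_injective {ι : M →ₗ[k] P} (hι : Function.Injective ι) (φ : A →ₗ[k] P)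
    (h : ∀ a, φ a ∈ LinearMap.range ι) : ∃ ψ : A →ₗ[k] M, ∀ a, ι (ψ a) = φ a := by
  refine ⟨(LinearEquiv.ofInjective ι hι).symm.toLinearMap ∘ₗ φ.codRestrict _ h, fun a => ?_⟩
  have := (LinearEquiv.ofInjective ι hι).apply_symm_apply (φ.codRestrict _ h a)
  exact congrArg Subtype.val this

theorem exists_lift₂_of_injective {ι : M →ₗ[k] P} (hι : Function.Injective ι)
    (φ : A →ₗ[k] N →ₗ[k] P) (h : ∀ a n, φ a n ∈ LinearMap.range ι) :
    ∃ ψ : A →ₗ[k] N →ₗ[k] M, ∀ a n, ι (ψ a n) = φ a n := by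
  obtain ⟨ψ, hψ⟩ := exists_lift_of_injective hι (TensorProduct.lift φ) fun z => by
    induction z using TensorProduct.induction_on with
    | zero => simp
    | tmul a n => simpa using h a n
    | add x y hx hy => rw [map_add]; exact add_mem hx hy
  exact ⟨TensorProduct.curry ψ, fun a n => hψ (a ⊗ₜ n)⟩

section BalMap

variable {r : A →ₗ[k] B →ₗ[k] A} {l : B →ₗ[k] N →ₗ[k] N} {l' : B →ₗ[k] P →ₗ[k] P}
  {g : N →ₗ[k] P} (hg : ∀ b x, g (l b x) = l' b (g x))

/-- The map `id ⊗_B g`. -/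
abbrev idMap (r : A →ₗ[k] B →ₗ[k] A) (hg : ∀ b x, g (l b x) = l' b (g x)) :
    Bal r l →ₗ[k] Bal r l' :=
  balMap r r l l' LinearMap.id (fun _ _ => rfl) g hg

theorem idMap_tm (a : A) (n : N) : idMap r hg (tm r l a n) = tm r l' a (g n) := rfl

theorem ev_idMap {F : A → P → Q} (hF : IsBal r l' F) (z : Bal r l) :
    ev (idMap r hg z) F = ev z fun a n => F a (g n) := by
  rw [← ev_hom z (idMap r hg), ev_ev hF]
  exact ev_congr z fun a n => ev_tm hF _ _

/-- The functor `A ⊗_B -` is exact if it preserves injective maps. -/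
theorem idMap_exact {BB : AlgebraOn k B} (hflat : IsFaithfullyFlatRight BB r)
    {l'' : B →ₗ[k] R →ₗ[k] R} (hl' : IsLeftModule BB l') (hl'' : IsLeftModule BB l'')
    {h : P →ₗ[k] R} (hh : ∀ b x, h (l' b x) = l'' b (h x))
    (hker : ∀ p, h p = 0 → p ∈ LinearMap.range g) (hg0 : ∀ n, h (g n) = 0) {z : Bal r l'}
    (hz : idMap r hh z = 0) : z ∈ LinearMap.range (idMap r hg) := by
  let K := LinearMap.range g
  have hK : ∀ b p, p ∈ K → l' b p ∈ K := by
    rintro b _ ⟨n, rfl⟩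
    exact ⟨l b n, hg b n⟩
  let lV : B →ₗ[k] (P ⧸ K) →ₗ[k] (P ⧸ K) :=
    (K.liftQ (l'.compr₂ K.mkQ).flip (fun p hp => by
      ext b
      exact (Submodule.Quotient.mk_eq_zero K).2 (hK b p hp))).flip
  have hlV : ∀ b p, lV b (K.mkQ p) = K.mkQ (l' b p) := fun _ _ => rfl
  have hmod : IsLeftModule BB lV := by
    constructor
    · intro x
      obtain ⟨p, rfl⟩ := K.mkQ_surjective x
      rw [hlV, hl'.one_act]
    · intro a b x
      obtain ⟨p, rfl⟩ := K.mkQ_surjective x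
      rw [hlV, hl'.mul_act]
      rfl
  have hle : K ≤ LinearMap.ker h := by
    rintro _ ⟨n, rfl⟩
    exact hg0 n
  let hbar : (P ⧸ K) →ₗ[k] R := K.liftQ h hle
  have hbar_inj : Function.Injective hbar := by
    rw [← LinearMap.ker_eq_bot]
    refine Submodule.ker_liftQ_eq_bot _ _ _ fun p hp => hker p hp
  have hbar_lin : ∀ b x, hbar (lV b x) = l'' b (hbar x) := by
    intro b x
    obtain ⟨p, rfl⟩ := K.mkQ_surjective x
    exact hh b p
  have h1 := hflat.1 _ _ lV l'' hmod hl'' hbar hbar_lin hbar_inj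
  have hq : ∀ b p, K.mkQ (l' b p) = lV b (K.mkQ p) := fun _ _ => rfl
  have h2 : idMap r hq z = 0 := by
    apply h1
    rw [map_zero, ← hz]
    exact LinearMap.congr_fun (Bal.hom_ext (f := idMap r hbar_lin ∘ₗ idMap r hq)
      (g := idMap r hh) fun _ _ => rfl) z
  let T : A →ₗ[k] (P ⧸ K) →ₗ[k] (Bal r l' ⧸ LinearMap.range (idMap r hg)) :=
    (K.liftQ ((tm r l').compr₂ (LinearMap.range (idMap r hg)).mkQ).flip (fun p hp => by
      obtain ⟨n, rfl⟩ := hp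
      ext a
      exact (Submodule.Quotient.mk_eq_zero _).2 ⟨tm r l a n, rfl⟩)).flip
  have hT : IsBal r lV fun a x => T a x := IsBal.mk_linear T (by
    intro a b x
    obtain ⟨p, rfl⟩ := K.mkQ_surjective x
    exact congrArg (LinearMap.range (idMap r hg)).mkQ (tm_bal r l' a b p))
  have h3 : (LinearMap.range (idMap r hg)).mkQ z = 0 := by
    have := LinearMap.congr_fun (Bal.hom_ext (f := blift _ hT ∘ₗ idMap r hq)
      (g := (LinearMap.range (idMap r hg)).mkQ) fun _ _ => rfl) z
    rw [← this, LinearMap.comp_apply, h2, map_zero]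
  exact (Submodule.Quotient.mk_eq_zero _).1 h3

end BalMap

namespace LeftBialgebroid

/-- A left linear and colinear map is right linear, since `m b = ε(m₋₁ b) m₀`. -/
theorem CoHom.right {H : LeftBialgebroid k B L} {cM : H.Comodule M} {cN : H.Comodule N}
    {φ : M →ₗ[k] N} (h : CoHom cM cN φ) (m : M) (b : B) :
    φ (cM.ract m b) = cN.ract (φ m) b := by
  have key : ∀ {V : Type u} [AddCommGroup V] [Module k V] (cV : H.Comodule V) (v : V),
      cV.ract v b = HopfCotwist.ev (cV.δ v) fun X n => cV.lact (H.ε (H.algL.mul X (H.s b))) n := by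
    intro V _ _ cV v
    rw [← cV.ev_δ_ract cV.isBal_counit]
    exact (cV.counit_ev _).symm
  have hb : H.Bl cN.lact fun X n => cN.lact (H.ε (H.algL.mul X (H.s b))) n :=
    IsBal.mk_linear (cN.lact ∘ₗ H.ε ∘ₗ H.algL.mul.flip (H.s b)) (by
      intro X c n
      simp [H.ε_t_mul])
  rw [key cM, key cN, h.ev hb, ev_map]
  exact ev_congr _ fun X n => h.left _ _

theorem CoHom.sub {H : LeftBialgebroid k B L} {cM : H.Comodule M} {cN : H.Comodule N}
    {φ ψ : M →ₗ[k] N} (h : CoHom cM cN φ) (h' : CoHom cM cN ψ) : CoHom cM cN (φ - ψ) where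
  left b m := by simp [h.left, h'.left]
  colin m := by
    simp only [LinearMap.sub_apply, map_sub, h.colin, h'.colin, ev_sub_fun]

/-- The kernel of a morphism of comodules is a comodule if `L ⋄ -` preserves injective maps. -/
theorem exists_comodule_of_kernel {H : LeftHopfAlgebroid k B L}
    (hflat : IsFaithfullyFlatRight H.algB H.tL.flip) {cP : H.Comodule P} {cN : H.Comodule N}
    {h : P →ₗ[k] N} (hh : CoHom cP cN h) {ι : M →ₗ[k] P} (hι : Function.Injective ι)
    (hker : ∀ p, h p = 0 → p ∈ LinearMap.range ι) (hι0 : ∀ m, h (ι m) = 0) :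
    ∃ cM : H.Comodule M, CoHom cM cP ι := by
  obtain ⟨l, hl⟩ := exists_lift₂_of_injective hι (cP.lact.compl₂ ι) fun b m => hker _ (by
    rw [LinearMap.compl₂_apply, hh.left, hι0, map_zero])
  obtain ⟨r, hr⟩ := exists_lift₂_of_injective hι (cP.ract ∘ₗ ι) fun m b => hker _ (by
    rw [LinearMap.comp_apply, hh.right, hι0, map_zero, LinearMap.zero_apply])
  simp only [LinearMap.compl₂_apply] at hl
  simp only [LinearMap.comp_apply] at hr
  have hlm : IsLeftModule H.algB l :=
    ⟨fun x => hι (by simp [hl]), fun a b x => hι (by simp [hl])⟩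
  have hj : Function.Injective (idMap H.tL.flip hl) :=
    hflat.1 _ _ l cP.lact hlm cP.lact_module ι hl hι
  obtain ⟨δ, hδ⟩ := exists_lift_of_injective hj (cP.δ ∘ₗ ι) fun m => by
    refine idMap_exact hl hflat cP.lact_module cN.lact_module hh.left hker hι0 ?_
    have := hh.colin (ι m)
    rw [hι0, map_zero] at this
    exact (ev_hom (cP.δ (ι m)) (idMap H.tL.flip hh.left)).symm.trans this.symm
  simp only [LinearMap.comp_apply] at hδ
  have hev : ∀ {V : Type u} [AddCommGroup V] [Module k V] {F : L → P → V}
      (_ : H.Bl cP.lact F) (m : M),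
      ev (cP.δ (ι m)) F = ev (δ m) fun X n => F X (ι n) := fun hF m => by
    rw [← hδ, ev_idMap hl hF]
  have hδl : ∀ a m, δ (l a m) = ev (δ m) fun X n => H.dia l (H.algL.mul (H.s a) X) n :=
    fun a m => hj (by
      rw [hδ, hl, cP.δ_lact]
      rw [ev_map]
      exact hev (Comodule.isBal_left cP.lact (H.sL a) (by simp)) m)
  refine ⟨Comodule.ofSweedler (H := H.toLeftBialgebroid) l r hlm
    ⟨fun x => hι (by simp [hr]), fun a b x => hι (by simp [hr])⟩
    (fun a b m => hι (by simp [hr, hl])) δ hδl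
    (fun a m => hj (by
      rw [hδ, hr, cP.δ_ract]
      rw [ev_map]
      exact hev (Comodule.isBal_left cP.lact (H.sR.flip a) (by simp)) m))
    (fun a m => hj (by
      have e₁ := hev (Comodule.isBal_left cP.lact (H.tR.flip a) (by simp)) m
      have e₂ := hev (IsBal.mk_linear (r := H.tL.flip) (l := cP.lact)
        ((H.dia cP.lact).compl₂ (cP.ract.flip a)) (by intro X b n; simp [H.dia_bal])) m
      rw [ev_map, ev_map]
      refine e₁.symm.trans ((cP.δ_tak a (ι m)).trans (e₂.trans (ev_congr _ fun X n => ?_)))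
      rw [idMap_tm, hr]
      rfl))
    (fun m => ?_)
    (fun m => hι (by
      rw [ev_map]
      refine Eq.trans (ev_congr _ fun X n => hl _ _) ?_
      rw [← hev cP.isBal_counit]
      exact cP.counit_ev (ι m))), hl, fun m => ?_⟩
  -- Coassociativity may be checked in `L ⋄ (L ⋄ P)`, by flatness.
  · have hj₂lin : ∀ b w, idMap H.tL.flip hl ((TwoCocycle.cofree H l).lact b w) =
        (TwoCocycle.cofree H cP.lact).lact b (idMap H.tL.flip hl w) := fun b =>
      LinearMap.ext_iff.1 (Bal.hom_ext
        (f := idMap H.tL.flip hl ∘ₗ (TwoCocycle.cofree H l).lact b)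
        (g := (TwoCocycle.cofree H cP.lact).lact b ∘ₗ idMap H.tL.flip hl) fun _ _ => rfl)
    have hj₂ : Function.Injective (idMap H.tL.flip hj₂lin) :=
      hflat.1 _ _ _ _ (TwoCocycle.cofree H l).lact_module
        (TwoCocycle.cofree H cP.lact).lact_module _ hj₂lin hj
    have key : (ev (δ m) fun X n => ev (δ n) fun Y p =>
          H.dia (TwoCocycle.cofree H l).lact X (H.dia l Y p)) =
        ev (δ m) fun X n => ev (H.Δ X) fun Y Z =>
          H.dia (TwoCocycle.cofree H l).lact Y (H.dia l Z n) := by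
      apply hj₂
      have e := cP.coassoc_ev (TwoCocycle.isBal₃_cofree H cP.lact) (ι m)
      have e₁ := hev (cP.isBal_ev_δ (TwoCocycle.isBal₃_cofree H cP.lact)) m
      have e₂ := hev (isBal_ev_Δ (TwoCocycle.isBal₃_cofree H cP.lact)) m
      rw [ev_map, ev_map]
      refine Eq.trans (ev_congr _ fun X n => ?_) (e₁.symm.trans (e.trans (e₂.trans
        (ev_congr _ fun X n => ?_))))
      · rw [ev_map, hev ((TwoCocycle.isBal₃_cofree H cP.lact).right X)]
        rfl
      · rw [ev_map]
        rfl
    have ht := trip_isBal₃ (r₁ := H.tL.flip) (l₁ := H.sL) (r₂ := H.tL.flip) (l₂ := l)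
    have hΨ : H.Bl (TwoCocycle.cofree H l).lact fun X w => blift _ (ht.right X) w :=
      { add_left := fun X X' => LinearMap.ext_iff.1 (Bal.hom_ext
          (f := blift _ (ht.right (X + X'))) (g := blift _ (ht.right X) + blift _ (ht.right X'))
          fun Y n => (ht.left n).add_left X X' Y)
        smul_left := fun c X => LinearMap.ext_iff.1 (Bal.hom_ext
          (f := blift _ (ht.right (c • X))) (g := c • blift _ (ht.right X))
          fun Y n => (ht.left n).smul_left c X Y)
        add_right := fun _ _ _ => map_add _ _ _
        smul_right := fun _ _ _ => map_smul _ _ _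
        bal := fun X b => LinearMap.ext_iff.1 (Bal.hom_ext
          (f := blift _ (ht.right (H.tL.flip X b)))
          (g := blift _ (ht.right X) ∘ₗ (TwoCocycle.cofree H l).lact b)
          fun Y n => (ht.left n).bal X b Y) }
    have := congrArg (blift _ hΨ) key
    simp only [ev_map] at this
    exact this
  · refine (hδ m).symm.trans ?_
    exact (ev_hom (δ m) (idMap H.tL.flip hl)).symm

end LeftBialgebroid
end Kernel

/-! ### Every comodule over the cotwist is a cotwist -/

section Surjectivity

variable {k : Type v} [Field k] {B L : Type u} [AddCommGroup B] [Module k B]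
  [AddCommGroup L] [Module k L] {M N P A R : Type u} [AddCommGroup M] [Module k M]
  [AddCommGroup N] [Module k N] [AddCommGroup P] [Module k P] [AddCommGroup A] [Module k A]
  [AddCommGroup R] [Module k R]
  {Q : Type*} [AddCommGroup Q] [Module k Q]

theorem LeftBialgebroid.Comodule.coHom_idMap {H : LeftBialgebroid k B L} (cP : H.Comodule P)
    (r : P →ₗ[k] B →ₗ[k] P) {l : B →ₗ[k] M →ₗ[k] M} {l' : B →ₗ[k] N →ₗ[k] N} {φ : M →ₗ[k] N}
    (hφ : ∀ b x, φ (l b x) = l' b (φ x)) (hr : ∀ b, CoHom cP cP (r.flip b))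
    (hr' : ∀ p a b, r (cP.ract p a) b = cP.ract (r p b) a) :
    CoHom (cP.leg r l hr hr') (cP.leg r l' hr hr') (idMap r hφ) where
  left b := LinearMap.ext_iff.1 (Bal.hom_ext (f := idMap r hφ ∘ₗ cP.legLact r l hr b)
    (g := cP.legLact r l' hr b ∘ₗ idMap r hφ) fun _ _ => rfl)
  colin z := by
    have hb : H.Bl (cP.legLact r l hr) fun X n => H.dia (cP.legLact r l' hr) X (idMap r hφ n) :=
      IsBal.mk_linear ((H.dia (cP.legLact r l' hr)).compl₂ (idMap r hφ)) (by
        intro X b n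
        revert n
        refine LinearMap.ext_iff.1 (Bal.hom_ext
          (f := H.dia (cP.legLact r l' hr) (H.tL.flip X b) ∘ₗ idMap r hφ)
          (g := H.dia (cP.legLact r l' hr) X ∘ₗ idMap r hφ ∘ₗ cP.legLact r l hr b)
          fun p n => ?_)
        exact tm_bal _ _ X b (tm r l' p (φ n)))
    refine Eq.trans ?_ (ev_eq_blift _ _ hb).symm
    revert z
    refine LinearMap.ext_iff.1 (Bal.hom_ext (f := cP.legδ r l' hr ∘ₗ idMap r hφ)
      (g := blift _ hb ∘ₗ cP.legδ r l hr) fun p n => ?_)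
    exact (cP.ev_legδ r l hr hb p n).symm.trans (ev_eq_blift _ _ hb)

namespace LeftBialgebroid.TwoCocycle

variable {H : LeftHopfAlgebroid k B L} {G : H.TwoCocycle} {hG : G.Invertible}

attribute [local irreducible] tw twist untwist

variable (cM' : (G.cotwist hG).Comodule M)

theorem twL_δ (b : B) (m : M) :
    cM'.δ (cM'.lact b m) = G.twL (G.legΓ cM'.lact) b (cM'.δ m) := by
  refine (cM'.δ_lact b m).trans ?_
  refine Eq.trans ?_ (ev_hom (cM'.δ m) (G.twL (G.legΓ cM'.lact) b))
  exact ev_congr _ fun X n => (G.twL_legΓ cM'.lact b X n).symm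

theorem twR_δ (b : B) (m : M) :
    cM'.δ (cM'.ract m b) = G.twR (G.legΓ cM'.lact) (cM'.δ m) b := by
  refine (cM'.δ_ract b m).trans ?_
  refine Eq.trans ?_ (ev_hom (cM'.δ m) ((G.twR (G.legΓ cM'.lact)).flip b))
  exact ev_congr _ fun X n => (G.twR_legΓ cM'.lact b X n).symm

/-- The map `id ⋄ δ'`. -/
noncomputable abbrev idδ : G.ring.Dia cM'.lact →ₗ[k] G.ring.Dia (G.twL (G.legΓ cM'.lact)) :=
  idMap G.ring.tL.flip (twL_δ cM')

/-- The map `ε^Γ ⋄ id`, a retraction of `δ'`. -/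
noncomputable abbrev retr : G.ring.Dia cM'.lact →ₗ[k] M := blift _ cM'.isBal_counit

theorem retr_δ (m : M) : retr cM' (cM'.δ m) = m :=
  (ev_eq_blift _ _ cM'.isBal_counit).symm.trans (cM'.counit_ev m)

theorem retr_twL (b : B) (z : G.ring.Dia cM'.lact) :
    retr cM' (G.twL (G.legΓ cM'.lact) b z) = cM'.lact b (retr cM' z) := by
  revert z
  refine LinearMap.ext_iff.1 (Bal.hom_ext (f := retr cM' ∘ₗ G.twL (G.legΓ cM'.lact) b)
    (g := cM'.lact b ∘ₗ retr cM') fun X n => ?_)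
  refine (congrArg (retr cM') (G.twL_legΓ cM'.lact b X n)).trans ?_
  change cM'.lact (G.epsΓ (G.mulΓ (H.s b) X)) n = cM'.lact b (cM'.lact (G.epsΓ X) n)
  refine (congrArg (fun c => cM'.lact c n) (G.epsΓ_s_mul b X)).trans ?_
  exact cM'.lact_module.mul_act b (G.epsΓ X) n

theorem idδ_injective : Function.Injective (idδ cM') := by
  refine Function.LeftInverse.injective (g := idMap G.ring.tL.flip (retr_twL cM')) ?_
  exact LinearMap.ext_iff.1 (Bal.hom_ext
    (f := idMap G.ring.tL.flip (retr_twL cM') ∘ₗ idδ cM') (g := LinearMap.id) fun X n =>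
      congrArg (G.ring.dia cM'.lact X) (retr_δ cM' n))

/-- Coassociativity of `δ'`: the maps `Δ^Γ ⋄ id` and `id ⋄ δ'` agree on the image of `δ'`. -/
theorem coact_δ (m : M) :
    G.coact (G.legΓ cM'.lact) rfl hG (cM'.δ m) = idδ cM' (cM'.δ m) := by
  have hT : (G.cotwist hG).Bl₃ cM'.lact fun X Y n =>
      G.ring.dia (G.twL (G.legΓ cM'.lact)) X (G.ring.dia cM'.lact Y n) :=
    { left := fun n => IsBal.mk_linear ((G.ring.dia (G.twL (G.legΓ cM'.lact))).compl₂
          ((G.ring.dia cM'.lact).flip n)) (fun X b Y =>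
            (tm_bal _ _ X b (G.ring.dia cM'.lact Y n)).trans
              (congrArg (G.ring.dia (G.twL (G.legΓ cM'.lact)) X) (G.twL_legΓ cM'.lact b Y n)))
      right := fun X => IsBal.mk_linear ((G.ring.dia cM'.lact).compr₂
          (G.ring.dia (G.twL (G.legΓ cM'.lact)) X)) (fun Y b n =>
            congrArg (G.ring.dia (G.twL (G.legΓ cM'.lact)) X) (tm_bal _ _ Y b n)) }
  have h := cM'.coassoc_ev hT m
  refine Eq.trans ?_ (h.symm.trans ?_)
  · refine (ev_hom (cM'.δ m) (G.coact (G.legΓ cM'.lact) rfl hG)).symm.trans ?_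
    exact ev_congr _ fun X n => G.coact_nat G.ring_sL rfl hG
      (H.reg.coHom_leg G.ring.tL.flip cM'.lact _ _ n) X
  · refine Eq.trans (ev_congr _ fun X n => ?_) (ev_hom (cM'.δ m) (idδ cM'))
    exact ev_hom (cM'.δ n) (G.ring.dia (G.twL (G.legΓ cM'.lact)) X)

/-- The sequence `M → L ⋄_{B^Γ} M ⇉ L ⋄_{B^Γ} (L ⋄_{B^Γ} M)` is exact. -/
theorem eq_δ_of_coact_eq {z : G.ring.Dia cM'.lact}
    (h : G.coact (G.legΓ cM'.lact) rfl hG z = idδ cM' z) : z = cM'.δ (retr cM' z) := by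
  have hb : IsBal G.ring.tL.flip (G.twL (G.legΓ cM'.lact)) fun X w =>
      G.twL (G.legΓ cM'.lact) (G.epsΓ X) w :=
    IsBal.mk_linear (r := G.ring.tL.flip) (G.twL (G.legΓ cM'.lact) ∘ₗ G.epsΓ) (fun X b w => by
      refine (congrArg (fun c => G.twL (G.legΓ cM'.lact) c w) (G.epsΓ_t_mul b X)).trans ?_
      exact (G.twL_module (G.legΓ cM'.lact)).mul_act (G.epsΓ X) b w)
  refine (G.coact_counit (cM := G.legΓ cM'.lact) rfl hG z).symm.trans ?_
  rw [h, ev_eq_blift _ _ hb]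
  exact LinearMap.ext_iff.1 (Bal.hom_ext (f := blift _ hb ∘ₗ idδ cM') (g := cM'.δ ∘ₗ retr cM')
    fun X n => (twL_δ cM' (G.epsΓ X) n).symm) z

/-- Every comodule over the cotwist is a cotwist. The comodule is recovered as the kernel of the
difference of the two maps `Δ^Γ ⋄ id` and `id ⋄ δ'`, which are morphisms of `L`-comodules. -/
theorem exists_isCotwistComodule (hflat : IsFaithfullyFlatRight H.algB H.tL.flip) :
    ∃ cM : H.Comodule M, H.IsCotwistComodule G (G.cotwist hG) cM cM' := by
  have hinj : Function.Injective cM'.δ := Function.LeftInverse.injective (retr_δ cM')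
  have hf := G.coHom_coact (cM := G.legΓ cM'.lact) rfl hG
  have hg := H.reg.coHom_idMap G.ring.tL.flip (twL_δ cM')
    (fun b => by rw [ring_tL]; exact H.commutes_reg_cT.coHom_twR G b)
    (fun p a b => by rw [ring_tL]; exact H.commutes_reg_cT.ract_act G (H.s b) p a)
  obtain ⟨cM, hι⟩ := exists_comodule_of_kernel (H := H) hflat (hf.sub hg) hinj
    (fun p hp => ⟨retr cM' p, (eq_δ_of_coact_eq cM' (sub_eq_zero.1 hp)).symm⟩)
    (fun m => sub_eq_zero.2 (coact_δ cM' m))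
  have hl : cM'.lact = G.twL cM := LinearMap.ext₂ fun b m =>
    hinj ((twL_δ cM' b m).trans (G.twL_nat hι b m))
  have hr : cM'.ract = G.twR cM := LinearMap.ext₂ fun m b =>
    hinj ((twR_δ cM' b m).trans (G.twR_nat hι b m))
  refine ⟨cM, isCotwistComodule_mk hl hr fun m => ?_⟩
  have h : G.coact cM hl hG m = cM'.δ m := by
    apply idδ_injective
    rw [← coact_δ]
    refine Eq.trans ?_ (G.coact_nat hl rfl hG hι m).symm
    exact (ev_hom (G.coact cM hl hG m) (idδ cM')).symm
  rw [← h]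
  exact G.twist_coact hl hG m

end LeftBialgebroid.TwoCocycle
end Surjectivity

end HopfCotwist

theorem mainTheorem7 {k : Type v} [Field k] {B L : Type u} [AddCommGroup B] [Module k B]
    [AddCommGroup L] [Module k L] (H : HopfCotwist.LeftHopfAlgebroid k B L)
    (hflat : H.IsFaithfullyFlat)
    (G : HopfCotwist.LeftBialgebroid.TwoCocycle H.toLeftBialgebroid) (hG : G.Invertible) :
    -- the cotwist `H' = L^Γ` is a left Hopf algebroid, and `S` is a left 2-cocycle `Σ` on it
    ∃ (H' : HopfCotwist.LeftHopfAlgebroid k B L)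
      (S : HopfCotwist.LeftBialgebroid.TwoCocycle H'.toLeftBialgebroid),
      H.IsCotwist G H' ∧
      -- `Σ(X, Y) = Γ(X₊ Y₊, Γ(Y₋₁, X₋₁) Y₋₂ X₋₂)`
      (∀ (X Y : L) (x y : L ⊗[k] (L ⊗[k] L)), H.RepPlusMinusDelta X x →
        H.RepPlusMinusDelta Y y → S.Γ X Y = H.inverseForm G.Γ x y) ∧
      S.Invertible ∧
      -- every comodule over `L` has a cotwist, every comodule over `L^Γ` is such a cotwist
      (∀ (M : Type u) [AddCommGroup M] [Module k M] (cM : H.Comodule M),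
        ∃ cM' : H'.Comodule M, H.IsCotwistComodule G H' cM cM') ∧
      (∀ (M : Type u) [AddCommGroup M] [Module k M] (cM' : H'.Comodule M),
        ∃ cM : H.Comodule M, H.IsCotwistComodule G H' cM cM') ∧
      -- `Γ^# : M ⊗_{B^Γ} N → M ⊗_B N` and `Σ^# : M ⊗_B N → M ⊗_{B^Γ} N` are mutually inverse
      (∀ (M N : Type u) [AddCommGroup M] [Module k M] [AddCommGroup N] [Module k N]
        (cM : H.Comodule M) (cN : H.Comodule N) (cM' : H'.Comodule M) (cN' : H'.Comodule N),
        H.IsCotwistComodule G H' cM cM' → H.IsCotwistComodule G H' cN cN' →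
        ∀ x y : M ⊗[k] N,
          G.sharp cM cN (HopfCotwist.toBal (G.twR cM) (G.twL cN) x) =
              HopfCotwist.toBal cM.ract cN.lact y ↔
            S.sharp cM' cN' (HopfCotwist.toBal (S.twR cM') (S.twL cN') y) =
              HopfCotwist.toBal cM'.ract cN'.lact x) ∧
      -- `(L^Γ)^Σ = L`
      H'.IsCotwist S H := by
  open HopfCotwist.LeftBialgebroid.TwoCocycle in
  refine ⟨G.cotwist hG, G.sigma hG, isCotwist_cotwist G hG,
    fun X Y x y hx hy => sigma_eq_inverseForm G hG hx hy, ?_,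
    fun M _ _ cM => ⟨G.cotwistComodule hG cM, isCotwistComodule_cotwistComodule G hG cM⟩,
    fun M _ _ cM' => exists_isCotwistComodule cM' hflat.2.2.1,
    fun M N _ _ _ _ cM cN cM' cN' hM hN x y => sharp_eq_iff hM hN x y, isCotwist_sigma G hG⟩
  intro M N _ _ _ _ cM' cN'
  obtain ⟨cM, hM⟩ := exists_isCotwistComodule cM' hflat.2.2.1
  obtain ⟨cN, hN⟩ := exists_isCotwistComodule cN' hflat.2.2.1
  exact sigma_sharp_bijective hM hN
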